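/- A \emph{one-pass streaming algorithm} is a fixed finite randomized program with a fixed number of integer registers (arithmetic $+,-,\cdot$, integer division and remainder, comparisons, while-loops, fair coin flips). It is given the dimension $n$ and $\lceil\log_2(1/\delta)\rceil$ as input, is presented one after another with updates $(i,u)\in[n]\times\mathbb Z$, and finally outputs an index in $[n]=\{1,\dots,n\}$ or FAIL. The stream defines a vector $x\in\mathbb Z^n$: initially $x=0$, and the update $(i,u)$ adds $u$ to $x_i$. The algorithm \emph{uses at most $S$ bits} if on every admissible stream and for every outcome of the coin flips it halts, the total bit length of all registers and intermediate results never exceeds $S$, and at most $S$ coins are flipped (there is no random oracle: a coin is read once, and has to be stored in a register to be used again). \textbf{Theorem.} For all constants $a,c\in\mathbb N$ there are a one-pass streaming algorithm and a constant $C$ such that for all $n\ge 2$ and all real $\delta$ with $0<\delta\le 1/2$ the following holds. Call a stream \emph{admissible} if all coordinates of $x$ are bounded by $n^a$ in absolute value throughout the stream. On admissible streams the algorithm uses at most $C\log^2 n\,\log(1/\delta)$ bits. Whenever the final vector $x$ of an admissible stream is non-zero, then \begin{enumerate} \item the algorithm outputs an index with probability at least $1-\delta$, and \item it is a zero relative error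 $L_0$-sampler: conditioned on no failure, each index $i$ with $x_i\neq0$ is output with probability within $n^{-c}$ of $1/k$, where $k=|\{j: x_j\ne0\}|$, and each index $i$ with $x_i=0$ is output with probability at most $n^{-c}$. \end{enumerate} -/

import Mathlib

/-! # Randomised one-pass streaming algorithms with bit-counted memory

The machine model is a uniform one: a streaming algorithm is a fixed finite program, with a fixed
number of integer registers, that works for all dimensions and all failure parameters.  The space
it uses is the total number of bits held in its registers at any time (including all intermediate
values of arithmetic expressions), and also the number of coin flips is charged. -/

namespace L0Streaming

/-- Elementary operations on integers; each of them can be carried out in space linear in the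
bit lengths of the operands. Division and remainder are Euclidean, comparisons return `0` or `1`. -/
inductive BinOp where
  | add | sub | mul | div | mod | eq | lt

/-- The value of an elementary operation. -/
def BinOp.eval : BinOp → ℤ → ℤ → ℤ
  | .add, x, y => x + y
  | .sub, x, y => x - y
  | .mul, x, y => x * y
  | .div, x, y => x / y
  | .mod, x, y => x % y
  | .eq, x, y => if x = y then 1 else 0
  | .lt, x, y => if x < y then 1 else 0

/-- Arithmetic expressions over `k` integer registers. -/
inductive Expr (k : ℕ) where
  | lit (z : ℤ)
  | reg (r : Fin k)
  | bin (o : BinOp) (e f : Expr k)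

/-- The contents of `k` integer registers. -/
abbrev Store (k : ℕ) := Fin k → ℤ

/-- Number of bits needed to store an integer: its binary length and a sign bit. -/
def bits (z : ℤ) : ℕ := Nat.size z.natAbs + 1

/-- Number of bits held in memory: the total length of all registers. -/
def Store.bits {k : ℕ} (σ : Store k) : ℕ := ∑ r, L0Streaming.bits (σ r)

/-- The value of an expression. -/
def Expr.eval {k : ℕ} : Expr k → Store k → ℤ
  | .lit z, _ => z
  | .reg r, σ => σ r
  | .bin o e f, σ => o.eval (e.eval σ) (f.eval σ)

/-- Working memory for the evaluation of an expression: the total length of the values of all its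
subexpressions. -/
def Expr.bits {k : ℕ} : Expr k → Store k → ℕ
  | .lit z, _ => L0Streaming.bits z
  | .reg r, σ => L0Streaming.bits (σ r)
  | .bin o e f, σ =>
      L0Streaming.bits (o.eval (e.eval σ) (f.eval σ)) + e.bits σ + f.bits σ

/-- Programs over `k` integer registers with access to fair coin flips. Conditions are expressions,
and a condition holds when its value is not `0`. -/
inductive Cmd (k : ℕ) where
  | skip
  | assign (r : Fin k) (e : Expr k)
  | flip (r : Fin k)
  | seq (c d : Cmd k)
  | ite (e : Expr k) (c d : Cmd k)
  | loop (e : Expr k) (c : Cmd k)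

/-- `Cmd.RunsIn S p σ w σ' w'`: started with memory `σ` and the sequence `w` of outcomes of future
coin flips, the program `p` halts with memory `σ'` and the unused coins `w'`, and at no time does
it use more than `S` bits of memory. Each coin can be read only once, and flipping needs a coin to
be left in the sequence. -/
inductive Cmd.RunsIn {k : ℕ} (S : ℕ) :
    Cmd k → Store k → List Bool → Store k → List Bool → Prop
  | skip (σ : Store k) (w : List Bool) :
      σ.bits ≤ S → Cmd.RunsIn S .skip σ w σ w
  | assign (r : Fin k) (e : Expr k) (σ : Store k) (w : List Bool) :
      σ.bits + e.bits σ ≤ S →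
      Store.bits (Function.update σ r (e.eval σ)) ≤ S →
      Cmd.RunsIn S (.assign r e) σ w (Function.update σ r (e.eval σ)) w
  | flip (r : Fin k) (σ : Store k) (b : Bool) (w : List Bool) :
      σ.bits ≤ S →
      Store.bits (Function.update σ r (if b then 1 else 0)) ≤ S →
      Cmd.RunsIn S (.flip r) σ (b :: w) (Function.update σ r (if b then 1 else 0)) w
  | seq (c d : Cmd k) (σ σ₁ σ₂ : Store k) (w w₁ w₂ : List Bool) :
      Cmd.RunsIn S c σ w σ₁ w₁ → Cmd.RunsIn S d σ₁ w₁ σ₂ w₂ →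
      Cmd.RunsIn S (.seq c d) σ w σ₂ w₂
  | ite_true (e : Expr k) (c d : Cmd k) (σ σ₁ : Store k) (w w₁ : List Bool) :
      σ.bits + e.bits σ ≤ S → e.eval σ ≠ 0 → Cmd.RunsIn S c σ w σ₁ w₁ →
      Cmd.RunsIn S (.ite e c d) σ w σ₁ w₁
  | ite_false (e : Expr k) (c d : Cmd k) (σ σ₁ : Store k) (w w₁ : List Bool) :
      σ.bits + e.bits σ ≤ S → e.eval σ = 0 → Cmd.RunsIn S d σ w σ₁ w₁ →
      Cmd.RunsIn S (.ite e c d) σ w σ₁ w₁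
  | loop_true (e : Expr k) (c : Cmd k) (σ σ₁ σ₂ : Store k) (w w₁ w₂ : List Bool) :
      σ.bits + e.bits σ ≤ S → e.eval σ ≠ 0 → Cmd.RunsIn S c σ w σ₁ w₁ →
      Cmd.RunsIn S (.loop e c) σ₁ w₁ σ₂ w₂ →
      Cmd.RunsIn S (.loop e c) σ w σ₂ w₂
  | loop_false (e : Expr k) (c : Cmd k) (σ : Store k) (w : List Bool) :
      σ.bits + e.bits σ ≤ S → e.eval σ = 0 →
      Cmd.RunsIn S (.loop e c) σ w σ w

/-- The final memory and the coins used are determined by the initial memory and the coins. -/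
theorem Cmd.RunsIn.det {k S T : ℕ} {p : Cmd k} {σ σ₁ σ₂ : Store k} {w w₁ w₂ : List Bool}
    (h₁ : Cmd.RunsIn S p σ w σ₁ w₁) (h₂ : Cmd.RunsIn T p σ w σ₂ w₂) : σ₁ = σ₂ ∧ w₁ = w₂ := by
  induction h₁ generalizing σ₂ w₂ with
  | skip => cases h₂; simp
  | assign => cases h₂; simp
  | flip => cases h₂; simp
  | seq c d σ σ₁ σ₃ w w₁ w₃ _ _ ih1 ih2 =>
    cases h₂ with
    | seq _ _ _ _ _ _ _ _ a b =>
      obtain ⟨rfl, rfl⟩ := ih1 a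
      exact ih2 b
  | ite_true e c d σ σ₁ w w₁ _ he _ ih =>
    cases h₂ with
    | ite_true _ _ _ _ _ _ _ _ _ a => exact ih a
    | ite_false _ _ _ _ _ _ _ _ he' _ => exact absurd he' he
  | ite_false e c d σ σ₁ w w₁ _ he _ ih =>
    cases h₂ with
    | ite_true _ _ _ _ _ _ _ _ he' _ => exact absurd he he'
    | ite_false _ _ _ _ _ _ _ _ _ a => exact ih a
  | loop_true e c σ σ₁ σ₃ w w₁ w₃ _ he _ _ ih1 ih2 =>
    cases h₂ with
    | loop_true _ _ _ _ _ _ _ _ _ _ a b =>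
      obtain ⟨rfl, rfl⟩ := ih1 a
      exact ih2 b
    | loop_false _ _ _ _ _ he' => exact absurd he' he
  | loop_false e c σ w _ he =>
    cases h₂ with
    | loop_true _ _ _ _ _ _ _ _ _ he' _ _ => exact absurd he he'
    | loop_false => simp

/-- A one-pass streaming algorithm: three fixed programs over `regs + 5` registers, run before the
stream starts, after the arrival of each update, and at the end of the stream. Register `0`
initially holds the dimension, register `1` the failure parameter; the index and the amount of an
arriving update are written to registers `2` and `3`; the output is read from register `4`. -/
structure StreamAlg where
  regs : ℕ
  init : Cmd (regs + 5)
  update : Cmd (regs + 5)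
  output : Cmd (regs + 5)

/-- The initial memory for dimension `n` and failure parameter `d`; all other registers are `0`. -/
def StreamAlg.start (A : StreamAlg) (n d : ℕ) : Store (A.regs + 5) :=
  Function.update (Function.update (fun _ => 0) 0 (n : ℤ)) 1 (d : ℤ)

/-- The memory after the arrival of the update `(i, u)`. The coordinates `0, …, n - 1` of `Fin n`
are presented to the algorithm as `1, …, n`. -/
def StreamAlg.receive (A : StreamAlg) {n : ℕ} (σ : Store (A.regs + 5)) (i : Fin n) (u : ℤ) :
    Store (A.regs + 5) :=
  Function.update (Function.update σ 2 ((i : ℤ) + 1)) 3 u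

/-- Processing a stream of updates one by one, using at most `S` bits of memory. -/
def StreamAlg.ProcessesIn (A : StreamAlg) (S : ℕ) {n : ℕ} :
    List (Fin n × ℤ) → Store (A.regs + 5) → List Bool → Store (A.regs + 5) → List Bool → Prop
  | [], σ, w, σ', w' => σ' = σ ∧ w' = w
  | (i, u) :: L, σ, w, σ', w' =>
      ∃ σ₁ w₁, Cmd.RunsIn S A.update (A.receive σ i u) w σ₁ w₁ ∧
        A.ProcessesIn S L σ₁ w₁ σ' w'

/-- With the coins `w`, the algorithm halts on the stream `L` with output value `v`, using at most
`S` bits of memory throughout. -/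
def StreamAlg.RunsIn (A : StreamAlg) (S n d : ℕ) (L : List (Fin n × ℤ)) (w : List Bool) (v : ℤ) :
    Prop :=
  ∃ σ₁ w₁ σ₂ w₂ σ₃ w₃,
    Cmd.RunsIn S A.init (A.start n d) w σ₁ w₁ ∧
    A.ProcessesIn S L σ₁ w₁ σ₂ w₂ ∧
    Cmd.RunsIn S A.output σ₂ w₂ σ₃ w₃ ∧ σ₃ 4 = v

/-- On the stream `L` the algorithm halts for every outcome of its coin flips, uses at most `S`
bits of memory and flips at most `S` coins. -/
def StreamAlg.HasSpace (A : StreamAlg) (S n d : ℕ) (L : List (Fin n × ℤ)) : Prop :=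
  ∀ w : Fin S → Bool, ∃ v, A.RunsIn S n d L (List.ofFn w) v

/-- The probability, over `S` fair coin flips, that the algorithm outputs the coordinate `i`. -/
noncomputable def StreamAlg.outProb (A : StreamAlg) (S n d : ℕ) (L : List (Fin n × ℤ))
    (i : Fin n) : ℝ :=
  (Nat.card {w : Fin S → Bool // A.RunsIn S n d L (List.ofFn w) ((i : ℤ) + 1)} : ℝ) / 2 ^ S

/-- The probability that the algorithm outputs some coordinate; any output value other than
`1, …, n` counts as a failure. -/
noncomputable def StreamAlg.successProb (A : StreamAlg) (S n d : ℕ) (L : List (Fin n × ℤ)) : ℝ :=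
  (Nat.card {w : Fin S → Bool //
    ∃ i : Fin n, A.RunsIn S n d L (List.ofFn w) ((i : ℤ) + 1)} : ℝ) / 2 ^ S

/-- The vector defined by a stream of updates. -/
def streamVec {n : ℕ} (L : List (Fin n × ℤ)) : Fin n → ℤ :=
  (L.map fun p => Pi.single p.1 p.2).sum

/-- All coordinates of the vector remain bounded by `M` throughout the stream. -/
def BoundedThroughout {n : ℕ} (M : ℕ) (L : List (Fin n × ℤ)) : Prop :=
  ∀ L', L' <+: L → ∀ i, |streamVec L' i| ≤ (M : ℤ)

/-- The `L₀` distribution of a non-zero vector: the uniform distribution on its support. -/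
noncomputable def l0Dist {n : ℕ} (x : Fin n → ℤ) (i : Fin n) : ℝ :=
  if x i = 0 then 0 else 1 / (Nat.card {j // x j ≠ 0} : ℝ)

end L0Streaming

namespace L0Streaming

/-! ## Executions with bounded registers at loop heads -/

/-! A copy of the sketch draws a random polynomial hash function `h` with `m = O(log n)`
coefficients over the field with `p` elements, and a random point `r` of that field. Level `j` keeps
the coordinates `i` with `h(i) * 2 ^ j < p`, and the sketch stores, per level, the sum of the kept
coordinates and the fingerprint `∑ x_i * (r ^ i mod p)`. If `i` is the only support point at a
level, then sum times `r ^ i` minus fingerprint vanishes modulo `p`. If another support point is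
present, this difference is a nonzero polynomial in `r` of degree at most `n`, so few `r` are
misleading (`card_roots_le`, `card_misled_le`). The levels are nested, hence at most one support
point can be alone at some level (`Isolated.unique`), and apart from misleading `r` a copy outputs
exactly this point, or fails if there is none (`copyOut_eq_iff`).

With a fully independent hash function the probability that a given support point becomes isolated
would depend only on the size `k` of the support (`isoProb`); this symmetry is the source of
uniformity. Isolation of `i` means that no other support point reaches the deepest level of `i`.
Bonferroni inequalities truncated at order `4 * β` see only `4 * β + 1` points at a time, so limited
independence changes the probability by `O(2 ^ (-β))` (`abs_avg_avoid_sub_le`, `avg_isolated`). A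
single level that thins the support by a factor of order `k` already shows that some point is
isolated with constant probability (`le_card_mul_isoProb`). Hence conditioning on success only
multiplies the errors by a constant and a factor `n` (`copyProb_spec`).

Of `12 * d` copies with independent seeds the first successful one is used. All of them fail with
probability at most `(7 / 8) ^ (12 * d)`, and conditioned on success the output has exactly the law
of one copy (`outDist_mul`). The base `p` digits of the seeds are those of one binary number made of
coins; the resulting bias is small because the output is periodic in that number
(`abs_average_sub_le`, `repeated_spec`).

On the machine, seed and sketch are one integer each. An update adds `u` times a column of digits to
the sketch, which is therefore linear in the stream (`pack_eq_sum_column`). There are `d * O(log n)`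
slots and `d * O(log n)` random digits, all of `O(log n)` bits. To count memory it suffices to bound
registers at loop heads: between two such moments only a fixed number of operations is carried out
(`Cmd.Exec.runsIn`). The result for the complete program is `sampler_runsIn`. -/

/-- All registers are at most `2 ^ b` in absolute value. -/
def Store.Bdd {k : ℕ} (b : ℕ) (σ : Store k) : Prop := ∀ r, |σ r| ≤ 2 ^ b

theorem Store.Bdd.mono {k b B : ℕ} {σ : Store k} (h : σ.Bdd b) (hb : b ≤ B) : σ.Bdd B :=
  fun r => (h r).trans (pow_le_pow_right₀ (by norm_num) hb)

theorem Store.Bdd.update {k b : ℕ} {σ : Store k} (h : σ.Bdd b) (r : Fin k) {v : ℤ}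
    (hv : |v| ≤ 2 ^ b) : Store.Bdd b (Function.update σ r v) := by
  intro s
  rw [Function.update_apply]
  split_ifs
  · exact hv
  · exact h s

/-- `Cmd.Exec b p σ w σ' w'`: the program `p` leads from `σ, w` to `σ', w'`, and all registers are
at most `2 ^ b` whenever the condition of a loop is evaluated. -/
inductive Cmd.Exec {k : ℕ} (b : ℕ) :
    Cmd k → Store k → List Bool → Store k → List Bool → Prop
  | skip (σ : Store k) (w : List Bool) : Cmd.Exec b .skip σ w σ w
  | assign (r : Fin k) (e : Expr k) (σ : Store k) (w : List Bool) :
      Cmd.Exec b (.assign r e) σ w (Function.update σ r (e.eval σ)) w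
  | flip (r : Fin k) (σ : Store k) (a : Bool) (w : List Bool) :
      Cmd.Exec b (.flip r) σ (a :: w) (Function.update σ r (if a then 1 else 0)) w
  | seq (c d : Cmd k) (σ σ₁ σ₂ : Store k) (w w₁ w₂ : List Bool) :
      Cmd.Exec b c σ w σ₁ w₁ → Cmd.Exec b d σ₁ w₁ σ₂ w₂ → Cmd.Exec b (.seq c d) σ w σ₂ w₂
  | ite_true (e : Expr k) (c d : Cmd k) (σ σ₁ : Store k) (w w₁ : List Bool) :
      e.eval σ ≠ 0 → Cmd.Exec b c σ w σ₁ w₁ → Cmd.Exec b (.ite e c d) σ w σ₁ w₁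
  | ite_false (e : Expr k) (c d : Cmd k) (σ σ₁ : Store k) (w w₁ : List Bool) :
      e.eval σ = 0 → Cmd.Exec b d σ w σ₁ w₁ → Cmd.Exec b (.ite e c d) σ w σ₁ w₁
  | loop_true (e : Expr k) (c : Cmd k) (σ σ₁ σ₂ : Store k) (w w₁ w₂ : List Bool) :
      σ.Bdd b → e.eval σ ≠ 0 → Cmd.Exec b c σ w σ₁ w₁ →
      Cmd.Exec b (.loop e c) σ₁ w₁ σ₂ w₂ → Cmd.Exec b (.loop e c) σ w σ₂ w₂
  | loop_false (e : Expr k) (c : Cmd k) (σ : Store k) (w : List Bool) :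
      σ.Bdd b → e.eval σ = 0 → Cmd.Exec b (.loop e c) σ w σ w

theorem Cmd.Exec.bdd_of_loop {k b : ℕ} {e : Expr k} {c : Cmd k} {σ σ' : Store k}
    {w w' : List Bool} (h : Cmd.Exec b (.loop e c) σ w σ' w') : σ.Bdd b := by
  cases h <;> assumption

/-! ### Space of an execution -/

/-- The value of `e` has at most `e.sz` times as many bits as the registers. -/
def Expr.sz {k : ℕ} : Expr k → ℕ
  | .lit z => z.natAbs + 1
  | .reg _ => 1
  | .bin _ e f => e.sz + f.sz

/-- Bound for the working memory of an expression, in multiples of the register length. -/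
def Expr.cst {k : ℕ} : Expr k → ℕ
  | .lit z => 2 * (z.natAbs + 1)
  | .reg _ => 2
  | .bin o e f => 2 * (Expr.bin o e f).sz + e.cst + f.cst

theorem Expr.one_le_sz {k : ℕ} (e : Expr k) : 1 ≤ e.sz := by
  induction e with
  | lit z => simp [Expr.sz]
  | reg => simp [Expr.sz]
  | bin o e f he hf => simp only [Expr.sz]; omega

theorem add_two_pow_le {x y : ℕ} (hx : 1 ≤ x) (hy : 1 ≤ y) :
    (2 : ℤ) ^ x + 2 ^ y ≤ 2 ^ (x + y) := by
  have h1 : (2 : ℤ) ^ 1 ≤ 2 ^ x := pow_le_pow_right₀ (by norm_num) hx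
  have h2 : (2 : ℤ) ^ 1 ≤ 2 ^ y := pow_le_pow_right₀ (by norm_num) hy
  rw [pow_add]
  nlinarith

theorem abs_emod_le_max (x y : ℤ) : |x % y| ≤ max |x| |y| := by
  rcases eq_or_ne y 0 with rfl | hy
  · simp
  · rw [abs_of_nonneg (Int.emod_nonneg _ hy)]
    exact le_max_of_le_right (Int.emod_lt_abs _ hy).le

/-- For products the exponents add; a sum of two powers of two with positive exponents is at most
their product; quotients and remainders do not exceed an operand. So bit lengths grow at most by the
factor `Expr.sz`, which depends on the program text alone. -/
theorem BinOp.abs_eval_le (o : BinOp) {x y : ℤ} {s t : ℕ} (hs : 1 ≤ s) (ht : 1 ≤ t)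
    (hx : |x| ≤ 2 ^ s) (hy : |y| ≤ 2 ^ t) : |o.eval x y| ≤ 2 ^ (s + t) := by
  have hadd := add_two_pow_le hs ht
  have h1 : (1 : ℤ) ≤ 2 ^ (s + t) := one_le_pow₀ (by norm_num)
  have hs' : (0 : ℤ) ≤ 2 ^ s := by positivity
  have ht' : (0 : ℤ) ≤ 2 ^ t := by positivity
  cases o with
  | add => exact (abs_add_le x y).trans (by linarith)
  | sub => exact (abs_sub x y).trans (by linarith)
  | mul =>
    simp only [BinOp.eval, abs_mul, pow_add]
    exact mul_le_mul hx hy (abs_nonneg _) hs'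
  | div =>
    have : |x / y| ≤ |x| := Int.abs_ediv_le_abs x y
    exact this.trans (by linarith)
  | mod => exact (abs_emod_le_max x y).trans (max_le (by linarith) (by linarith))
  | eq => simp only [BinOp.eval]; split_ifs <;> simp [h1]
  | lt => simp only [BinOp.eval]; split_ifs <;> simp [h1]

theorem Expr.abs_eval_le {k B : ℕ} (hB : 1 ≤ B) {σ : Store k} (h : σ.Bdd B) (e : Expr k) :
    |e.eval σ| ≤ 2 ^ (B * e.sz) := by
  induction e with
  | lit z =>
    simp only [Expr.eval, Expr.sz]
    have h1 : z.natAbs < 2 ^ z.natAbs := Nat.lt_two_pow_self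
    have h2 : (2 : ℕ) ^ z.natAbs ≤ 2 ^ (B * (z.natAbs + 1)) :=
      pow_le_pow_right₀ (by norm_num) ((Nat.le_succ _).trans (Nat.le_mul_of_pos_left _ hB))
    rw [Int.abs_eq_natAbs]
    exact_mod_cast h1.le.trans h2
  | reg r => simpa [Expr.eval, Expr.sz] using h r
  | bin o e f he hf =>
    simp only [Expr.eval, Expr.sz, mul_add]
    exact o.abs_eval_le (Nat.mul_pos hB e.one_le_sz) (Nat.mul_pos hB f.one_le_sz) he hf

theorem bits_le_of_abs_le {z : ℤ} {x : ℕ} (h : |z| ≤ 2 ^ x) : bits z ≤ x + 2 := by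
  have h1 : z.natAbs < 2 ^ (x + 1) := by
    rw [Int.abs_eq_natAbs] at h
    have : z.natAbs ≤ 2 ^ x := by exact_mod_cast h
    have : 0 < 2 ^ x := by positivity
    rw [pow_succ]; omega
  have := Nat.size_le.2 h1
  unfold bits; omega

theorem Store.bits_le {k B : ℕ} {σ : Store k} (h : σ.Bdd B) : σ.bits ≤ 2 * k * (B + 1) := by
  unfold Store.bits
  calc ∑ r, L0Streaming.bits (σ r) ≤ ∑ _r : Fin k, 2 * (B + 1) :=
        Finset.sum_le_sum fun r _ => (bits_le_of_abs_le (h r)).trans (by omega)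
    _ = 2 * k * (B + 1) := by simp; ring

theorem Expr.bits_le {k B : ℕ} (hB : 1 ≤ B) {σ : Store k} (h : σ.Bdd B) (e : Expr k) :
    e.bits σ ≤ e.cst * (B + 1) := by
  have key : ∀ e : Expr k, L0Streaming.bits (e.eval σ) ≤ 2 * e.sz * (B + 1) := fun e => by
    have h1 := bits_le_of_abs_le (e.abs_eval_le hB h)
    have h2 := e.one_le_sz
    nlinarith
  induction e with
  | lit z => simpa [Expr.bits, Expr.cst, Expr.sz, Expr.eval] using key (.lit z)
  | reg r => simpa [Expr.bits, Expr.cst, Expr.sz, Expr.eval] using key (.reg r)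
  | bin o e f he hf =>
    have := key (.bin o e f)
    simp only [Expr.bits, Expr.cst, add_mul]
    simp only [Expr.eval] at this
    omega

/-- The factor by which the register length may grow between the last loop and the end. -/
def Cmd.grow {k : ℕ} : Cmd k → ℕ
  | .skip => 1
  | .assign _ e => e.sz
  | .flip _ => 1
  | .seq c d => c.grow * d.grow
  | .ite _ c d => c.grow * d.grow
  | .loop _ _ => 1

/-- Bound for the memory used by a program, in multiples of the register length. -/
def Cmd.cst {k : ℕ} : Cmd k → ℕ
  | .skip => 2 * k
  | .assign _ e => 2 * k * e.sz + e.cst + 2 * k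
  | .flip _ => 2 * k
  | .seq c d => c.cst + c.grow * d.cst
  | .ite e c d => 2 * k + e.cst + c.cst + d.cst
  | .loop e c => 2 * k + e.cst + c.cst

theorem Cmd.one_le_grow {k : ℕ} (c : Cmd k) : 1 ≤ c.grow := by
  induction c with
  | assign r e => exact e.one_le_sz
  | seq c d hc hd => exact Nat.mul_pos hc hd
  | ite e c d hc hd => exact Nat.mul_pos hc hd
  | _ => simp [Cmd.grow]

/-- Straight-line code multiplies register lengths by a constant factor read off from its text, and
every loop head resets the length to `b`. Therefore the memory is a constant multiple of `b`,
however long the execution takes. The bound `B` is kept general because the second part of a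
sequence starts from the registers left by the first. -/
theorem Cmd.Exec.runsIn {k b : ℕ} (hb : 1 ≤ b) {c : Cmd k} {σ σ' : Store k} {w w' : List Bool}
    (h : Cmd.Exec b c σ w σ' w') : ∀ B, b ≤ B → σ.Bdd B →
      σ'.Bdd (B * c.grow) ∧ ∀ S, c.cst * (B + 1) ≤ S → Cmd.RunsIn S c σ w σ' w' := by
  induction h with
  | skip σ w =>
    intro B hB hσ
    refine ⟨by simpa [Cmd.grow] using hσ, fun S hS => .skip _ _ ?_⟩
    exact (Store.bits_le hσ).trans hS
  | assign r e σ w =>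
    intro B hB hσ
    have h1 : Store.Bdd (B * e.sz) (Function.update σ r (e.eval σ)) :=
      (hσ.mono (Nat.le_mul_of_pos_right _ e.one_le_sz)).update r
        (e.abs_eval_le (hb.trans hB) hσ)
    refine ⟨h1, fun S hS => .assign _ _ _ _ ?_ ?_⟩
    · have h2 := Store.bits_le hσ
      have h3 := e.bits_le (hb.trans hB) hσ
      simp only [Cmd.cst, add_mul] at hS h2
      omega
    · have h2 := Store.bits_le h1
      have h3 := e.one_le_sz
      refine h2.trans (le_trans ?_ hS)
      simp only [Cmd.cst]
      have : B * e.sz + 1 ≤ e.sz * (B + 1) := by nlinarith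
      calc 2 * k * (B * e.sz + 1) ≤ 2 * k * (e.sz * (B + 1)) := Nat.mul_le_mul_left _ this
        _ ≤ _ := by
          rw [← mul_assoc]
          exact Nat.mul_le_mul_right _ (by omega)
  | flip r σ a w =>
    intro B hB hσ
    have h1 : Store.Bdd B (Function.update σ r (if a then 1 else 0)) :=
      hσ.update r (by split_ifs <;> simp [one_le_pow₀])
    exact ⟨by simpa [Cmd.grow] using h1, fun S hS =>
      .flip _ _ _ _ ((Store.bits_le hσ).trans hS) ((Store.bits_le h1).trans hS)⟩
  | seq c d σ σ₁ σ₂ w w₁ w₂ _ _ ih1 ih2 =>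
    intro B hB hσ
    obtain ⟨h1, h2⟩ := ih1 B hB hσ
    have hg := c.one_le_grow
    obtain ⟨h3, h4⟩ := ih2 _ (hB.trans (Nat.le_mul_of_pos_right _ hg)) h1
    refine ⟨by simpa [Cmd.grow, mul_assoc] using h3, fun S hS => ?_⟩
    simp only [Cmd.cst] at hS
    refine .seq _ _ _ σ₁ _ _ w₁ _ (h2 S (le_trans ?_ hS)) (h4 S (le_trans ?_ hS))
    · exact Nat.mul_le_mul_right _ (Nat.le_add_right _ _)
    have : B * c.grow + 1 ≤ c.grow * (B + 1) := by nlinarith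
    calc d.cst * (B * c.grow + 1) ≤ d.cst * (c.grow * (B + 1)) := Nat.mul_le_mul_left _ this
      _ ≤ _ := by nlinarith
  | ite_true e c d σ σ₁ w w₁ he _ ih =>
    intro B hB hσ
    obtain ⟨h1, h2⟩ := ih B hB hσ
    refine ⟨h1.mono ?_, fun S hS => ?_⟩
    · exact Nat.mul_le_mul_left _ (Nat.le_mul_of_pos_right _ d.one_le_grow)
    · have h3 := Store.bits_le hσ
      have h4 := e.bits_le (hb.trans hB) hσ
      simp only [Cmd.cst, add_mul] at hS
      exact .ite_true _ _ _ _ _ _ _ (by omega) he (h2 S (by omega))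
  | ite_false e c d σ σ₁ w w₁ he _ ih =>
    intro B hB hσ
    obtain ⟨h1, h2⟩ := ih B hB hσ
    refine ⟨h1.mono ?_, fun S hS => ?_⟩
    · exact Nat.mul_le_mul_left _ (Nat.le_mul_of_pos_left _ c.one_le_grow)
    · have h3 := Store.bits_le hσ
      have h4 := e.bits_le (hb.trans hB) hσ
      simp only [Cmd.cst, add_mul] at hS
      exact .ite_false _ _ _ _ _ _ _ (by omega) he (h2 S (by omega))
  | loop_true e c σ σ₁ σ₂ w w₁ w₂ hσ' he _ hl ih1 ih2 =>
    intro B hB hσ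
    obtain ⟨-, h2⟩ := ih1 B hB hσ
    -- The growth caused by the body is forgotten here: the next loop head is again bounded by `2 ^
    -- b`, so growth does not compound over the iterations.
    obtain ⟨h3, h4⟩ := ih2 B hB (hl.bdd_of_loop.mono hB)
    refine ⟨h3, fun S hS => ?_⟩
    have h5 := Store.bits_le hσ
    have h6 := e.bits_le (hb.trans hB) hσ
    have h7 := h4 S hS
    simp only [Cmd.cst, add_mul] at hS
    exact .loop_true _ _ _ σ₁ _ _ w₁ _ (by omega) he (h2 S (by omega)) h7
  | loop_false e c σ w hσ' he =>
    intro B hB hσ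
    refine ⟨by simpa [Cmd.grow] using hσ, fun S hS => ?_⟩
    have h5 := Store.bits_le hσ
    have h6 := e.bits_le (hb.trans hB) hσ
    simp only [Cmd.cst, add_mul] at hS
    exact .loop_false _ _ _ _ (by omega) he

/-! ### Weakest preconditions -/

/-- The registers that a program may change. -/
def Cmd.targets {k : ℕ} : Cmd k → List (Fin k)
  | .skip => []
  | .assign r _ => [r]
  | .flip r => [r]
  | .seq c d => c.targets ++ d.targets
  | .ite _ c d => c.targets ++ d.targets
  | .loop _ c => c.targets

/-- Loop invariants then need to mention only registers that are written; all others are recovered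
by deciding non-membership in `targets`. -/
theorem Cmd.Exec.frame {k b : ℕ} {c : Cmd k} {σ σ' : Store k} {w w' : List Bool}
    (h : Cmd.Exec b c σ w σ' w') : ∀ r, r ∉ c.targets → σ' r = σ r := by
  induction h with
  | skip => simp
  | assign r e σ w =>
    intro s hs
    exact Function.update_of_ne (by simpa [Cmd.targets] using hs) _ _
  | flip r σ a w =>
    intro s hs
    exact Function.update_of_ne (by simpa [Cmd.targets] using hs) _ _
  | seq c d σ σ₁ σ₂ w w₁ w₂ _ _ ih1 ih2 =>
    intro r hr
    simp only [Cmd.targets, List.mem_append, not_or] at hr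
    rw [ih2 r hr.2, ih1 r hr.1]
  | ite_true e c d σ σ₁ w w₁ he _ ih =>
    intro r hr
    simp only [Cmd.targets, List.mem_append, not_or] at hr
    exact ih r hr.1
  | ite_false e c d σ σ₁ w w₁ he _ ih =>
    intro r hr
    simp only [Cmd.targets, List.mem_append, not_or] at hr
    exact ih r hr.2
  | loop_true e c σ σ₁ σ₂ w w₁ w₂ _ he _ _ ih1 ih2 =>
    intro r hr
    rw [ih2 r hr, ih1 r hr]
  | loop_false => simp

/-- The program `c` can be executed and leads to a state with property `Q`. -/
def Cmd.wp {k : ℕ} (b : ℕ) (c : Cmd k) (Q : Store k → List Bool → Prop) (σ : Store k)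
    (w : List Bool) : Prop := ∃ σ' w', Cmd.Exec b c σ w σ' w' ∧ Q σ' w'

/-- The frame property is handed to the continuation, so that specifications of subprograms need not
list what they leave alone. -/
theorem Cmd.wp.mono {k b : ℕ} {c : Cmd k} {Q R : Store k → List Bool → Prop} {σ : Store k}
    {w : List Bool} (h : c.wp b Q σ w)
    (hQ : ∀ σ' w', (∀ r, r ∉ c.targets → σ' r = σ r) → Q σ' w' → R σ' w') : c.wp b R σ w := by
  obtain ⟨σ', w', h1, h2⟩ := h
  exact ⟨σ', w', h1, hQ _ _ h1.frame h2⟩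

theorem Cmd.wp_assign {k b : ℕ} {r : Fin k} {e : Expr k} {Q : Store k → List Bool → Prop}
    {σ : Store k} {w : List Bool} (h : Q (Function.update σ r (e.eval σ)) w) :
    (Cmd.assign r e).wp b Q σ w := ⟨_, _, .assign _ _ _ _, h⟩

theorem Cmd.wp_skip {k b : ℕ} {Q : Store k → List Bool → Prop}
    {σ : Store k} {w : List Bool} (h : Q σ w) :
    (Cmd.skip).wp b Q σ w := ⟨_, _, .skip _ _, h⟩

theorem Cmd.wp_flip {k b : ℕ} {r : Fin k} {Q : Store k → List Bool → Prop}
    {σ : Store k} {a : Bool} {w : List Bool} (h : Q (Function.update σ r (if a then 1 else 0)) w) :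
    (Cmd.flip r).wp b Q σ (a :: w) := ⟨_, _, .flip _ _ _ _, h⟩

theorem Cmd.wp_seq {k b : ℕ} {c d : Cmd k} {Q : Store k → List Bool → Prop}
    {σ : Store k} {w : List Bool} (h : c.wp b (d.wp b Q) σ w) :
    (Cmd.seq c d).wp b Q σ w := by
  obtain ⟨σ₁, w₁, h1, σ₂, w₂, h2, h3⟩ := h
  exact ⟨_, _, .seq _ _ _ _ _ _ _ _ h1 h2, h3⟩

theorem Cmd.wp_ite {k b : ℕ} {e : Expr k} {c d : Cmd k} {Q : Store k → List Bool → Prop}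
    {σ : Store k} {w : List Bool} (h1 : e.eval σ ≠ 0 → c.wp b Q σ w)
    (h2 : e.eval σ = 0 → d.wp b Q σ w) : (Cmd.ite e c d).wp b Q σ w := by
  by_cases h : e.eval σ = 0
  · obtain ⟨σ', w', h3, h4⟩ := h2 h
    exact ⟨_, _, .ite_false _ _ _ _ _ _ _ h h3, h4⟩
  · obtain ⟨σ', w', h3, h4⟩ := h1 h
    exact ⟨_, _, .ite_true _ _ _ _ _ _ _ h h3, h4⟩

/-- Loop rule with an invariant and a decreasing measure. -/
theorem Cmd.wp_loop {k b : ℕ} {e : Expr k} {c : Cmd k} {Q : Store k → List Bool → Prop}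
    (I : Store k → List Bool → Prop) (μ : Store k → ℕ)
    (hb : ∀ σ w, I σ w → σ.Bdd b)
    (hstep : ∀ σ w, I σ w → e.eval σ ≠ 0 → c.wp b (fun σ' w' => I σ' w' ∧ μ σ' < μ σ) σ w)
    (hQ : ∀ σ w, I σ w → e.eval σ = 0 → Q σ w)
    {σ : Store k} {w : List Bool} (h : I σ w) : (Cmd.loop e c).wp b Q σ w := by
  induction hm : μ σ using Nat.strong_induction_on generalizing σ w with
  | _ m ih =>
    by_cases he : e.eval σ = 0
    · exact ⟨_, _, .loop_false _ _ _ _ (hb _ _ h) he, hQ _ _ h he⟩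
    · obtain ⟨σ₁, w₁, h1, h2, h3⟩ := hstep _ _ h he
      obtain ⟨σ₂, w₂, h4, h5⟩ := ih _ (hm ▸ h3) h2 rfl
      exact ⟨_, _, .loop_true _ _ _ _ _ _ _ _ (hb _ _ h) he h1 h4, h5⟩

/-- Repeat `c` as often as register `t` says, counting down. -/
def Cmd.rep {k : ℕ} (t : Fin k) (c : Cmd k) : Cmd k :=
  .loop (.reg t) (.seq c (.assign t (.bin .sub (.reg t) (.lit 1))))

/-- Rule for counting loops; `I s` holds after `s` iterations. -/
theorem Cmd.wp_rep {k b : ℕ} {t : Fin k} {c : Cmd k} {Q : Store k → List Bool → Prop}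
    {σ : Store k} {w : List Bool} (N : ℕ) (I : ℕ → Store k → List Bool → Prop)
    (ht : σ t = N) (h0 : I 0 σ w)
    (hb : ∀ s σ' w', s ≤ N → (∀ r, r ∉ (Cmd.rep t c).targets → σ' r = σ r) →
      σ' t = ((N - s : ℕ) : ℤ) → I s σ' w' → σ'.Bdd b)
    (hstep : ∀ s σ' w', s < N → (∀ r, r ∉ (Cmd.rep t c).targets → σ' r = σ r) →
      σ' t = ((N - s : ℕ) : ℤ) → I s σ' w' → σ'.Bdd b →
      c.wp b (fun σ₁ w₁ => σ₁ t = ((N - s : ℕ) : ℤ) ∧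
        I (s + 1) (Function.update σ₁ t ((N - (s + 1) : ℕ) : ℤ)) w₁) σ' w')
    (hQ : ∀ σ' w', (∀ r, r ∉ (Cmd.rep t c).targets → σ' r = σ r) →
      σ' t = 0 → I N σ' w' → σ'.Bdd b → Q σ' w') : (Cmd.rep t c).wp b Q σ w := by
  refine Cmd.wp_loop (fun σ' w' => ∃ s ≤ N, (∀ r, r ∉ (Cmd.rep t c).targets → σ' r = σ r) ∧
      σ' t = ((N - s : ℕ) : ℤ) ∧ I s σ' w') (fun σ' => (σ' t).toNat) ?_ ?_ ?_
      ⟨0, by omega, fun _ _ => rfl, by simpa using ht, h0⟩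
  · rintro σ' w' ⟨s, hs, hf, ht', hI⟩
    exact hb s σ' w' hs hf ht' hI
  · rintro σ' w' ⟨s, hs, hf, ht', hI⟩ he
    simp only [Expr.eval, ht'] at he
    have hs' : s < N := by
      by_contra h
      exact he (by simp; omega)
    refine Cmd.wp_seq ((hstep s σ' w' hs' hf ht' hI (hb s σ' w' hs hf ht' hI)).mono ?_)
    rintro σ₁ w₁ hf₁ ⟨ht₁, hI₁⟩
    refine Cmd.wp_assign ?_
    have hv : Expr.eval (.bin .sub (.reg t) (.lit 1)) σ₁ = ((N - (s + 1) : ℕ) : ℤ) := by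
      simp only [Expr.eval, BinOp.eval, ht₁]
      omega
    rw [hv]
    refine ⟨⟨s + 1, hs', fun r hr => ?_, by simp, hI₁⟩, ?_⟩
    · have hr' := hr
      simp only [Cmd.rep, Cmd.targets, List.mem_append, not_or, List.mem_singleton] at hr'
      rw [Function.update_of_ne hr'.2, hf₁ r hr'.1, hf r hr]
    · simp [ht']; omega
  · rintro σ' w' ⟨s, hs, hf, ht', hI⟩ he
    simp only [Expr.eval] at he
    have : s = N := by
      rw [ht'] at he
      have : N - s = 0 := by exact_mod_cast he
      omega
    subst this
    exact hQ _ _ hf he hI (hb s σ' w' hs hf ht' hI)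

theorem Store.Bdd.of_targets {k b : ℕ} {l : List (Fin k)} {σ σ' : Store k} (h : σ.Bdd b)
    (hf : ∀ r, r ∉ l → σ' r = σ r) (hl : ∀ r ∈ l, |σ' r| ≤ 2 ^ b) : σ'.Bdd b := by
  intro r
  by_cases hr : r ∈ l
  · exact hl r hr
  · rw [hf r hr]; exact h r

/-! ## The program -/

instance {k : ℕ} : Add (Expr k) := ⟨.bin .add⟩
instance {k : ℕ} : Sub (Expr k) := ⟨.bin .sub⟩
instance {k : ℕ} : Mul (Expr k) := ⟨.bin .mul⟩
instance {k : ℕ} : Div (Expr k) := ⟨.bin .div⟩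
instance {k : ℕ} : Mod (Expr k) := ⟨.bin .mod⟩

namespace Expr
variable {k : ℕ} (e f : Expr k) (σ : Store k)

@[simp] theorem eval_add : (e + f).eval σ = e.eval σ + f.eval σ := rfl
@[simp] theorem eval_sub : (e - f).eval σ = e.eval σ - f.eval σ := rfl
@[simp] theorem eval_mul : (e * f).eval σ = e.eval σ * f.eval σ := rfl
@[simp] theorem eval_div : (e / f).eval σ = e.eval σ / f.eval σ := rfl
@[simp] theorem eval_mod : (e % f).eval σ = e.eval σ % f.eval σ := rfl
@[simp] theorem eval_lit (z : ℤ) : (Expr.lit z).eval σ = z := rfl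
@[simp] theorem eval_reg (r : Fin k) : (Expr.reg r).eval σ = σ r := rfl
@[simp] theorem eval_eq :
    (Expr.bin .eq e f).eval σ = if e.eval σ = f.eval σ then 1 else 0 := rfl
@[simp] theorem eval_lt :
    (Expr.bin .lt e f).eval σ = if e.eval σ < f.eval σ then 1 else 0 := rfl

/-- Powers with a fixed exponent. -/
def npow : ℕ → Expr k
  | 0 => .lit 1
  | j + 1 => npow j * e

@[simp] theorem eval_npow (j : ℕ) : (e.npow j).eval σ = e.eval σ ^ j := by
  induction j with
  | zero => simp [npow]
  | succ j ih => simp [npow, ih, pow_succ]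

end Expr

namespace Sampler

/-! ### Hash functions, columns of the sketch and the update program -/

/-- The hash function whose coefficients are the base `p` digits of `V` after the first. -/
def hashv (p m V x : ℕ) : ℕ := (∑ l ∈ Finset.range m, V / p ^ (l + 1) % p * x ^ l) % p

/-- The contribution of index `x` at level `j` to the sketch: its membership, and its power of the
random root, as the two lowest digits in base `p ^ 3`. -/
def coef (p m V x j : ℕ) : ℕ :=
  if hashv p m V x * 2 ^ j < p then 1 + p ^ 3 * ((V % p) ^ x % p) else 0

/-- The random digits used in slot `s`, when there are `J` slots for every copy. -/
def slotSeed (p m J U s : ℕ) : ℕ := U / p ^ ((m + 1) * (s / J))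

/-- The column of index `x` in the first `S` slots of the sketch. -/
def column (p m J U x S : ℕ) : ℕ :=
  ∑ s ∈ Finset.range S, coef p m (slotSeed p m J U s) x (s % J) * p ^ (6 * s)

/-- Register `14` becomes the power of register `13` with the exponent in register `15`, modulo
register `6`. -/
def powLoop : Cmd 21 := .rep 15 (.assign 14 (.reg 14 * .reg 13 % .reg 6))

/-- Evaluation of the polynomial whose coefficients are the digits of register `11`. -/
def hashLoop : Cmd 21 := .rep 15
  (.seq (.assign 16 (.reg 16 + (.reg 11 % .reg 6) * .reg 17))
  (.seq (.assign 17 (.reg 17 * .reg 2))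
  (.assign 11 (.reg 11 / .reg 6))))

/-- Computation of the column entries for all levels of a copy. -/
def levelLoop : Cmd 21 := .rep 15
  (.seq (.ite (.bin .lt (.reg 16) (.reg 6))
    (.assign 9 (.reg 9 + .reg 10 * (.lit 1 + (Expr.reg 6).npow 3 * .reg 14))) .skip)
  (.seq (.assign 10 (.reg 10 * (Expr.reg 6).npow 6))
  (.assign 16 (.lit 2 * .reg 16))))

/-- Computation of the column entries for one copy. -/
def copyBody (m J : Expr 21) : Cmd 21 :=
  .seq (.assign 13 (.reg 11 % .reg 6))
  (.seq (.assign 11 (.reg 11 / .reg 6))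
  (.seq (.assign 14 (.lit 1))
  (.seq (.assign 15 (.reg 2))
  (.seq powLoop
  (.seq (.assign 16 (.lit 0))
  (.seq (.assign 17 (.lit 1))
  (.seq (.assign 15 m)
  (.seq hashLoop
  (.seq (.assign 16 (.reg 16 % .reg 6))
  (.seq (.assign 15 J)
  levelLoop))))))))))

/-- The program for an update. -/
def updateCmd (m J D : Expr 21) : Cmd 21 :=
  .seq (.assign 9 (.lit 0))
  (.seq (.assign 10 (.lit 1))
  (.seq (.assign 11 (.reg 7))
  (.seq (.assign 12 D)
  (.seq (.rep 12 (copyBody m J))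
  (.assign 8 (.reg 8 + .reg 3 * .reg 9))))))

/-- Reduction after every multiplication keeps the power below `p`, whatever the exponent. -/
theorem powLoop_wp {b : ℕ} {Q : Store 21 → List Bool → Prop} {σ : Store 21} {w : List Bool}
    {x r p : ℕ} (hb : σ.Bdd b) (hp : 2 ≤ p) (h6 : σ 6 = p) (h13 : σ 13 = r) (h14 : σ 14 = 1)
    (h15 : σ 15 = x)
    (hQ : ∀ σ', (∀ s, s ∉ powLoop.targets → σ' s = σ s) → σ'.Bdd b →
      σ' 14 = ((r ^ x % p : ℕ) : ℤ) → Q σ' w) : powLoop.wp b Q σ w := by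
  have hpb : (p : ℤ) ≤ 2 ^ b := by simpa [h6] using hb 6
  have hxb : (x : ℤ) ≤ 2 ^ b := by simpa [h15] using hb 15
  refine Cmd.wp_rep x (fun s σ' w' => w' = w ∧ σ' 14 = ((r ^ s % p : ℕ) : ℤ)) h15
    ⟨rfl, by simp [h14, Nat.mod_eq_of_lt hp]⟩ ?_ ?_ ?_
  · rintro s σ' w' hs hf ht ⟨rfl, hg⟩
    refine hb.of_targets hf ?_
    simp only [Cmd.rep, Cmd.targets, List.cons_append, List.nil_append, List.forall_mem_cons,
      List.not_mem_nil, IsEmpty.forall_iff, implies_true, and_true, hg, ht, Nat.abs_cast]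
    constructor
    · have : r ^ s % p < p := Nat.mod_lt _ (by omega)
      have : ((r ^ s % p : ℕ) : ℤ) < p := by exact_mod_cast this
      linarith
    · have : ((x - s : ℕ) : ℤ) ≤ x := by omega
      linarith
  · rintro s σ' w' hs hf ht ⟨rfl, hg⟩ -
    have e6 : σ' 6 = p := (hf 6 (by decide)).trans h6
    have e13 : σ' 13 = r := (hf 13 (by decide)).trans h13
    refine Cmd.wp_assign ⟨?_, rfl, ?_⟩
    · simpa using ht
    · simp only [Expr.eval_mod, Expr.eval_mul, Expr.eval_reg, hg, e6, e13, ne_eq, Fin.reduceEq,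
        not_false_eq_true, Function.update_of_ne, Function.update_self, pow_succ]
      push_cast
      exact Int.ModEq.mul_right _ (Int.mod_modEq _ _)
  · rintro σ' w' hf ht ⟨rfl, hg⟩ hb'
    exact hQ σ' hf hb' hg

/-- The partial sums are not reduced modulo `p`. They stay below `m * p * x ^ m`, which is
affordable: its length is of order `log² n` when `m` is of order `log n`. -/
theorem hashLoop_wp {b : ℕ} {Q : Store 21 → List Bool → Prop} {σ : Store 21} {w : List Bool}
    {x m p V : ℕ} (hb : σ.Bdd b) (hp : 2 ≤ p) (hx : 1 ≤ x) (h2 : σ 2 = x) (h6 : σ 6 = p)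
    (h11 : σ 11 = V) (h15 : σ 15 = m) (h16 : σ 16 = 0) (h17 : σ 17 = 1)
    (hfit : m * p * x ^ m ≤ 2 ^ b) (hfit' : x ^ m ≤ 2 ^ b)
    (hQ : ∀ σ', (∀ s, s ∉ hashLoop.targets → σ' s = σ s) → σ'.Bdd b →
      σ' 11 = ((V / p ^ m : ℕ) : ℤ) → σ' 16 = ((∑ l ∈ Finset.range m, V / p ^ l % p * x ^ l : ℕ) : ℤ) →
      Q σ' w) : hashLoop.wp b Q σ w := by
  have hVb : (V : ℤ) ≤ 2 ^ b := by simpa [h11] using hb 11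
  have hmb : (m : ℤ) ≤ 2 ^ b := by simpa [h15] using hb 15
  refine Cmd.wp_rep m (fun s σ' w' => w' = w ∧ σ' 11 = ((V / p ^ s : ℕ) : ℤ) ∧
    σ' 16 = ((∑ l ∈ Finset.range s, V / p ^ l % p * x ^ l : ℕ) : ℤ) ∧ σ' 17 = ((x ^ s : ℕ) : ℤ)) h15
    ⟨rfl, by simp [h11], by simp [h16], by simp [h17]⟩ ?_ ?_ ?_
  · rintro s σ' w' hs hf ht ⟨rfl, hg1, hg2, hg3⟩
    refine hb.of_targets hf ?_
    simp only [Cmd.rep, Cmd.targets, List.cons_append, List.nil_append, List.forall_mem_cons,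
      List.not_mem_nil, IsEmpty.forall_iff, implies_true, and_true, hg1, hg2, hg3, ht, Nat.abs_cast]
    have hxs : ∀ l ≤ m, x ^ l ≤ x ^ m := fun l hl => Nat.pow_le_pow_right hx hl
    refine ⟨?_, ?_, ?_, ?_⟩
    · have : ∑ l ∈ Finset.range s, V / p ^ l % p * x ^ l ≤ m * p * x ^ m := by
        calc ∑ l ∈ Finset.range s, V / p ^ l % p * x ^ l
            ≤ ∑ _l ∈ Finset.range s, p * x ^ m := by
              refine Finset.sum_le_sum fun l hl => ?_
              have := Finset.mem_range.1 hl
              exact Nat.mul_le_mul (Nat.mod_lt _ (by omega)).le (hxs l (by omega))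
          _ = s * (p * x ^ m) := by simp
          _ ≤ m * (p * x ^ m) := Nat.mul_le_mul_right _ hs
          _ = _ := by ring
      exact_mod_cast this.trans hfit
    · exact_mod_cast (hxs s hs).trans hfit'
    · have : V / p ^ s ≤ V := Nat.div_le_self _ _
      have : ((V / p ^ s : ℕ) : ℤ) ≤ V := by exact_mod_cast this
      linarith
    · have : ((m - s : ℕ) : ℤ) ≤ m := by omega
      linarith
  · rintro s σ' w' hs hf ht ⟨rfl, hg1, hg2, hg3⟩ -
    have e6 : σ' 6 = p := (hf 6 (by decide)).trans h6
    have e2 : σ' 2 = x := (hf 2 (by decide)).trans h2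
    refine Cmd.wp_seq (Cmd.wp_assign (Cmd.wp_seq (Cmd.wp_assign (Cmd.wp_assign
      ⟨?_, rfl, ?_, ?_, ?_⟩))))
    · simpa using ht
    · simp [hg1, e6, pow_succ, ← Nat.div_div_eq_div_mul]
    · simp [hg1, hg2, hg3, e6, Finset.sum_range_succ]
    · simp [hg3, e2, pow_succ]
  · rintro σ' w' hf ht ⟨rfl, hg1, hg2, hg3⟩ hb'
    exact hQ σ' hf hb' hg1 hg2

/-- Every level contributes one digit in base `p ^ 6`. The entry `1 + p ^ 3 * f` is a legal digit,
so the number built so far stays below the running place value in register `10`. -/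
theorem levelLoop_wp {b : ℕ} {Q : Store 21 → List Bool → Prop} {σ : Store 21} {w : List Bool}
    {h f p G P J : ℕ} (hb : σ.Bdd b) (hp : 2 ≤ p) (h6 : σ 6 = p) (hf' : f < p)
    (h9 : σ 9 = G) (h10 : σ 10 = P) (h14 : σ 14 = f) (h15 : σ 15 = J) (h16 : σ 16 = h)
    (hG : G < P) (hfit : P * p ^ (6 * J) ≤ 2 ^ b) (hfit' : h * 2 ^ J ≤ 2 ^ b)
    (hQ : ∀ σ', (∀ s, s ∉ levelLoop.targets → σ' s = σ s) → σ'.Bdd b →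
      σ' 10 = ((P * p ^ (6 * J) : ℕ) : ℤ) →
      (∃ G' < P * p ^ (6 * J), G' = G + P * ∑ j ∈ Finset.range J,
        (if h * 2 ^ j < p then 1 + p ^ 3 * f else 0) * p ^ (6 * j) ∧ σ' 9 = (G' : ℤ)) →
      Q σ' w) : levelLoop.wp b Q σ w := by
  have hJb : (J : ℤ) ≤ 2 ^ b := by simpa [h15] using hb 15
  have hp3 : p ≤ p ^ 3 := Nat.le_self_pow (by norm_num) p
  refine Cmd.wp_rep J (fun s σ' w' => w' = w ∧ σ' 10 = ((P * p ^ (6 * s) : ℕ) : ℤ) ∧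
    σ' 16 = ((h * 2 ^ s : ℕ) : ℤ) ∧
    ∃ G' < P * p ^ (6 * s), G' = G + P * ∑ j ∈ Finset.range s,
        (if h * 2 ^ j < p then 1 + p ^ 3 * f else 0) * p ^ (6 * j) ∧ σ' 9 = (G' : ℤ)) h15
    ⟨rfl, by simp [h10], by simp [h16], G, by simpa using hG, by simp, by simp [h9]⟩ ?_ ?_ ?_
  · rintro s σ' w' hs hf ht ⟨rfl, hg1, hg2, G', hG', -, hg3⟩
    refine hb.of_targets hf ?_
    simp only [Cmd.rep, Cmd.targets, List.cons_append, List.nil_append, List.forall_mem_cons,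
      List.not_mem_nil, IsEmpty.forall_iff, implies_true, and_true, hg1, hg2, hg3, ht, Nat.abs_cast]
    have h1 : P * p ^ (6 * s) ≤ P * p ^ (6 * J) :=
      Nat.mul_le_mul_left _ (Nat.pow_le_pow_right (by omega) (by omega))
    have h2 : h * 2 ^ s ≤ h * 2 ^ J :=
      Nat.mul_le_mul_left _ (Nat.pow_le_pow_right (by omega) (by omega))
    refine ⟨?_, ?_, ?_, ?_⟩
    · exact_mod_cast (hG'.le.trans h1).trans hfit
    · exact_mod_cast h1.trans hfit
    · exact_mod_cast h2.trans hfit'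
    · have : ((J - s : ℕ) : ℤ) ≤ J := by omega
      linarith
  · rintro s σ' w' hs hf ht ⟨rfl, hg1, hg2, G', hG', hG2, hg3⟩ -
    have e6 : σ' 6 = p := (hf 6 (by decide)).trans h6
    have e14 : σ' 14 = f := (hf 14 (by decide)).trans h14
    have hcoef : 1 + p ^ 3 * f < p ^ 6 := by
      have h1 : p ^ 3 * (f + 1) ≤ p ^ 3 * p ^ 3 := Nat.mul_le_mul_left _ (by omega)
      have h2 : p ^ 6 = p ^ 3 * p ^ 3 := by ring
      have h3 : 1 < p ^ 3 := by omega
      rw [h2]; linarith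
    have hp6 : p ^ (6 * (s + 1)) = p ^ (6 * s) * p ^ 6 := by ring
    refine Cmd.wp_seq (Cmd.wp_ite (fun he => ?_) (fun he => ?_))
    · have he' : h * 2 ^ s < p := by
        have : ((h * 2 ^ s : ℕ) : ℤ) < p := by
          by_contra hcon
          exact he (by simp only [Expr.eval_lt, Expr.eval_reg, hg2, e6]; rw [if_neg hcon])
        exact_mod_cast this
      refine Cmd.wp_assign (Cmd.wp_seq (Cmd.wp_assign (Cmd.wp_assign
        ⟨?_, rfl, ?_, ?_, G' + P * p ^ (6 * s) * (1 + p ^ 3 * f), ?_, ?_, ?_⟩)))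
      · simpa using ht
      · simp [hg1, e6, hp6, mul_assoc]
      · simp [hg2, pow_succ]; ring
      · rw [hp6]
        have := Nat.mul_le_mul_left (P * p ^ (6 * s)) hcoef
        rw [Nat.succ_eq_add_one] at this
        linarith
      · rw [hG2, Finset.sum_range_succ, if_pos he']; ring
      · simp [hg3, hg1, e6, e14]
    · have he' : ¬ h * 2 ^ s < p := by
        intro hcon
        have : ((h * 2 ^ s : ℕ) : ℤ) < p := by exact_mod_cast hcon
        simp only [Expr.eval_lt, Expr.eval_reg, hg2, e6, if_pos this] at he
        exact one_ne_zero he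
      refine Cmd.wp_skip (Cmd.wp_seq (Cmd.wp_assign (Cmd.wp_assign
        ⟨?_, rfl, ?_, ?_, G', ?_, ?_, ?_⟩)))
      · simpa using ht
      · simp [hg1, e6, hp6, mul_assoc]
      · simp [hg2, pow_succ]; ring
      · rw [hp6]
        have : 1 ≤ p ^ 6 := Nat.one_le_pow _ _ (by omega)
        nlinarith
      · rw [hG2, Finset.sum_range_succ, if_neg he']; ring
      · simp [hg3]
  · rintro σ' w' hf ht ⟨rfl, hg1, hg2, hg3⟩ hb'
    exact hQ σ' hf hb' hg1 hg3

/-- Slots are numbered copy by copy: quotient and remainder of the slot number by `J` are the copy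
and the level. -/
theorem column_add (p m J U x c : ℕ) (hJ : 0 < J) :
    column p m J U x (J * (c + 1)) = column p m J U x (J * c) + p ^ (6 * (J * c)) *
      ∑ j ∈ Finset.range J, coef p m (U / p ^ ((m + 1) * c)) x j * p ^ (6 * j) := by
  unfold column slotSeed
  rw [mul_add, mul_one, Finset.sum_range_add, Finset.mul_sum]
  congr 1
  refine Finset.sum_congr rfl fun j hj => ?_
  have hj' := Finset.mem_range.1 hj
  rw [Nat.mul_add_div hJ, Nat.div_eq_of_lt hj', Nat.mul_add_mod, Nat.mod_eq_of_lt hj', add_zero]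
  ring

/-- The numbers that occur in an execution fit into registers of length `b`. -/
structure Fits (b n p m J D U : ℕ) : Prop where
  two_le : 2 ≤ p
  pos : 0 < J
  m_le : m ≤ 2 ^ b
  J_le : J ≤ 2 ^ b
  D_le : D ≤ 2 ^ b
  U_le : U ≤ 2 ^ b
  pow_le : m * p * n ^ m ≤ 2 ^ b
  pow_le' : n ^ m ≤ 2 ^ b
  level_le : p * 2 ^ J ≤ 2 ^ b
  sketch_le : p ^ (6 * (J * D)) ≤ 2 ^ b
  sq_le : p ^ 2 ≤ 2 ^ b
  lt_p : n < p

theorem copyBody_wp {b n p m J D U x c : ℕ} {σ : Store 21}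
    {w : List Bool} {em eJ : Expr 21} (hF : Fits b n p m J D U) (hb : σ.Bdd b)
    (hx : 1 ≤ x) (hxn : x ≤ n) (hc : c < D)
    (hm : ∀ σ' : Store 21, (∀ s : Fin 21, s < 9 → σ' s = σ s) → em.eval σ' = m)
    (hJ : ∀ σ' : Store 21, (∀ s : Fin 21, s < 9 → σ' s = σ s) → eJ.eval σ' = J)
    (h2 : σ 2 = x) (h6 : σ 6 = p)
    (h9 : σ 9 = column p m J U x (J * c)) (h10 : σ 10 = ((p ^ (6 * (J * c)) : ℕ) : ℤ))
    (h11 : σ 11 = ((U / p ^ ((m + 1) * c) : ℕ) : ℤ))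
    (hlt : column p m J U x (J * c) < p ^ (6 * (J * c))) :
    (copyBody em eJ).wp b (fun σ' w' => w' = w ∧ σ'.Bdd b ∧
      σ' 9 = column p m J U x (J * (c + 1)) ∧ σ' 10 = ((p ^ (6 * (J * (c + 1))) : ℕ) : ℤ) ∧
      σ' 11 = ((U / p ^ ((m + 1) * (c + 1)) : ℕ) : ℤ) ∧
      column p m J U x (J * (c + 1)) < p ^ (6 * (J * (c + 1)))) σ w := by
  obtain ⟨hp, hJ0, hmb, hJb, -, hUb, hfit, hfit', hlev, hsk, -⟩ := hF
  have hcol := column_add p m J U x c hJ0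
  set V := U / p ^ ((m + 1) * c) with hV
  have hVU : V ≤ U := Nat.div_le_self _ _
  have hpb : p ≤ 2 ^ b := le_trans (Nat.le_mul_of_pos_right _ (by positivity)) hlev
  have hrp : V % p < p := Nat.mod_lt _ (by omega)
  have hxb : |(x : ℤ)| ≤ 2 ^ b := by simpa [h2] using hb 2
  have cast_le : ∀ y : ℕ, y ≤ 2 ^ b → |(y : ℤ)| ≤ 2 ^ b := fun y hy => by
    rw [Nat.abs_cast]; exact_mod_cast hy
  refine Cmd.wp_seq (Cmd.wp_assign (Cmd.wp_seq (Cmd.wp_assign (Cmd.wp_seq (Cmd.wp_assign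
    (Cmd.wp_seq (Cmd.wp_assign (Cmd.wp_seq ?_))))))))
  refine powLoop_wp (x := x) (r := V % p) (p := p) ?_ hp ?_ ?_ ?_ ?_ ?_
  · refine Store.Bdd.update (Store.Bdd.update (Store.Bdd.update (Store.Bdd.update hb _ ?_)
      _ ?_) _ ?_) _ ?_
    · simpa [h11, h6] using cast_le _ (hrp.le.trans hpb)
    · simpa [h11, h6] using cast_le _ (((Nat.div_le_self _ _).trans hVU).trans hUb)
    · simp [one_le_pow₀]
    · simpa [h2] using hxb
  · simp [h6]
  · simp [h6, h11]
  · simp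
  · simp [h2]
  intro σ₁ hf₁ hb₁ hg₁
  have e6 : σ₁ 6 = p := by rw [hf₁ 6 (by decide)]; simp [h6]
  have e2 : σ₁ 2 = x := by rw [hf₁ 2 (by decide)]; simp [h2]
  have e11 : σ₁ 11 = ((V / p : ℕ) : ℤ) := by rw [hf₁ 11 (by decide)]; simp [h11, h6]
  have e10 : σ₁ 10 = ((p ^ (6 * (J * c)) : ℕ) : ℤ) := by
    rw [hf₁ 10 (by decide)]; simpa using h10
  have e9 : σ₁ 9 = column p m J U x (J * c) := by rw [hf₁ 9 (by decide)]; simpa using h9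
  have hlow₁ : ∀ s : Fin 21, s < 9 → σ₁ s = σ s := fun s hs => by
    have hne : ∀ t : Fin 21, 9 ≤ t → s ≠ t := fun t ht h => by subst h; exact absurd hs (not_lt.2 ht)
    rw [hf₁ s (by
      simp only [powLoop, Cmd.rep, Cmd.targets, List.cons_append, List.nil_append,
        List.mem_cons, List.not_mem_nil, or_false, not_or]
      exact ⟨hne _ (by decide), hne _ (by decide)⟩)]
    rw [Function.update_of_ne (hne _ (by decide)), Function.update_of_ne (hne _ (by decide)),
      Function.update_of_ne (hne _ (by decide)), Function.update_of_ne (hne _ (by decide))]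
  refine Cmd.wp_seq (Cmd.wp_assign (Cmd.wp_seq (Cmd.wp_assign (Cmd.wp_seq (Cmd.wp_assign
    (Cmd.wp_seq ?_))))))
  -- The parameter expressions depend only on registers below `9`, which the body never writes; so
  -- they keep their values throughout.
  rw [hm _ fun s hs => by
    have hne : ∀ t : Fin 21, 9 ≤ t → s ≠ t := fun t ht h => by subst h; exact absurd hs (not_lt.2 ht)
    rw [Function.update_of_ne (hne _ (by decide)), Function.update_of_ne (hne _ (by decide)),
      hlow₁ s hs]]
  refine hashLoop_wp (x := x) (m := m) (p := p) (V := V / p) ?_ hp hx ?_ ?_ ?_ ?_ ?_ ?_ ?_ ?_ ?_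
  · refine Store.Bdd.update (Store.Bdd.update (Store.Bdd.update hb₁ _ ?_) _ ?_) _ ?_
    · simp
    · simp [one_le_pow₀]
    · exact cast_le _ hmb
  · simp [e2]
  · simp [e6]
  · simp [e11]
  · simp
  · simp
  · simp
  · exact (Nat.mul_le_mul_left _ (Nat.pow_le_pow_left hxn _)).trans hfit
  · exact (Nat.pow_le_pow_left hxn _).trans hfit'
  intro σ₂ hf₂ hb₂ hg₂ hg₂'
  have e6' : σ₂ 6 = p := by rw [hf₂ 6 (by decide)]; simp [e6]
  have e10' : σ₂ 10 = ((p ^ (6 * (J * c)) : ℕ) : ℤ) := by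
    rw [hf₂ 10 (by decide)]; simpa using e10
  have e9' : σ₂ 9 = column p m J U x (J * c) := by rw [hf₂ 9 (by decide)]; simpa using e9
  have e14' : σ₂ 14 = (((V % p) ^ x % p : ℕ) : ℤ) := by
    rw [hf₂ 14 (by decide)]; simpa using hg₁
  have hh : σ₂ 16 % σ₂ 6 = (hashv p m V x : ℕ) := by
    rw [hg₂', e6', hashv]
    simp only [pow_succ', ← Nat.div_div_eq_div_mul]
    push_cast
    rfl
  have hlow₂ : ∀ s : Fin 21, s < 9 → σ₂ s = σ s := fun s hs => by
    have hne : ∀ t : Fin 21, 9 ≤ t → s ≠ t := fun t ht h => by subst h; exact absurd hs (not_lt.2 ht)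
    rw [hf₂ s (by
      simp only [hashLoop, Cmd.rep, Cmd.targets, List.cons_append, List.nil_append,
        List.mem_cons, List.not_mem_nil, or_false, not_or]
      exact ⟨hne _ (by decide), hne _ (by decide), hne _ (by decide), hne _ (by decide)⟩)]
    rw [Function.update_of_ne (hne _ (by decide)), Function.update_of_ne (hne _ (by decide)),
      Function.update_of_ne (hne _ (by decide)), hlow₁ s hs]
  refine Cmd.wp_seq (Cmd.wp_assign (Cmd.wp_seq (Cmd.wp_assign ?_)))
  rw [hJ _ fun s hs => by
    have hne : ∀ t : Fin 21, 9 ≤ t → s ≠ t := fun t ht h => by subst h; exact absurd hs (not_lt.2 ht)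
    rw [Function.update_of_ne (hne _ (by decide)), hlow₂ s hs]]
  have hhp : hashv p m V x < p := Nat.mod_lt _ (by omega)
  have hpow : p ^ (6 * (J * c)) * p ^ (6 * J) = p ^ (6 * (J * (c + 1))) := by ring
  refine levelLoop_wp (p := p) (f := (V % p) ^ x % p) (h := hashv p m V x) (J := J)
    (P := p ^ (6 * (J * c))) (G := column p m J U x (J * c)) ?_ hp ?_ (Nat.mod_lt _ (by omega))
    ?_ ?_ ?_ ?_ ?_ hlt ?_ ?_ ?_
  · refine Store.Bdd.update (Store.Bdd.update hb₂ _ ?_) _ ?_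
    · simp only [Expr.eval_mod, Expr.eval_reg, hh]
      exact cast_le _ (hhp.le.trans hpb)
    · exact cast_le _ hJb
  · simp [e6']
  · simp [e9']
  · simp [e10']
  · simp [e14']
  · simp
  · simp [hh]
  · rw [hpow]
    exact (Nat.pow_le_pow_right (by omega) (Nat.mul_le_mul_left _ (Nat.mul_le_mul_left _ hc))).trans
      hsk
  · exact (Nat.mul_le_mul_right _ hhp.le).trans hlev
  rintro σ₃ hf₃ hb₃ hg₃ ⟨G', hG', hG2, hg₃'⟩
  have hG3 : G' = column p m J U x (J * (c + 1)) := by rw [hG2, hcol]; rfl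
  rw [hpow] at hG' hg₃
  refine ⟨rfl, hb₃, by rw [hg₃', hG3], hg₃, ?_, hG3 ▸ hG'⟩
  rw [hf₃ 11 (by decide)]
  simp only [ne_eq, Fin.reduceEq, not_false_eq_true, Function.update_of_ne, hg₂, hV,
    Nat.div_div_eq_div_mul]
  congr 2
  ring

theorem updateCmd_wp {b n p m J D U x : ℕ} {σ : Store 21}
    {w : List Bool} {em eJ eD : Expr 21} (hF : Fits b n p m J D U) (hb : σ.Bdd b)
    (hx : 1 ≤ x) (hxn : x ≤ n)
    (hm : ∀ σ' : Store 21, (∀ s : Fin 21, s < 8 → σ' s = σ s) → em.eval σ' = m)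
    (hJ : ∀ σ' : Store 21, (∀ s : Fin 21, s < 8 → σ' s = σ s) → eJ.eval σ' = J)
    (hD : ∀ σ' : Store 21, (∀ s : Fin 21, s < 8 → σ' s = σ s) → eD.eval σ' = D)
    (h2 : σ 2 = x) (h6 : σ 6 = p) (h7 : σ 7 = U)
    (hZ : |σ 8 + σ 3 * column p m J U x (J * D)| ≤ 2 ^ b) :
    (updateCmd em eJ eD).wp b (fun σ' w' => w' = w ∧ σ'.Bdd b ∧ (∀ s : Fin 21, s < 8 → σ' s = σ s) ∧
      σ' 8 = σ 8 + σ 3 * column p m J U x (J * D)) σ w := by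
  have hDb : |(D : ℤ)| ≤ 2 ^ b := by rw [Nat.abs_cast]; exact_mod_cast hF.D_le
  have hne : ∀ s : Fin 21, s < 9 → ∀ t : Fin 21, 9 ≤ t → s ≠ t :=
    fun s hs t ht h => by subst h; exact absurd hs (not_lt.2 ht)
  have h89 : ∀ s : Fin 21, s < 8 → s < 9 := fun s hs => hs.trans (by decide)
  refine Cmd.wp_seq (Cmd.wp_assign (Cmd.wp_seq (Cmd.wp_assign (Cmd.wp_seq (Cmd.wp_assign
    (Cmd.wp_seq (Cmd.wp_assign (Cmd.wp_seq ?_))))))))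
  rw [hD _ fun s hs => by
    have hne := hne s (h89 s hs)
    rw [Function.update_of_ne (hne _ (by decide)), Function.update_of_ne (hne _ (by decide)),
      Function.update_of_ne (hne _ (by decide))]]
  refine Cmd.wp_rep D (fun c σ' w' => w' = w ∧ σ'.Bdd b ∧ (∀ s : Fin 21, s < 9 → σ' s = σ s) ∧
    σ' 9 = column p m J U x (J * c) ∧ σ' 10 = ((p ^ (6 * (J * c)) : ℕ) : ℤ) ∧
      σ' 11 = ((U / p ^ ((m + 1) * c) : ℕ) : ℤ) ∧
      column p m J U x (J * c) < p ^ (6 * (J * c))) (by simp) ?_ ?_ ?_ ?_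
  · refine ⟨rfl, ?_, fun s hs => ?_, by simp [column], by simp, by simp [h7], by simp [column]⟩
    · refine Store.Bdd.update (Store.Bdd.update (Store.Bdd.update (Store.Bdd.update hb _ ?_)
        _ ?_) _ ?_) _ hDb
      · simp
      · simp [one_le_pow₀]
      · simpa using hb 7
    · have hne := hne s hs
      rw [Function.update_of_ne (hne _ (by decide)), Function.update_of_ne (hne _ (by decide)),
        Function.update_of_ne (hne _ (by decide)), Function.update_of_ne (hne _ (by decide))]
  · rintro c σ' w' - - - ⟨-, h, -⟩
    exact h
  · rintro c σ' w' hc - ht ⟨rfl, hb', hlow, g9, g10, g11, hlt⟩ -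
    refine (copyBody_wp hF hb' hx hxn hc
      (fun σ₁ h₁ => hm σ₁ fun s hs => (h₁ s (h89 s hs)).trans (hlow s (h89 s hs)))
      (fun σ₁ h₁ => hJ σ₁ fun s hs => (h₁ s (h89 s hs)).trans (hlow s (h89 s hs)))
      ((hlow 2 (by decide)).trans h2) ((hlow 6 (by decide)).trans h6) g9 g10 g11 hlt).mono ?_
    rintro σ₁ w₁ hf₁ ⟨rfl, hb₁, g9', g10', g11', hlt'⟩
    have hsub : ((D - (c + 1) : ℕ) : ℤ) ≤ D := by omega
    refine ⟨by rw [hf₁ 12 (by simp [copyBody, powLoop, hashLoop, levelLoop, Cmd.rep, Cmd.targets]),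
      ht], rfl, hb₁.update _ ?_, fun s hs => ?_, by simpa using g9', by simpa using g10',
      by simpa using g11', hlt'⟩
    · rw [Nat.abs_cast]
      rw [Nat.abs_cast] at hDb
      exact hsub.trans hDb
    · rw [Function.update_of_ne (hne s hs _ (by decide)), ← hlow s hs]
      refine hf₁ s ?_
      simp only [copyBody, powLoop, hashLoop, levelLoop, Cmd.rep, Cmd.targets, List.cons_append,
        List.nil_append, List.append_nil, List.mem_cons, List.not_mem_nil, or_false, not_or]
      have hne := hne s hs
      refine ⟨?_, ?_, ?_, ?_, ?_, ?_, ?_, ?_, ?_, ?_, ?_, ?_, ?_, ?_, ?_, ?_, ?_, ?_, ?_⟩ <;>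
        exact hne _ (by decide)
  · rintro σ' w' - - ⟨rfl, hb', hlow, g9, -, -, -⟩ -
    refine Cmd.wp_assign ?_
    have hv : (Expr.reg 8 + Expr.reg 3 * Expr.reg 9 : Expr 21).eval σ' =
        σ 8 + σ 3 * column p m J U x (J * D) := by
      simp [hlow 8 (by decide), hlow 3 (by decide), g9]
    rw [hv]
    refine ⟨rfl, hb'.update _ hZ, fun s hs => ?_, by simp⟩
    rw [Function.update_of_ne (fun h => by subst h; exact absurd hs (by decide)),
      hlow s (h89 s hs)]

/-! ### Initialisation -/

/-- The least prime that is at least `N`. -/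
noncomputable def leastPrime (N : ℕ) : ℕ := Nat.find (Nat.exists_infinite_primes N)

/-- The number with given binary digits, most significant first. -/
def ofBits (l : List Bool) : ℕ := l.foldl (fun u a => 2 * u + a.toNat) 0

/-- Binary length of register `0`. -/
def sizeLoop : Cmd 21 := .loop (.reg 15)
  (.seq (.assign 5 (.reg 5 + .lit 1)) (.assign 15 (.reg 15 / .lit 2)))

/-- Search for a prime by trial division. -/
def primeLoop : Cmd 21 := .loop (.bin .lt (.reg 19) (.reg 6))
  (.ite (.bin .eq (.reg 6 % .reg 19) (.lit 0))
    (.seq (.assign 6 (.reg 6 + .lit 1)) (.assign 19 (.lit 2)))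
    (.assign 19 (.reg 19 + .lit 1)))

/-- Collection of random bits in register `7`. -/
def flipLoop : Cmd 21 := .rep 20
  (.seq (.flip 18) (.assign 7 (.lit 2 * .reg 7 + .reg 18)))

/-- The program run before the stream starts. -/
def initCmd (e : ℕ) (W : Expr 21) : Cmd 21 :=
  .seq (.assign 15 (.reg 0))
  (.seq sizeLoop
  (.seq (.assign 6 ((Expr.reg 0).npow e))
  (.seq (.assign 19 (.lit 2))
  (.seq primeLoop
  (.seq (.assign 20 W)
  flipLoop)))))

theorem sizeLoop_wp {b n : ℕ} {σ : Store 21} {w : List Bool} (hb : σ.Bdd b)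
    (h15 : σ 15 = n) (h5 : σ 5 = 0) (hL : n.size ≤ 2 ^ b) :
    sizeLoop.wp b (fun σ' w' => w' = w ∧ σ'.Bdd b ∧ σ' 5 = n.size) σ w := by
  have hnb : (n : ℤ) ≤ 2 ^ b := by simpa [h15] using hb 15
  have hbdd : ∀ σ' : Store 21, ∀ s : ℕ, (∀ r, r ∉ sizeLoop.targets → σ' r = σ r) → s ≤ n.size →
      σ' 5 = s → σ' 15 = ((n / 2 ^ s : ℕ) : ℤ) → σ'.Bdd b := by
    intro σ' s hf hs h5' h15'
    refine hb.of_targets hf ?_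
    simp only [sizeLoop, Cmd.targets, List.cons_append, List.nil_append, List.forall_mem_cons,
      List.not_mem_nil, IsEmpty.forall_iff, implies_true, and_true, h5', h15', Nat.abs_cast]
    refine ⟨by exact_mod_cast hs.trans hL, ?_⟩
    have : ((n / 2 ^ s : ℕ) : ℤ) ≤ n := by exact_mod_cast Nat.div_le_self _ _
    linarith
  refine Cmd.wp_loop (fun σ' w' => w' = w ∧ (∀ r, r ∉ sizeLoop.targets → σ' r = σ r) ∧
    ∃ s : ℕ, s ≤ n.size ∧ σ' 5 = s ∧ σ' 15 = ((n / 2 ^ s : ℕ) : ℤ)) (fun σ' => (σ' 15).toNat)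
    ?_ ?_ ?_ ⟨rfl, fun _ _ => rfl, 0, Nat.zero_le _, by simpa using h5, by simpa using h15⟩
  · rintro σ' w' ⟨-, hf, s, hs, g5, g15⟩
    exact hbdd σ' s hf hs g5 g15
  · rintro σ' w' ⟨rfl, hf, s, hs, g5, g15⟩ he
    have hpos : n / 2 ^ s ≠ 0 := fun h => he (by simp [g15, h])
    have hlt : s < n.size := Nat.lt_size.2 (by
      by_contra hcon
      exact hpos (Nat.div_eq_of_lt (not_le.1 hcon)))
    refine Cmd.wp_seq (Cmd.wp_assign (Cmd.wp_assign ⟨⟨rfl, fun r hr => ?_, s + 1, hlt, ?_, ?_⟩, ?_⟩))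
    · rw [← hf r hr]
      simp only [sizeLoop, Cmd.targets, List.cons_append, List.nil_append, List.mem_cons,
        List.not_mem_nil, or_false, not_or] at hr
      rw [Function.update_of_ne hr.2, Function.update_of_ne hr.1]
    · simp [g5]
    · simp [g15, pow_succ, ← Nat.div_div_eq_div_mul]
    · simp only [Expr.eval_div, Expr.eval_reg, Expr.eval_lit, ne_eq, Fin.reduceEq,
        not_false_eq_true, Function.update_of_ne, Function.update_self, g15]
      generalize n / 2 ^ s = y at hpos
      omega
  · rintro σ' w' ⟨rfl, hf, s, hs, g5, g15⟩ he
    refine ⟨rfl, hbdd σ' s hf hs g5 g15, ?_⟩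
    have h0 : n / 2 ^ s = 0 := by
      simp only [Expr.eval_reg, g15] at he
      exact_mod_cast he
    have h1 : n < 2 ^ s := by
      rcases Nat.div_eq_zero_iff.1 h0 with h | h
      · simp at h
      · exact h
    have h2 := Nat.size_le.2 h1
    rw [g5, le_antisymm hs h2]

theorem leastPrime_prime (N : ℕ) : (leastPrime N).Prime :=
  (Nat.find_spec (Nat.exists_infinite_primes N)).2

theorem le_leastPrime (N : ℕ) : N ≤ leastPrime N :=
  (Nat.find_spec (Nat.exists_infinite_primes N)).1

theorem leastPrime_le {N q : ℕ} (h : N ≤ q) (hq : q.Prime) : leastPrime N ≤ q :=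
  Nat.find_min' _ ⟨h, hq⟩

theorem primeLoop_wp {b N : ℕ} {σ : Store 21} {w : List Bool} (hb : σ.Bdd b) (hN : 2 ≤ N)
    (h6 : σ 6 = N) (h19 : σ 19 = 2) (hp : leastPrime N ≤ 2 ^ b) :
    primeLoop.wp b (fun σ' w' => w' = w ∧ σ'.Bdd b ∧ σ' 6 = leastPrime N) σ w := by
  have hbdd : ∀ σ' : Store 21, ∀ p q : ℕ, (∀ r, r ∉ primeLoop.targets → σ' r = σ r) →
      σ' 6 = p → σ' 19 = q → p ≤ leastPrime N → q ≤ p → σ'.Bdd b := by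
    intro σ' p q hf h6' h19' hp' hq
    refine hb.of_targets hf ?_
    simp only [primeLoop, Cmd.targets, List.cons_append, List.nil_append, List.forall_mem_cons,
      List.not_mem_nil, IsEmpty.forall_iff, implies_true, and_true, h6', h19', Nat.abs_cast]
    have h1 : (p : ℤ) ≤ 2 ^ b := by exact_mod_cast hp'.trans hp
    have h2 : (q : ℤ) ≤ 2 ^ b := by exact_mod_cast hq.trans (hp'.trans hp)
    exact ⟨h1, h2, h2⟩
  refine Cmd.wp_loop (fun σ' w' => w' = w ∧ (∀ r, r ∉ primeLoop.targets → σ' r = σ r) ∧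
    ∃ p q : ℕ, σ' 6 = p ∧ σ' 19 = q ∧ N ≤ p ∧ p ≤ leastPrime N ∧ 2 ≤ q ∧ q ≤ p ∧
      ∀ t, 2 ≤ t → t < q → ¬ t ∣ p)
    -- A lexicographic measure: first the distance of the candidate from the answer, then the trial
    -- divisors that remain. The second part never exceeds `leastPrime N`, which dictates the weight
    -- of the first.
    (fun σ' => (leastPrime N - (σ' 6).toNat) * (leastPrime N + 1) +
      ((σ' 6).toNat - (σ' 19).toNat))
    ?_ ?_ ?_ ⟨rfl, fun _ _ => rfl, N, 2, h6, by simpa using h19, le_rfl, le_leastPrime N, le_rfl, hN,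
      fun t h1 h2 => absurd h1 (by omega)⟩
  · rintro σ' w' ⟨-, hf, p, q, g6, g19, -, hp1, -, hq, -⟩
    exact hbdd σ' p q hf g6 g19 hp1 hq
  · rintro σ' w' ⟨rfl, hf, p, q, g6, g19, hNp, hp1, hq2, hq, hdvd⟩ he
    have hlt : q < p := by
      by_contra hcon
      have : ¬ ((q : ℤ) < p) := by exact_mod_cast hcon
      exact he (by simp only [Expr.eval_lt, Expr.eval_reg, g6, g19, if_neg this])
    refine Cmd.wp_ite (fun hc => ?_) (fun hc => ?_)
    · have hqp : q ∣ p := by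
        by_contra hcon
        have : ¬ ((p : ℤ) % q = 0) := by
          rw [← Int.natCast_mod]
          exact_mod_cast fun h => hcon (Nat.dvd_of_mod_eq_zero h)
        exact hc (by simp only [Expr.eval_eq, Expr.eval_mod, Expr.eval_reg, Expr.eval_lit, g6, g19,
          if_neg this])
      -- A proper divisor has been found, so the candidate can be increased without passing the
      -- answer.
      have hne : p ≠ leastPrime N := by
        rintro rfl
        rcases (Nat.dvd_prime (leastPrime_prime N)).1 hqp with h | h <;> omega
      refine Cmd.wp_seq (Cmd.wp_assign (Cmd.wp_assign
        ⟨⟨rfl, fun r hr => ?_, p + 1, 2, ?_, ?_, by omega, by omega, le_rfl, by omega,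
          fun t h1 h2 => absurd h1 (by omega)⟩, ?_⟩))
      · rw [← hf r hr]
        simp only [primeLoop, Cmd.targets, List.cons_append, List.nil_append, List.mem_cons,
          List.not_mem_nil, or_false, not_or] at hr
        rw [Function.update_of_ne hr.2.1, Function.update_of_ne hr.1]
      · simp [g6]
      · simp
      · simp only [Expr.eval_add, Expr.eval_reg, Expr.eval_lit, ne_eq, Fin.reduceEq,
          not_false_eq_true, Function.update_of_ne, Function.update_self, g6, g19, Int.toNat_natCast]
        have e1 : ((p : ℤ) + 1).toNat = p + 1 := by omega
        have e2 : (2 : ℤ).toNat = 2 := rfl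
        have e3 : leastPrime N - p = (leastPrime N - (p + 1)) + 1 := by omega
        rw [e1, e2, e3]
        rw [add_mul]
        omega
    · have hqp : ¬ q ∣ p := by
        intro hcon
        have : ((p : ℤ) % q = 0) := by
          rw [← Int.natCast_mod]
          exact_mod_cast Nat.mod_eq_zero_of_dvd hcon
        simp only [Expr.eval_eq, Expr.eval_mod, Expr.eval_reg, Expr.eval_lit, g6, g19,
          if_pos this] at hc
        exact one_ne_zero hc
      refine Cmd.wp_assign
        ⟨⟨rfl, fun r hr => ?_, p, q + 1, ?_, ?_, hNp, hp1, by omega, by omega,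
          fun t h1 h2 => ?_⟩, ?_⟩
      · rw [← hf r hr]
        simp only [primeLoop, Cmd.targets, List.cons_append, List.nil_append, List.mem_cons,
          List.not_mem_nil, or_false, not_or] at hr
        rw [Function.update_of_ne hr.2.1]
      · simp [g6]
      · simp [g19]
      · rcases Nat.lt_succ_iff_lt_or_eq.1 h2 with h | rfl
        · exact hdvd t h1 h
        · exact hqp
      · simp only [Expr.eval_add, Expr.eval_reg, Expr.eval_lit, ne_eq, Fin.reduceEq,
          not_false_eq_true, Function.update_of_ne, Function.update_self, g6, g19, Int.toNat_natCast]
        have e1 : ((q : ℤ) + 1).toNat = q + 1 := by omega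
        rw [e1]
        omega
  · rintro σ' w' ⟨rfl, hf, p, q, g6, g19, hNp, hp1, hq2, hq, hdvd⟩ he
    refine ⟨rfl, hbdd σ' p q hf g6 g19 hp1 hq, ?_⟩
    have hge : p ≤ q := by
      by_contra hcon
      have : (q : ℤ) < p := by exact_mod_cast not_le.1 hcon
      simp only [Expr.eval_lt, Expr.eval_reg, g6, g19, if_pos this] at he
      exact one_ne_zero he
    have hprime : p.Prime := by
      rw [Nat.prime_def_lt']
      exact ⟨by omega, fun t h1 h2 => hdvd t h1 (by omega)⟩
    rw [g6, le_antisymm hp1 (leastPrime_le hNp hprime)]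

theorem ofBits_append_singleton (l : List Bool) (a : Bool) :
    ofBits (l ++ [a]) = 2 * ofBits l + a.toNat := by
  simp [ofBits]

theorem ofBits_lt (l : List Bool) : ofBits l < 2 ^ l.length := by
  induction l using List.reverseRecOn with
  | nil => simp [ofBits]
  | append_singleton l a ih =>
    rw [ofBits_append_singleton, List.length_append, List.length_singleton, pow_succ]
    have : a.toNat ≤ 1 := Bool.toNat_le a
    omega

theorem flipLoop_wp {b W : ℕ} {σ : Store 21} {w : List Bool} (hb : σ.Bdd b)
    (h20 : σ 20 = W) (h7 : σ 7 = 0) (hw : W ≤ w.length) (hWb : W ≤ b) :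
    flipLoop.wp b (fun σ' w' => w' = w.drop W ∧ σ'.Bdd b ∧ σ' 7 = ofBits (w.take W)) σ w := by
  have hWb' : (W : ℤ) ≤ 2 ^ b := by simpa [h20] using hb 20
  refine Cmd.wp_rep W (fun s σ' w' => w' = w.drop s ∧ |σ' 18| ≤ 2 ^ b ∧
    σ' 7 = ofBits (w.take s)) h20 ⟨rfl, hb 18, by simp [h7, ofBits]⟩ ?_ ?_ ?_
  · rintro s σ' w' hs hf ht ⟨rfl, hg1, hg2⟩
    refine hb.of_targets hf ?_
    simp only [Cmd.rep, Cmd.targets, List.cons_append, List.nil_append, List.forall_mem_cons,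
      List.not_mem_nil, IsEmpty.forall_iff, implies_true, and_true, hg1, hg2, ht, Nat.abs_cast,
      true_and]
    constructor
    · have h1 := ofBits_lt (w.take s)
      have h2 : (w.take s).length ≤ b := by simp; omega
      exact_mod_cast h1.le.trans (Nat.pow_le_pow_right (by norm_num) h2)
    · have : ((W - s : ℕ) : ℤ) ≤ W := by omega
      linarith
  · rintro s σ' w' hs hf ht ⟨rfl, hg1, hg2⟩ -
    have hlen : s < w.length := by omega
    rw [List.drop_eq_getElem_cons hlen]
    refine Cmd.wp_seq (Cmd.wp_flip (Cmd.wp_assign ⟨by simpa using ht, rfl, ?_, ?_⟩))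
    · simp only [ne_eq, Fin.reduceEq, not_false_eq_true, Function.update_of_ne,
        Function.update_self]
      split_ifs <;> simp [one_le_pow₀]
    · rw [List.take_succ_eq_append_getElem hlen, ofBits_append_singleton]
      cases w[s] <;> simp [hg2]
  · rintro σ' w' hf ht ⟨rfl, hg1, hg2⟩ hb'
    exact ⟨rfl, hb', hg2⟩

theorem initCmd_wp {b n d e W : ℕ} {σ : Store 21} {w : List Bool} {eW : Expr 21} (hb : σ.Bdd b)
    (hn : 2 ≤ n) (he : 1 ≤ e) (h0 : σ 0 = n) (h1 : σ 1 = d) (h5 : σ 5 = 0) (h7 : σ 7 = 0)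
    (hW : ∀ σ' : Store 21, σ' 0 = n → σ' 1 = d → σ' 5 = n.size → eW.eval σ' = W)
    (hL : n.size ≤ 2 ^ b) (hp : leastPrime (n ^ e) ≤ 2 ^ b)
    (hw : W ≤ w.length) (hWb : W ≤ b) :
    (initCmd e eW).wp b (fun σ' w' => w' = w.drop W ∧ σ'.Bdd b ∧
      (∀ s : Fin 21, s < 5 → σ' s = σ s) ∧ σ' 8 = σ 8 ∧ σ' 5 = n.size ∧
      σ' 6 = leastPrime (n ^ e) ∧ σ' 7 = ofBits (w.take W)) σ w := by
  have hnb : |(n : ℤ)| ≤ 2 ^ b := by simpa [h0] using hb 0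
  have hlow : ∀ s : Fin 21, s < 5 → ∀ t : Fin 21, 5 ≤ t → s ≠ t :=
    fun s hs t ht h => by subst h; exact absurd hs (not_lt.2 ht)
  suffices h : (initCmd e eW).wp b (fun σ' w' => w' = w.drop W ∧ σ'.Bdd b ∧ σ' 5 = n.size ∧
      σ' 6 = leastPrime (n ^ e) ∧ σ' 7 = ofBits (w.take W)) σ w by
    refine h.mono ?_
    rintro σ' w' hf ⟨g1, g2, g3, g4, g5⟩
    refine ⟨g1, g2, fun s hs => hf s ?_, hf 8 (by simp [initCmd, sizeLoop, primeLoop, flipLoop, Cmd.rep, Cmd.targets]), g3, g4, g5⟩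
    have hne := hlow s hs
    simp only [initCmd, sizeLoop, primeLoop, flipLoop, Cmd.rep, Cmd.targets, List.cons_append,
      List.nil_append, List.mem_cons, List.not_mem_nil, or_false, not_or]
    refine ⟨?_, ?_, ?_, ?_, ?_, ?_, ?_, ?_, ?_, ?_, ?_, ?_⟩ <;> exact hne _ (by decide)
  have hn2 : 2 ≤ n ^ e := hn.trans (Nat.le_self_pow (by omega) n)
  refine Cmd.wp_seq (Cmd.wp_assign (Cmd.wp_seq ((sizeLoop_wp (n := n) (hb.update _ ?_) ?_ ?_
    hL).mono ?_)))
  · simpa [h0] using hnb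
  · simp [h0]
  · simp [h5]
  rintro σ₁ w₁ hf₁ ⟨rfl, hb₁, g5⟩
  have e0 : σ₁ 0 = n := by rw [hf₁ 0 (by decide)]; simp [h0]
  have e1 : σ₁ 1 = d := by rw [hf₁ 1 (by decide)]; simp [h1]
  have e7 : σ₁ 7 = 0 := by rw [hf₁ 7 (by decide)]; simp [h7]
  have hp2 : 2 ≤ leastPrime (n ^ e) := (leastPrime_prime _).two_le
  refine Cmd.wp_seq (Cmd.wp_assign (Cmd.wp_seq (Cmd.wp_assign (Cmd.wp_seq
    ((primeLoop_wp (N := n ^ e) (Store.Bdd.update (hb₁.update _ ?_) _ ?_) hn2 ?_ ?_ hp).mono ?_)))))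
  · simp only [Expr.eval_npow, Expr.eval_reg, e0]
    rw [← Nat.cast_pow, Nat.abs_cast]
    exact_mod_cast (le_leastPrime _).trans hp
  · simp only [Expr.eval_lit]
    have : ((2 : ℕ) : ℤ) ≤ 2 ^ b := by exact_mod_cast hp2.trans hp
    simpa using this
  · simp [e0]
  · simp
  rintro σ₂ w₂ hf₂ ⟨rfl, hb₂, g6⟩
  have e0' : σ₂ 0 = n := by rw [hf₂ 0 (by decide)]; simp [e0]
  have e1' : σ₂ 1 = d := by rw [hf₂ 1 (by decide)]; simp [e1]
  have e7' : σ₂ 7 = 0 := by rw [hf₂ 7 (by decide)]; simp [e7]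
  have e5' : σ₂ 5 = n.size := by rw [hf₂ 5 (by decide)]; simp [g5]
  refine Cmd.wp_seq (Cmd.wp_assign ?_)
  rw [hW σ₂ e0' e1' e5']
  have hWb' : |(W : ℤ)| ≤ 2 ^ b := by
    rw [Nat.abs_cast]
    exact_mod_cast (hWb.trans Nat.lt_two_pow_self.le)
  refine (flipLoop_wp (W := W) (hb₂.update _ hWb') (by simp) (by simpa using e7') hw hWb).mono ?_
  rintro σ₃ w₃ hf₃ ⟨rfl, hb₃, g7⟩
  exact ⟨rfl, hb₃, by rw [hf₃ 5 (by decide)]; simpa using e5',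
    by rw [hf₃ 6 (by decide)]; simpa using g6, g7⟩

/-! ### Output -/

/-- The smallest of `1, …, s` with property `T`, unless `o` is nonzero already; `0` if there is
none. -/
def scan (T : ℕ → Prop) [DecidablePred T] (o : ℕ) : ℕ → ℕ
  | 0 => o
  | s + 1 => if scan T o s = 0 ∧ T (s + 1) then s + 1 else scan T o s

/-- The sketch `A, F` of a level looks like that of a multiple of the unit vector `i`. -/
def Passes (p r : ℕ) (A F : ℤ) (i : ℕ) : Prop := A ≠ 0 ∧ (p : ℤ) ∣ A * r ^ i - F

instance (p r : ℕ) (A F : ℤ) : DecidablePred (Passes p r A F) := fun _ =>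
  inferInstanceAs (Decidable (_ ∧ _))

/-- Scan of the levels of a copy for an index that passes the test. -/
def levelScan (p n r : ℕ) (A F : ℕ → ℤ) (o : ℕ) : ℕ → ℕ
  | 0 => o
  | j + 1 => scan (Passes p r (A j) (F j)) (levelScan p n r A F o j) n

/-- Scan of the copies. -/
def copyScan (p n m J U : ℕ) (A F : ℕ → ℤ) : ℕ → ℕ
  | 0 => 0
  | c + 1 => levelScan p n (U / p ^ ((m + 1) * c) % p) (fun j => A (J * c + j))
      (fun j => F (J * c + j)) (copyScan p n m J U A F c) J

/-- The packed sketch of `k` slots beginning with slot `s`. -/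
def pack (p : ℕ) (A F : ℕ → ℤ) : ℕ → ℕ → ℤ
  | 0, _ => 0
  | k + 1, s => A s + p ^ 3 * (F s + p ^ 3 * pack p A F k (s + 1))

/-- Removal of the lowest digit of the packed sketch, which goes to register `t`. -/
def popCmd (t : Fin 21) : Cmd 21 :=
  .seq (.assign t ((.reg 8 + (Expr.reg 6).npow 2) % (Expr.reg 6).npow 3 - (Expr.reg 6).npow 2))
    (.assign 8 ((.reg 8 + (Expr.reg 6).npow 2) / (Expr.reg 6).npow 3))

/-- Scan of all indices at one level. -/
def scanLoop : Cmd 21 := .rep 18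
  (.seq (.ite (.reg 4) .skip (.ite (.reg 9)
      (.ite ((.reg 9 * .reg 14 - .reg 10) % .reg 6) .skip (.assign 4 (.reg 17))) .skip))
  (.seq (.assign 17 (.reg 17 + .lit 1))
  (.assign 14 (.reg 14 * .reg 13 % .reg 6))))

/-- Scan of all levels of a copy. -/
def levelsLoop : Cmd 21 := .rep 15
  (.seq (popCmd 9)
  (.seq (popCmd 10)
  (.seq (.assign 17 (.lit 1))
  (.seq (.assign 14 (.reg 13))
  (.seq (.assign 18 (.reg 0))
  scanLoop)))))

/-- Removal of the coefficients of the hash function. -/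
def skipLoop : Cmd 21 := .rep 15 (.assign 11 (.reg 11 / .reg 6))

/-- Scan of a copy. -/
def scanBody (m J : Expr 21) : Cmd 21 :=
  .seq (.assign 13 (.reg 11 % .reg 6))
  (.seq (.assign 11 (.reg 11 / .reg 6))
  (.seq (.assign 15 m)
  (.seq skipLoop
  (.seq (.assign 15 J)
  levelsLoop))))

/-- The program run at the end of the stream. -/
def outputCmd (m J D : Expr 21) : Cmd 21 :=
  .seq (.assign 11 (.reg 7))
  (.seq (.assign 12 D)
  (.rep 12 (scanBody m J)))

/-! ### Correctness of the output program -/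

theorem scan_le {T : ℕ → Prop} [DecidablePred T] {o n : ℕ} (ho : o ≤ n) :
    ∀ s ≤ n, scan T o s ≤ n
  | 0, _ => ho
  | s + 1, hs => by
    rw [scan]
    split_ifs
    · exact hs
    · exact scan_le ho s (by omega)

theorem levelScan_le {p n r : ℕ} {A F : ℕ → ℤ} {o : ℕ} (ho : o ≤ n) :
    ∀ j, levelScan p n r A F o j ≤ n
  | 0 => ho
  | j + 1 => scan_le (levelScan_le ho j) n le_rfl

theorem copyScan_le {p n m J U : ℕ} {A F : ℕ → ℤ} :
    ∀ c, copyScan p n m J U A F c ≤ n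
  | 0 => Nat.zero_le _
  | c + 1 => levelScan_le (copyScan_le c) J

/-- Digits of the sketch may be negative. Adding `H` makes the lowest one nonnegative before the
Euclidean division, and the shift is undone on the remainder. -/
theorem digit_emod {a t H Q : ℤ} (ha : |a| < H) (hQ : 2 * H ≤ Q) :
    (a + Q * t + H) % Q - H = a ∧ (a + Q * t + H) / Q = t := by
  obtain ⟨h1, h2⟩ := abs_lt.1 ha
  have e : a + Q * t + H = (a + H) + Q * t := by ring
  have hQ0 : Q ≠ 0 := by omega
  rw [e, Int.add_mul_emod_self_left, Int.add_mul_ediv_left _ _ hQ0,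
    Int.emod_eq_of_lt (by omega) (by omega), Int.ediv_eq_zero_of_lt (by omega) (by omega)]
  omega

theorem two_mul_sq_le_cube {p : ℕ} (hp : 2 ≤ p) : 2 * (p : ℤ) ^ 2 ≤ p ^ 3 := by
  have : (2 : ℤ) ≤ p := by exact_mod_cast hp
  have : 0 ≤ (p : ℤ) ^ 2 := by positivity
  nlinarith [pow_succ (p : ℤ) 2]

/-- Strictness of the bound on the higher part leaves a slack of `p ^ 3`, which absorbs a signed
digit below `p ^ 2`. -/
theorem abs_pack_lt {p : ℕ} (hp : 2 ≤ p) {A F : ℕ → ℤ} (hA : ∀ s, |A s| < (p : ℤ) ^ 2)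
    (hF : ∀ s, |F s| < (p : ℤ) ^ 2) : ∀ k s, |pack p A F k s| < (p : ℤ) ^ (6 * k)
  | 0, s => by simp [pack]
  | k + 1, s => by
    have ih := abs_pack_lt hp hA hF k (s + 1)
    have hp' : (2 : ℤ) ≤ p := by exact_mod_cast hp
    have key : ∀ a t : ℤ, ∀ j : ℕ, |a| < (p : ℤ) ^ 2 → |t| < (p : ℤ) ^ j →
        |a + p ^ 3 * t| < (p : ℤ) ^ (j + 3) := by
      intro a t j ha ht
      have h1 : |a + p ^ 3 * t| ≤ |a| + p ^ 3 * |t| := by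
        refine (abs_add_le _ _).trans_eq ?_
        rw [abs_mul, abs_of_nonneg (by positivity : (0 : ℤ) ≤ (p : ℤ) ^ 3)]
      have h2 : (p : ℤ) ^ 3 * (|t| + 1) ≤ p ^ 3 * p ^ j :=
        mul_le_mul_of_nonneg_left ht (by positivity)
      have h3 := two_mul_sq_le_cube hp
      have h4 : (0 : ℤ) ≤ (p : ℤ) ^ 2 := by positivity
      rw [pow_add]
      linarith
    have e : 6 * (k + 1) = 6 * k + 3 + 3 := by ring
    rw [pack, e]
    exact key _ _ _ (hA s) (key _ _ _ (hF s) ih)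

/-- A nonzero quotient outweighs the digit, so removing a digit cannot increase the absolute value.
This bounds the sketch between the two removals at a level. -/
theorem abs_le_abs_add_cube_mul {p : ℕ} (hp : 2 ≤ p) {a : ℤ} (ha : |a| < (p : ℤ) ^ 2) (y : ℤ) :
    |y| ≤ |a + p ^ 3 * y| := by
  rcases eq_or_ne y 0 with h0 | h0
  · rw [h0]; simp
  · have h3 := two_mul_sq_le_cube hp
    have h5 : |(p : ℤ) ^ 3 * y| ≤ |a + p ^ 3 * y| + |a| := by
      have := abs_sub (a + p ^ 3 * y) a
      rwa [add_sub_cancel_left] at this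
    rw [abs_mul, abs_of_nonneg (by positivity : (0 : ℤ) ≤ (p : ℤ) ^ 3)] at h5
    have h6 : 1 ≤ |y| := Int.one_le_abs h0
    have h7 : (2 : ℤ) ≤ p := by exact_mod_cast hp
    have h8 : (4 : ℤ) ≤ (p : ℤ) ^ 2 := by nlinarith
    nlinarith

theorem popCmd_wp {b p : ℕ} {a T : ℤ} {t : Fin 21} {Q : Store 21 → List Bool → Prop}
    {σ : Store 21} {w : List Bool} (hp : 2 ≤ p) (ht6 : t ≠ 6) (ht8 : t ≠ 8)
    (h6 : σ 6 = p) (h8 : σ 8 = a + p ^ 3 * T) (ha : |a| < (p : ℤ) ^ 2)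
    (hQ : Q (Function.update (Function.update σ t a) 8 T) w) : (popCmd t).wp b Q σ w := by
  obtain ⟨h1, h2⟩ := digit_emod (t := T) ha (two_mul_sq_le_cube hp)
  refine Cmd.wp_seq (Cmd.wp_assign (Cmd.wp_assign ?_))
  simp only [Expr.eval_div, Expr.eval_sub, Expr.eval_mod, Expr.eval_add, Expr.eval_npow,
    Expr.eval_reg, Function.update_of_ne ht6.symm, Function.update_of_ne ht8.symm, h6, h8, h1, h2]
  exact hQ

theorem scanLoop_wp {b n p r o : ℕ} {A F : ℤ} {σ : Store 21} {w : List Bool}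
    (hb : σ.Bdd b) (hp : 2 ≤ p) (hr : r < p) (hnp : n < p) (ho : o ≤ n) (h6 : σ 6 = p)
    (h4 : σ 4 = o) (h9 : σ 9 = A) (h10 : σ 10 = F) (h13 : σ 13 = r) (h14 : σ 14 = r)
    (h17 : σ 17 = 1) (h18 : σ 18 = n) :
    scanLoop.wp b (fun σ' w' => w' = w ∧ σ'.Bdd b ∧
      σ' 4 = scan (Passes p r A F) o n) σ w := by
  have hpb : (p : ℤ) ≤ 2 ^ b := by simpa [h6] using hb 6
  refine Cmd.wp_rep n (fun s σ' w' => w' = w ∧ σ' 4 = scan (Passes p r A F) o s ∧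
    σ' 17 = ((s + 1 : ℕ) : ℤ) ∧ σ' 14 = ((r ^ (s + 1) % p : ℕ) : ℤ)) h18
    ⟨rfl, by simp [h4, scan], by simp [h17], by simp [h14, Nat.mod_eq_of_lt hr]⟩ ?_ ?_ ?_
  · rintro s σ' w' hs hf ht ⟨rfl, g4, g17, g14⟩
    refine hb.of_targets hf ?_
    simp only [Cmd.rep, Cmd.targets, List.cons_append, List.nil_append, List.forall_mem_cons,
      List.not_mem_nil, IsEmpty.forall_iff, implies_true, and_true, g4, g17, g14, ht,
      Nat.abs_cast]
    have h1 : scan (Passes p r A F) o s ≤ n := scan_le ho s hs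
    have h2 : r ^ (s + 1) % p < p := Nat.mod_lt _ (by omega)
    refine ⟨le_trans ?_ hpb, le_trans ?_ hpb, le_trans ?_ hpb, le_trans ?_ hpb⟩ <;>
      · norm_cast; omega
  · rintro s σ' w' hs hf ht ⟨rfl, g4, g17, g14⟩ -
    have e6 : σ' 6 = p := (hf 6 (by decide)).trans h6
    have e9 : σ' 9 = A := (hf 9 (by decide)).trans h9
    have e10 : σ' 10 = F := (hf 10 (by decide)).trans h10
    have e13 : σ' 13 = r := (hf 13 (by decide)).trans h13
    -- Register `14` holds the power of the root only modulo `p`, which does not affect the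
    -- divisibility test.
    have hpass : (A * ((r ^ (s + 1) % p : ℕ) : ℤ) - F) % p = 0 ↔
        (p : ℤ) ∣ A * (r : ℤ) ^ (s + 1) - F := by
      rw [Int.dvd_iff_emod_eq_zero]
      push_cast
      rw [Int.sub_emod, Int.mul_emod, Int.emod_emod_of_dvd _ dvd_rfl, ← Int.mul_emod,
        ← Int.sub_emod]
    -- The branches of the test differ in register `4` only; what follows them is treated once.
    have hrest : ∀ σ₁ : Store 21, σ₁ 4 = scan (Passes p r A F) o (s + 1) →
        (∀ t, t ≠ 4 → σ₁ t = σ' t) →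
        ((Cmd.assign 17 (Expr.reg 17 + .lit 1)).seq
          (.assign 14 (.reg 14 * .reg 13 % .reg 6)) : Cmd 21).wp b (fun σ₁ w₁ =>
            σ₁ 18 = ((n - s : ℕ) : ℤ) ∧ (w₁ = w' ∧
            Function.update σ₁ 18 ((n - (s + 1) : ℕ) : ℤ) 4 =
              scan (Passes p r A F) o (s + 1) ∧
            Function.update σ₁ 18 ((n - (s + 1) : ℕ) : ℤ) 17 = ((s + 1 + 1 : ℕ) : ℤ) ∧
            Function.update σ₁ 18 ((n - (s + 1) : ℕ) : ℤ) 14 =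
              ((r ^ (s + 1 + 1) % p : ℕ) : ℤ))) σ₁ w' := by
      intro σ₁ g4' hne
      refine Cmd.wp_seq (Cmd.wp_assign (Cmd.wp_assign ⟨?_, rfl, ?_, ?_, ?_⟩))
      · simpa [hne 18 (by decide)] using ht
      · simpa using g4'
      · simp [hne 17 (by decide), g17]
      · simp only [Expr.eval_mod, Expr.eval_mul, Expr.eval_reg, hne 14 (by decide),
          hne 13 (by decide), hne 6 (by decide), g14, e6, e13, ne_eq, Fin.reduceEq,
          not_false_eq_true, Function.update_of_ne, Function.update_self, pow_succ _ (s + 1)]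
        push_cast
        exact Int.ModEq.mul_right _ (Int.mod_modEq _ _)
    refine Cmd.wp_seq (Cmd.wp_ite (fun he => ?_) fun he => Cmd.wp_ite (fun he1 => Cmd.wp_ite
      (fun he2 => ?_) fun he2 => ?_) fun he1 => ?_)
    · refine Cmd.wp_skip (hrest σ' ?_ fun _ _ => rfl)
      rw [Expr.eval_reg, g4] at he
      rw [g4, scan, if_neg (fun h => he (by exact_mod_cast h.1))]
    · refine Cmd.wp_skip (hrest σ' ?_ fun _ _ => rfl)
      simp only [Expr.eval_mod, Expr.eval_sub, Expr.eval_mul, Expr.eval_reg, e9, e10, e6, g14,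
        ne_eq, hpass] at he2
      rw [g4, scan, if_neg (fun h => he2 h.2.2)]
    · refine Cmd.wp_assign (hrest _ ?_ fun t ht => Function.update_of_ne ht _ _)
      simp only [Expr.eval_mod, Expr.eval_sub, Expr.eval_mul, Expr.eval_reg, e9, e10, e6, g14,
        ne_eq, hpass] at he2 he1
      rw [Expr.eval_reg, g4] at he
      rw [scan, if_pos ⟨by exact_mod_cast he, he1, he2⟩]
      simp [g17]
    · refine Cmd.wp_skip (hrest σ' ?_ fun _ _ => rfl)
      rw [Expr.eval_reg, e9] at he1
      rw [g4, scan, if_neg (fun h => h.2.1 he1)]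
  · rintro σ' w' hf ht ⟨rfl, g4, -, -⟩ hb'
    exact ⟨rfl, hb', g4⟩

theorem levelsLoop_wp {b n m p J D U c r o : ℕ} {A F : ℕ → ℤ} {σ : Store 21} {w : List Bool}
    (hFit : Fits b n p m J D U) (hb : σ.Bdd b) (hr : r < p) (ho : o ≤ n) (hc : c < D)
    (hA : ∀ s, |A s| < (p : ℤ) ^ 2) (hF : ∀ s, |F s| < (p : ℤ) ^ 2)
    (h0 : σ 0 = n) (h6 : σ 6 = p) (h4 : σ 4 = o) (h13 : σ 13 = r) (h15 : σ 15 = J)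
    (h8 : σ 8 = pack p A F (J * (D - c)) (J * c)) :
    levelsLoop.wp b (fun σ' w' => w' = w ∧ σ'.Bdd b ∧
      σ' 8 = pack p A F (J * (D - (c + 1))) (J * (c + 1)) ∧
      σ' 4 = levelScan p n r (fun j => A (J * c + j)) (fun j => F (J * c + j)) o J) σ w := by
  obtain ⟨hp, hJ0, -, hJb, -, -, -, -, hlev, hsk, hsq, hnp⟩ := hFit
  have hpb : p ≤ 2 ^ b := le_trans (Nat.le_mul_of_pos_right _ (by positivity)) hlev
  have hsq' : (p : ℤ) ^ 2 ≤ 2 ^ b := by exact_mod_cast hsq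
  have hAb : ∀ s, |A s| ≤ 2 ^ b := fun s => (hA s).le.trans hsq'
  have hFb : ∀ s, |F s| ≤ 2 ^ b := fun s => (hF s).le.trans hsq'
  have hpack : ∀ k s, k ≤ J * D → |pack p A F k s| ≤ 2 ^ b := fun k s hk => by
    refine (abs_pack_lt hp hA hF k s).le.trans ?_
    have h1 : p ^ (6 * k) ≤ p ^ (6 * (J * D)) :=
      Nat.pow_le_pow_right (by omega) (Nat.mul_le_mul_left _ hk)
    exact_mod_cast h1.trans hsk
  have hle : J * (D - c) ≤ J * D := Nat.mul_le_mul_left _ (Nat.sub_le _ _)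
  have hrem : J * (D - c) = J * (D - (c + 1)) + J := by
    rw [show D - c = D - (c + 1) + 1 by omega, mul_add, mul_one]
  refine Cmd.wp_rep J (fun j σ' w' => w' = w ∧ σ'.Bdd b ∧
    σ' 8 = pack p A F (J * (D - (c + 1)) + (J - j)) (J * c + j) ∧
    σ' 4 = levelScan p n r (fun j => A (J * c + j)) (fun j => F (J * c + j)) o j) h15
    ⟨rfl, hb, by simp [h8, hrem], by simp [h4, levelScan]⟩ ?_ ?_ ?_
  · rintro s σ' w' - - - ⟨-, h, -⟩
    exact h
  · rintro j σ' w' hj hf ht ⟨rfl, hb', g8, g4⟩ -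
    have e0 : σ' 0 = n := (hf 0 (by decide)).trans h0
    have e6 : σ' 6 = p := (hf 6 (by decide)).trans h6
    have e13 : σ' 13 = r := (hf 13 (by decide)).trans h13
    set k := J * (D - (c + 1)) + (J - (j + 1)) with hk
    have hk1 : J * (D - (c + 1)) + (J - j) = k + 1 := by omega
    rw [hk1, pack] at g8
    have hT := hpack k (J * c + j + 1) (by omega)
    have hx0 : |F (J * c + j) + p ^ 3 * pack p A F k (J * c + j + 1)| ≤ 2 ^ b := by
      have h1 := hpack (k + 1) (J * c + j) (by omega)
      rw [pack] at h1
      exact (abs_le_abs_add_cube_mul hp (hA _) _).trans h1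
    refine Cmd.wp_seq (popCmd_wp (T := F (J * c + j) + p ^ 3 * pack p A F k (J * c + j + 1))
      hp (by decide) (by decide) e6 g8 (hA _) ?_)
    refine Cmd.wp_seq (popCmd_wp (p := p) (a := F (J * c + j))
      (T := pack p A F k (J * c + j + 1)) hp (by decide) (by decide) (by simpa using e6)
      (by simp) (hF _) ?_)
    refine Cmd.wp_seq (Cmd.wp_assign (Cmd.wp_seq (Cmd.wp_assign (Cmd.wp_seq (Cmd.wp_assign ?_)))))
    refine (scanLoop_wp (n := n) (p := p) (r := r)
      (o := levelScan p n r (fun j => A (J * c + j)) (fun j => F (J * c + j)) o j)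
      (A := A (J * c + j)) (F := F (J * c + j)) ?_ hp hr hnp (levelScan_le ho j)
      ?_ ?_ ?_ ?_ ?_ ?_ ?_ ?_).mono ?_
    · refine Store.Bdd.update (Store.Bdd.update (Store.Bdd.update (Store.Bdd.update
        (Store.Bdd.update (Store.Bdd.update (Store.Bdd.update hb' _ (hAb _)) _ hx0) _ (hFb _))
        _ hT) _ ?_) _ ?_) _ ?_
      · simp [one_le_pow₀]
      · simpa using hb' 13
      · simpa using hb' 0
    · simpa using e6
    · simpa using g4
    · simp
    · simp
    · simpa using e13
    · simpa using e13
    · simp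
    · simpa using e0
    rintro σ₁ w₁ hf₁ ⟨rfl, hb₁, g4'⟩
    refine ⟨by rw [hf₁ 15 (by decide)]; simpa using ht, rfl, hb₁.update _ ?_, ?_, ?_⟩
    · have h1 : J - (j + 1) ≤ 2 ^ b := (Nat.sub_le _ _).trans hJb
      rw [Nat.abs_cast]
      exact_mod_cast h1
    · rw [Function.update_of_ne (by decide), hf₁ 8 (by decide)]
      simp [add_assoc]
    · rw [Function.update_of_ne (by decide), g4', levelScan]
  · rintro σ' w' hf ht ⟨rfl, hb', g8, g4⟩ -
    exact ⟨rfl, hb', by simpa [mul_add] using g8, g4⟩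

theorem skipLoop_wp {b m p V : ℕ} {σ : Store 21} {w : List Bool} (hb : σ.Bdd b)
    (h6 : σ 6 = p) (h11 : σ 11 = V) (h15 : σ 15 = m) :
    skipLoop.wp b (fun σ' w' => w' = w ∧ σ'.Bdd b ∧ σ' 11 = ((V / p ^ m : ℕ) : ℤ)) σ w := by
  have hVb : (V : ℤ) ≤ 2 ^ b := by simpa [h11] using hb 11
  have hmb : (m : ℤ) ≤ 2 ^ b := by simpa [h15] using hb 15
  refine Cmd.wp_rep m (fun s σ' w' => w' = w ∧ σ' 11 = ((V / p ^ s : ℕ) : ℤ)) h15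
    ⟨rfl, by simp [h11]⟩ ?_ ?_ ?_
  · rintro s σ' w' hs hf ht ⟨rfl, hg⟩
    refine hb.of_targets hf ?_
    simp only [Cmd.rep, Cmd.targets, List.cons_append, List.nil_append, List.forall_mem_cons,
      List.not_mem_nil, IsEmpty.forall_iff, implies_true, and_true, hg, ht, Nat.abs_cast]
    constructor
    · have : ((V / p ^ s : ℕ) : ℤ) ≤ V := by exact_mod_cast Nat.div_le_self _ _
      linarith
    · have : ((m - s : ℕ) : ℤ) ≤ m := by omega
      linarith
  · rintro s σ' w' hs hf ht ⟨rfl, hg⟩ -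
    have e6 : σ' 6 = p := (hf 6 (by decide)).trans h6
    refine Cmd.wp_assign ⟨by simpa using ht, rfl, ?_⟩
    simp [hg, e6, pow_succ, ← Nat.div_div_eq_div_mul]
  · rintro σ' w' hf ht ⟨rfl, hg⟩ hb'
    exact ⟨rfl, hb', hg⟩

/-- Seed and sketch are consumed in step, one copy at a time. The test needs only the root, the
first digit of the seed of a copy; the `m` hash coefficients are skipped. -/
theorem outputCmd_wp {b n m p J D U : ℕ} {A F : ℕ → ℤ} {σ : Store 21} {w : List Bool}
    {em eJ eD : Expr 21}
    (hFit : Fits b n p m J D U) (hb : σ.Bdd b)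
    (hA : ∀ s, |A s| < (p : ℤ) ^ 2) (hF : ∀ s, |F s| < (p : ℤ) ^ 2)
    (hm : ∀ σ' : Store 21, σ' 1 = σ 1 → σ' 5 = σ 5 → em.eval σ' = m)
    (hJ : ∀ σ' : Store 21, σ' 1 = σ 1 → σ' 5 = σ 5 → eJ.eval σ' = J)
    (hD : ∀ σ' : Store 21, σ' 1 = σ 1 → σ' 5 = σ 5 → eD.eval σ' = D)
    (h0 : σ 0 = n) (h6 : σ 6 = p) (h4 : σ 4 = 0) (h7 : σ 7 = U)
    (h8 : σ 8 = pack p A F (J * D) 0) :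
    (outputCmd em eJ eD).wp b (fun σ' w' => w' = w ∧ σ'.Bdd b ∧
      σ' 4 = copyScan p n m J U A F D) σ w := by
  have hDb : |(D : ℤ)| ≤ 2 ^ b := by rw [Nat.abs_cast]; exact_mod_cast hFit.D_le
  have hpb : p ≤ 2 ^ b := le_trans (Nat.le_mul_of_pos_right _ (by positivity)) hFit.level_le
  have hmb := hFit.m_le
  have hJb := hFit.J_le
  have hUb := hFit.U_le
  have hp := hFit.two_le
  refine Cmd.wp_seq (Cmd.wp_assign (Cmd.wp_seq (Cmd.wp_assign ?_)))
  rw [hD _ (by simp) (by simp)]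
  refine Cmd.wp_rep D (fun c σ' w' => w' = w ∧ σ'.Bdd b ∧
    σ' 11 = ((U / p ^ ((m + 1) * c) : ℕ) : ℤ) ∧
    σ' 8 = pack p A F (J * (D - c)) (J * c) ∧ σ' 4 = copyScan p n m J U A F c) (by simp)
    ⟨rfl, Store.Bdd.update (hb.update _ (by simpa using hb 7)) _ hDb, by simp [h7], by simp [h8],
      by simp [h4, copyScan]⟩ ?_ ?_ ?_
  · rintro s σ' w' - - - ⟨-, h, -⟩
    exact h
  · rintro c σ' w' hc hf ht ⟨rfl, hb', g11, g8, g4⟩ -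
    have hfσ : ∀ r : Fin 21, r ∉ [4, 8, 9, 10, 11, 12, 13, 14, 15, 17, 18] → σ' r = σ r := by
      intro r hr
      simp only [List.mem_cons, List.not_mem_nil, or_false, not_or] at hr
      rw [hf r (by
        simp [scanBody, skipLoop, levelsLoop, scanLoop, popCmd, Cmd.rep, Cmd.targets, hr]),
        Function.update_of_ne (by tauto), Function.update_of_ne (by tauto)]
    set V := U / p ^ ((m + 1) * c) with hV
    have hVU : V ≤ U := Nat.div_le_self _ _
    have hrp : V % p < p := Nat.mod_lt _ (by omega)
    have cast_le : ∀ y : ℕ, y ≤ 2 ^ b → |(y : ℤ)| ≤ 2 ^ b := fun y hy => by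
      rw [Nat.abs_cast]; exact_mod_cast hy
    have e0 : σ' 0 = n := (hfσ 0 (by decide)).trans h0
    have e1 : σ' 1 = σ 1 := hfσ 1 (by decide)
    have e5 : σ' 5 = σ 5 := hfσ 5 (by decide)
    have e6 : σ' 6 = p := (hfσ 6 (by decide)).trans h6
    refine Cmd.wp_seq (Cmd.wp_assign (Cmd.wp_seq (Cmd.wp_assign (Cmd.wp_seq (Cmd.wp_assign
      (Cmd.wp_seq ?_))))))
    rw [hm _ (by simp [e1]) (by simp [e5])]
    refine (skipLoop_wp (p := p) (V := V / p) (m := m) ?_ ?_ ?_ ?_).mono ?_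
    · refine Store.Bdd.update (Store.Bdd.update (Store.Bdd.update hb' _ ?_) _ ?_) _
        (cast_le _ hmb)
      · simpa [g11, e6] using cast_le _ (hrp.le.trans hpb)
      · simpa [g11, e6] using cast_le _ (((Nat.div_le_self _ _).trans hVU).trans hUb)
    · simp [e6]
    · simp [g11, e6]
    · simp
    rintro σ₁ w₁ hf₁ ⟨rfl, hb₁, g11'⟩
    refine Cmd.wp_seq (Cmd.wp_assign ?_)
    rw [hJ _ (by rw [hf₁ 1 (by decide)]; simp [e1])
      (by rw [hf₁ 5 (by decide)]; simp [e5])]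
    refine (levelsLoop_wp (r := V % p) (o := copyScan p n m J U A F c) hFit
      (hb₁.update _ (cast_le _ hJb)) hrp (copyScan_le c) hc hA hF ?_ ?_ ?_ ?_ ?_ ?_).mono ?_
    · rw [Function.update_of_ne (by decide), hf₁ 0 (by decide)]; simp [e0]
    · rw [Function.update_of_ne (by decide), hf₁ 6 (by decide)]; simp [e6]
    · rw [Function.update_of_ne (by decide), hf₁ 4 (by decide)]; simp [g4]
    · rw [Function.update_of_ne (by decide), hf₁ 13 (by decide)]; simp [g11, e6]
    · simp
    · rw [Function.update_of_ne (by decide), hf₁ 8 (by decide)]; simp [g8]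
    rintro σ₂ w₂ hf₂ ⟨rfl, hb₂, g8', g4'⟩
    refine ⟨?_, rfl, hb₂.update _ (cast_le _ ((Nat.sub_le _ _).trans hFit.D_le)), ?_, ?_, ?_⟩
    · rw [hf₂ 12 (by decide), Function.update_of_ne (by decide), hf₁ 12 (by decide)]
      simpa using ht
    · rw [Function.update_of_ne (by decide), hf₂ 11 (by decide),
        Function.update_of_ne (by decide), g11', hV]
      simp only [Nat.div_div_eq_div_mul]
      congr 2
      ring
    · rw [Function.update_of_ne (by decide), g8']
    · rw [Function.update_of_ne (by decide), g4', copyScan]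
  · rintro σ' w' hf ht ⟨rfl, hb', -, -, g4⟩ -
    exact ⟨rfl, hb', g4⟩

/-! ### Whole streams -/

/-- Number of coefficients of the hash function. -/
def digitsExpr (κ : ℕ) : Expr 21 := .lit κ * .reg 5 + .lit 2

/-- Number of levels. -/
def levelsExpr : Expr 21 := .reg 5 + .lit 3

/-- Number of copies. -/
def copiesExpr : Expr 21 := .lit 12 * .reg 1

/-- Number of coins. -/
def coinsExpr (κ e γ : ℕ) : Expr 21 :=
  copiesExpr * (digitsExpr κ + .lit 1) * (.lit e * .reg 5 + .lit 1) + .reg 1 + .lit γ * .reg 5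

/-- The sampling algorithm. -/
def sampler (κ e γ : ℕ) : StreamAlg where
  regs := 16
  init := initCmd e (coinsExpr κ e γ)
  update := updateCmd (digitsExpr κ) levelsExpr copiesExpr
  output := outputCmd (digitsExpr κ) levelsExpr copiesExpr

/-- Sum of the coordinates at a level. -/
def levelSum (p m V : ℕ) {n : ℕ} (x : Fin n → ℤ) (j : ℕ) : ℤ :=
  ∑ i : Fin n, if hashv p m V (i + 1) * 2 ^ j < p then x i else 0

/-- Fingerprint of the coordinates at a level. -/
def levelPrint (p m V : ℕ) {n : ℕ} (x : Fin n → ℤ) (j : ℕ) : ℤ :=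
  ∑ i : Fin n, if hashv p m V (i + 1) * 2 ^ j < p then
    x i * (((V % p) ^ ((i : ℕ) + 1) % p : ℕ) : ℤ) else 0

/-- Output of a copy with random digits `V` for the vector `x`. -/
def copyOut (p m J V : ℕ) {n : ℕ} (x : Fin n → ℤ) : ℕ :=
  levelScan p n (V % p) (levelSum p m V x) (levelPrint p m V x) 0 J

/-- Output for the vector `x` with random digits `U`. -/
def outOf (p m J U : ℕ) {n : ℕ} (x : Fin n → ℤ) : ℕ → ℕ
  | 0 => 0
  | c + 1 => if outOf p m J U x c = 0 then copyOut p m J (U / p ^ ((m + 1) * c)) x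
      else outOf p m J U x c

/-! ### From the program to the abstract output function -/

theorem scan_of_ne_zero {T : ℕ → Prop} [DecidablePred T] {o : ℕ} (ho : o ≠ 0) :
    ∀ s, scan T o s = o
  | 0 => rfl
  | s + 1 => by rw [scan, scan_of_ne_zero ho s, if_neg (fun h => ho h.1)]

theorem levelScan_of_ne_zero {p n r : ℕ} {A F : ℕ → ℤ} {o : ℕ} (ho : o ≠ 0) :
    ∀ j, levelScan p n r A F o j = o
  | 0 => rfl
  | j + 1 => by rw [levelScan, levelScan_of_ne_zero ho j, scan_of_ne_zero ho]

theorem levelScan_congr {p n r o : ℕ} {A F A' F' : ℕ → ℤ} :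
    ∀ J, (∀ j < J, A j = A' j) → (∀ j < J, F j = F' j) →
      levelScan p n r A F o J = levelScan p n r A' F' o J
  | 0, _, _ => rfl
  | J + 1, hA, hF => by
    rw [levelScan, levelScan, levelScan_congr J (fun j hj => hA j (by omega))
      (fun j hj => hF j (by omega)), hA J (by omega), hF J (by omega)]

/-- An index once found is kept by all later tests. So the scan with a shared output register
amounts to running every copy from scratch and taking the first nonzero answer. -/
theorem copyScan_eq_outOf {p m J U n : ℕ} (x : Fin n → ℤ) :
    ∀ c, copyScan p n m J U (fun s => levelSum p m (slotSeed p m J U s) x (s % J))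
      (fun s => levelPrint p m (slotSeed p m J U s) x (s % J)) c = outOf p m J U x c
  | 0 => rfl
  | c + 1 => by
    rw [copyScan, outOf, copyScan_eq_outOf x c]
    have hs : ∀ j < J, slotSeed p m J U (J * c + j) = U / p ^ ((m + 1) * c) ∧
        (J * c + j) % J = j := fun j hj => by
      rw [slotSeed, Nat.mul_add_div (by omega), Nat.div_eq_of_lt hj, Nat.mul_add_mod,
        Nat.mod_eq_of_lt hj, add_zero]
      exact ⟨rfl, rfl⟩
    split_ifs with h
    · rw [h]
      exact levelScan_congr J (fun j hj => by rw [(hs j hj).1, (hs j hj).2])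
        (fun j hj => by rw [(hs j hj).1, (hs j hj).2])
    · exact levelScan_of_ne_zero h J

theorem pack_eq_sum (p : ℕ) (A F : ℕ → ℤ) : ∀ k s, pack p A F k s =
    ∑ t ∈ Finset.range k, (A (s + t) + p ^ 3 * F (s + t)) * (p : ℤ) ^ (6 * t)
  | 0, s => rfl
  | k + 1, s => by
    have h : ∀ t, (A (s + (t + 1)) + p ^ 3 * F (s + (t + 1))) * (p : ℤ) ^ (6 * (t + 1)) =
        p ^ 6 * ((A (s + 1 + t) + p ^ 3 * F (s + 1 + t)) * (p : ℤ) ^ (6 * t)) := fun t => by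
      rw [show s + (t + 1) = s + 1 + t by ring]
      ring
    rw [pack, pack_eq_sum p A F k (s + 1), Finset.sum_range_succ', Finset.sum_congr rfl fun t _ => h t,
      ← Finset.mul_sum, add_zero, mul_zero, pow_zero]
    ring

/-- Interchange of the sums over slots and over indices. The right side is what updates maintain;
the left side is what the final scan decodes. The identity holds between integers, so carries and
signs during the stream are irrelevant. -/
theorem pack_eq_sum_column {p m J U n S : ℕ} (x : Fin n → ℤ) :
    pack p (fun s => levelSum p m (slotSeed p m J U s) x (s % J))
      (fun s => levelPrint p m (slotSeed p m J U s) x (s % J)) S 0 =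
    ∑ i : Fin n, x i * column p m J U (i + 1) S := by
  rw [pack_eq_sum]
  simp only [zero_add, levelSum, levelPrint, column, Finset.mul_sum, Nat.cast_sum,
    ← Finset.sum_add_distrib, Finset.sum_mul]
  rw [Finset.sum_comm]
  refine Finset.sum_congr rfl fun i _ => Finset.sum_congr rfl fun s _ => ?_
  rw [coef]
  split_ifs
  · push_cast; ring
  · simp

theorem coef_lt {p m V x j : ℕ} (hp : 2 ≤ p) : coef p m V x j < p ^ 6 := by
  have hp3 : p ≤ p ^ 3 := Nat.le_self_pow (by norm_num) p
  rw [coef]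
  split_ifs
  · have h0 : (V % p) ^ x % p < p := Nat.mod_lt _ (by omega)
    have h1 : p ^ 3 * ((V % p) ^ x % p + 1) ≤ p ^ 3 * p ^ 3 := Nat.mul_le_mul_left _ (by omega)
    have h2 : p ^ 6 = p ^ 3 * p ^ 3 := by ring
    rw [h2]; linarith
  · positivity

theorem column_lt {p m J U x : ℕ} (hp : 2 ≤ p) : ∀ S, column p m J U x S < p ^ (6 * S)
  | 0 => by simp [column]
  | S + 1 => by
    have ih := column_lt (m := m) (J := J) (U := U) (x := x) hp S
    have h := coef_lt (m := m) (V := slotSeed p m J U S) (x := x) (j := S % J) hp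
    rw [column, Finset.sum_range_succ]
    rw [column] at ih
    have h2 := Nat.mul_le_mul_right (p ^ (6 * S)) (Nat.succ_le_of_lt h)
    have e : p ^ (6 * (S + 1)) = p ^ 6 * p ^ (6 * S) := by ring
    rw [Nat.succ_eq_add_one] at h2
    rw [e]
    linarith

theorem abs_levelSum_le {p m V n M : ℕ} {x : Fin n → ℤ} (hx : ∀ i, |x i| ≤ M) (j : ℕ) :
    |levelSum p m V x j| ≤ n * M := by
  refine (Finset.abs_sum_le_sum_abs _ _).trans ?_
  refine (Finset.sum_le_sum (g := fun _ => (M : ℤ)) fun i _ => ?_).trans (by simp)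
  split_ifs
  · exact hx i
  · simp

/-- Since the powers of the root are reduced modulo `p`, the condition `n * M ≤ p` places
fingerprints below `p ^ 2`, the range in which signed digits can be decoded. -/
theorem abs_levelPrint_le {p m V n M : ℕ} (hp : 2 ≤ p) {x : Fin n → ℤ} (hx : ∀ i, |x i| ≤ M)
    (j : ℕ) : |levelPrint p m V x j| ≤ n * (M * (p - 1)) := by
  have hp' : (2 : ℤ) ≤ p := by exact_mod_cast hp
  refine (Finset.abs_sum_le_sum_abs _ _).trans ?_
  refine (Finset.sum_le_sum (g := fun _ => (M * (p - 1) : ℤ)) fun i _ => ?_).trans (by simp)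
  split_ifs
  · rw [abs_mul, Nat.abs_cast]
    have h : (V % p) ^ ((i : ℕ) + 1) % p < p := Nat.mod_lt _ (by omega)
    refine mul_le_mul (hx i) (by omega) (by positivity) (by positivity)
  · rw [abs_zero]
    exact mul_nonneg (by positivity) (by omega)

theorem streamVec_append {n : ℕ} (L : List (Fin n × ℤ)) (i : Fin n) (u : ℤ) :
    streamVec (L ++ [(i, u)]) = streamVec L + Pi.single i u := by
  simp [streamVec]

/-- What holds between two updates. -/
structure Inv (b n d p m J D U : ℕ) (x : Fin n → ℤ) (σ : Store 21) : Prop where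
  bdd : σ.Bdd b
  r0 : σ 0 = n
  r1 : σ 1 = d
  r4 : σ 4 = 0
  r5 : σ 5 = n.size
  r6 : σ 6 = p
  r7 : σ 7 = U
  r8 : σ 8 = ∑ i : Fin n, x i * column p m J U (i + 1) (J * D)

theorem eval_digitsExpr {κ n : ℕ} {σ : Store 21} (h5 : σ 5 = n.size) :
    (digitsExpr κ).eval σ = ((κ * n.size + 2 : ℕ) : ℤ) := by
  simp [digitsExpr, h5]

theorem eval_levelsExpr {n : ℕ} {σ : Store 21} (h5 : σ 5 = n.size) :
    levelsExpr.eval σ = ((n.size + 3 : ℕ) : ℤ) := by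
  simp [levelsExpr, h5]

theorem eval_copiesExpr {d : ℕ} {σ : Store 21} (h1 : σ 1 = d) :
    copiesExpr.eval σ = ((12 * d : ℕ) : ℤ) := by
  simp [copiesExpr, h1]

/-- Number of coins flipped. -/
def coins (κ e γ n d : ℕ) : ℕ :=
  12 * d * (κ * n.size + 2 + 1) * (e * n.size + 1) + d + γ * n.size

theorem eval_coinsExpr {κ e γ n d : ℕ} {σ : Store 21} (h1 : σ 1 = d) (h5 : σ 5 = n.size) :
    (coinsExpr κ e γ).eval σ = coins κ e γ n d := by
  simp [coinsExpr, eval_copiesExpr h1, eval_digitsExpr h5, h1, h5, coins]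

theorem update_step {κ e γ b n d p U M : ℕ} {x : Fin n → ℤ} {σ : Store 21} {i : Fin n} {u : ℤ}
    {w : List Bool} (hb : 1 ≤ b)
    (hF : Fits b n p (κ * n.size + 2) (n.size + 3) (12 * d) U)
    (hI : Inv b n d p (κ * n.size + 2) (n.size + 3) (12 * d) U x σ)
    (hx : ∀ j, |x j| ≤ M) (hx' : ∀ j, |(x + Pi.single i u : Fin n → ℤ) j| ≤ M) (hMb : 2 * M ≤ 2 ^ b)
    (hZ : n * (M * p ^ (6 * ((n.size + 3) * (12 * d)))) ≤ 2 ^ b) {S : ℕ}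
    (hS : (sampler κ e γ).update.cst * (b + 1) ≤ S) :
    ∃ σ', Cmd.RunsIn S (sampler κ e γ).update ((sampler κ e γ).receive σ i u) w σ' w ∧
      Inv b n d p (κ * n.size + 2) (n.size + 3) (12 * d) U (x + Pi.single i u) σ' := by
  set m := κ * n.size + 2
  set J := n.size + 3
  set D := 12 * d
  have hp := hF.two_le
  have hpb : p ≤ 2 ^ b := le_trans (Nat.le_mul_of_pos_right _ (by positivity)) hF.level_le
  -- Admissibility bounds coordinates, not updates; but an update is the difference of two
  -- successive values of a coordinate, hence at most `2 * M`.
  have hu : |u| ≤ 2 ^ b := by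
    have h1 : u = (x + Pi.single i u : Fin n → ℤ) i - x i := by simp
    have h2 : |u| ≤ |(x + Pi.single i u : Fin n → ℤ) i| + |x i| := by
      have := abs_sub ((x + Pi.single i u : Fin n → ℤ) i) (x i)
      rwa [← h1] at this
    have h3 := hx i
    have h4 := hx' i
    have h5 : (2 * M : ℤ) ≤ 2 ^ b := by exact_mod_cast hMb
    linarith
  set σ₀ : Store 21 := Function.update (Function.update σ 2 ((i : ℤ) + 1)) 3 u with hσ₀
  have hb₀ : σ₀.Bdd b := by
    refine Store.Bdd.update (hI.bdd.update _ ?_) _ hu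
    have h1 : (i : ℕ) + 1 ≤ 2 ^ b := by
      have := i.2
      have := hF.lt_p
      omega
    have h2 : ((i : ℤ) + 1) = ((i + 1 : ℕ) : ℤ) := by push_cast; rfl
    rw [h2, Nat.abs_cast]
    exact_mod_cast h1
  have hsum : σ 8 + u * column p m J U (i + 1) (J * D) =
      ∑ j : Fin n, (x + Pi.single i u : Fin n → ℤ) j * column p m J U (j + 1) (J * D) := by
    rw [hI.r8]
    simp only [Pi.add_apply, add_mul, Finset.sum_add_distrib]
    congr 1
    rw [Finset.sum_eq_single i (fun j _ hj => by simp [Pi.single_eq_of_ne hj]) (by simp)]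
    simp
  have hbound : |∑ j : Fin n, (x + Pi.single i u : Fin n → ℤ) j * column p m J U (j + 1) (J * D)| ≤
      2 ^ b := by
    refine (Finset.abs_sum_le_sum_abs _ _).trans ?_
    refine (Finset.sum_le_sum (g := fun _ => ((M * p ^ (6 * (J * D)) : ℕ) : ℤ))
      fun j _ => ?_).trans ?_
    · rw [abs_mul, Nat.abs_cast]
      push_cast
      refine mul_le_mul (hx' j) ?_ (by positivity) (by positivity)
      exact_mod_cast (column_lt hp _).le
    · simp only [Finset.sum_const, Finset.card_univ, Fintype.card_fin, nsmul_eq_mul]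
      exact_mod_cast hZ
  have low : ∀ s : Fin 21, s ≠ 2 → s ≠ 3 → σ₀ s = σ s := fun s h2 h3 => by
    rw [hσ₀, Function.update_of_ne h3, Function.update_of_ne h2]
  have h5 : σ₀ 5 = n.size := (low 5 (by decide) (by decide)).trans hI.r5
  have h1 : σ₀ 1 = d := (low 1 (by decide) (by decide)).trans hI.r1
  have h8 : σ₀ 8 = σ 8 := low 8 (by decide) (by decide)
  obtain ⟨σ', w', hex, rfl, hb', hlow, g8⟩ := updateCmd_wp (w := w) (x := i + 1) (σ := σ₀)
    (em := digitsExpr κ) (eJ := levelsExpr) (eD := copiesExpr) hF hb₀ (by omega) (by omega)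
    (fun σ' h => eval_digitsExpr ((h 5 (by decide)).trans h5))
    (fun σ' h => eval_levelsExpr ((h 5 (by decide)).trans h5))
    (fun σ' h => eval_copiesExpr ((h 1 (by decide)).trans h1))
    (by simp [hσ₀]) ((low 6 (by decide) (by decide)).trans hI.r6)
    ((low 7 (by decide) (by decide)).trans hI.r7) (by
      rw [h8]
      have h3 : σ₀ 3 = u := by simp [hσ₀]
      rw [h3, hsum]
      exact hbound)
  have h3 : σ₀ 3 = u := by simp [hσ₀]
  refine ⟨σ', (hex.runsIn hb b le_rfl hb₀).2 S hS, hb', ?_, ?_, ?_, ?_, ?_, ?_, ?_⟩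
  · rw [hlow 0 (by decide), low 0 (by decide) (by decide), hI.r0]
  · rw [hlow 1 (by decide), low 1 (by decide) (by decide), hI.r1]
  · rw [hlow 4 (by decide), low 4 (by decide) (by decide), hI.r4]
  · rw [hlow 5 (by decide), low 5 (by decide) (by decide), hI.r5]
  · rw [hlow 6 (by decide), low 6 (by decide) (by decide), hI.r6]
  · rw [hlow 7 (by decide), low 7 (by decide) (by decide), hI.r7]
  · rw [g8, h8, h3, hsum]

/-- Induction over the unread part of the stream. The part `L₀` already read is carried along
because admissibility concerns all prefixes of the entire stream. -/
theorem processesIn {κ e γ b n d p U M : ℕ} {w : List Bool} (hb : 1 ≤ b)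
    (hF : Fits b n p (κ * n.size + 2) (n.size + 3) (12 * d) U) (hMb : 2 * M ≤ 2 ^ b)
    (hZ : n * (M * p ^ (6 * ((n.size + 3) * (12 * d)))) ≤ 2 ^ b) {S : ℕ}
    (hS : (sampler κ e γ).update.cst * (b + 1) ≤ S) :
    ∀ (L L₀ : List (Fin n × ℤ)) (σ : Store 21), BoundedThroughout M (L₀ ++ L) →
      Inv b n d p (κ * n.size + 2) (n.size + 3) (12 * d) U (streamVec L₀) σ →
      ∃ σ', (sampler κ e γ).ProcessesIn S L σ w σ' w ∧
        Inv b n d p (κ * n.size + 2) (n.size + 3) (12 * d) U (streamVec (L₀ ++ L)) σ'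
  | [], L₀, σ, _, hI => ⟨σ, ⟨rfl, rfl⟩, by simpa using hI⟩
  | (i, u) :: L, L₀, σ, hL, hI => by
    have e1 : L₀ ++ (i, u) :: L = (L₀ ++ [(i, u)]) ++ L := by simp
    have hx : ∀ j, |streamVec L₀ j| ≤ M := hL L₀ (List.prefix_append _ _)
    have hx' : ∀ j, |(streamVec L₀ + Pi.single i u : Fin n → ℤ) j| ≤ M := by
      rw [← streamVec_append]
      exact hL _ (by rw [e1]; exact List.prefix_append _ _)
    obtain ⟨σ₁, h1, h2⟩ := update_step (e := e) (γ := γ) (w := w) hb hF hI hx hx' hMb hZ hS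
    rw [← streamVec_append] at h2
    rw [e1] at hL ⊢
    obtain ⟨σ₂, h3, h4⟩ := processesIn hb hF hMb hZ hS L (L₀ ++ [(i, u)]) σ₁ hL h2
    exact ⟨σ₂, ⟨σ₁, w, h1, h3⟩, h4⟩

/-- The algorithm halts with the output given by `outOf`, within `S` bits. -/
theorem sampler_runsIn {κ e γ b n d M : ℕ} {w : List Bool} (hb : 1 ≤ b) (hn : 2 ≤ n)
    (he : 1 ≤ e)
    (hF : ∀ U < 2 ^ coins κ e γ n d,
      Fits b n (leastPrime (n ^ e)) (κ * n.size + 2) (n.size + 3) (12 * d) U)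
    (hnM : n * M ≤ leastPrime (n ^ e))
    (hL : n.size ≤ 2 ^ b) (hd : d ≤ 2 ^ b) (hMb : 2 * M ≤ 2 ^ b)
    (hZ : n * (M * leastPrime (n ^ e) ^ (6 * ((n.size + 3) * (12 * d)))) ≤ 2 ^ b)
    (hW : coins κ e γ n d ≤ b) {S : ℕ}
    (hS : ((sampler κ e γ).init.cst + (sampler κ e γ).update.cst +
      (sampler κ e γ).output.cst) * (b + 1) ≤ S)
    (hw : coins κ e γ n d ≤ w.length) (L : List (Fin n × ℤ)) (hLM : BoundedThroughout M L) :
    (sampler κ e γ).RunsIn S n d L w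
      (outOf (leastPrime (n ^ e)) (κ * n.size + 2) (n.size + 3)
        (ofBits (w.take (coins κ e γ n d))) (streamVec L) (12 * d)) := by
  set p := leastPrime (n ^ e) with hp_def
  set W := coins κ e γ n d with hW_def
  set U := ofBits (w.take W) with hU_def
  simp only [add_mul] at hS
  have hU : U < 2 ^ W := (ofBits_lt _).trans_le (Nat.pow_le_pow_right (by norm_num) (by simp))
  have hF := hF U hU
  have hp := hF.two_le
  have hpb : p ≤ 2 ^ b := le_trans (Nat.le_mul_of_pos_right _ (by positivity)) hF.level_le
  have hnb : n ≤ 2 ^ b := hF.lt_p.le.trans hpb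
  set σ₀ : Store 21 := Function.update (Function.update (fun _ => 0) 0 (n : ℤ)) 1 (d : ℤ) with hσ₀
  have hb₀ : σ₀.Bdd b := by
    refine Store.Bdd.update (Store.Bdd.update (fun _ => by simp) _ ?_) _ ?_ <;>
      · rw [Nat.abs_cast]; assumption_mod_cast
  obtain ⟨σ₁, w₁, hex₁, rfl, hb₁, hlow₁, g8, g5, g6, g7⟩ := initCmd_wp (w := w) (n := n) (d := d)
    (e := e) (W := W) (eW := coinsExpr κ e γ) hb₀ hn he (by simp [hσ₀]) (by simp [hσ₀])
    (by simp [hσ₀]) (by simp [hσ₀]) (fun σ' _ h1 h5 => eval_coinsExpr h1 h5) hL hpb hw hW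
  have hI : Inv b n d p (κ * n.size + 2) (n.size + 3) (12 * d) U
      (streamVec ([] : List (Fin n × ℤ))) σ₁ :=
    ⟨hb₁, by rw [hlow₁ 0 (by decide)]; simp [hσ₀], by rw [hlow₁ 1 (by decide)]; simp [hσ₀],
      by rw [hlow₁ 4 (by decide)]; simp [hσ₀], g5, g6, g7,
      by rw [g8]; simp [hσ₀, streamVec]⟩
  obtain ⟨σ₂, h2, hI₂⟩ := processesIn (e := e) (γ := γ) (w := w.drop W) hb hF hMb hZ
    (S := S) (by omega) L [] σ₁ hLM hI
  rw [List.nil_append] at hI₂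
  have hx : ∀ j, |streamVec L j| ≤ M := hLM L List.prefix_rfl
  have hnM' : (n : ℤ) * M ≤ p := by exact_mod_cast hnM
  have hp' : (2 : ℤ) ≤ p := by exact_mod_cast hp
  have hsq : (p : ℤ) * (p - 1) < p ^ 2 := by nlinarith
  obtain ⟨σ₃, w₃, hex₃, rfl, hb₃, g4⟩ := outputCmd_wp (w := w.drop W) (σ := σ₂)
    (A := fun s => levelSum p (κ * n.size + 2) (slotSeed p (κ * n.size + 2) (n.size + 3) U s)
      (streamVec L) (s % (n.size + 3)))
    (F := fun s => levelPrint p (κ * n.size + 2) (slotSeed p (κ * n.size + 2) (n.size + 3) U s)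
      (streamVec L) (s % (n.size + 3)))
    (em := digitsExpr κ) (eJ := levelsExpr) (eD := copiesExpr) hF hI₂.bdd
    (fun s => (abs_levelSum_le hx _).trans_lt (by nlinarith))
    (fun s => (abs_levelPrint_le hp hx _).trans_lt (by
      rw [← mul_assoc]
      exact (mul_le_mul_of_nonneg_right hnM' (by omega)).trans_lt hsq))
    (fun σ' _ h => eval_digitsExpr (h.trans hI₂.r5))
    (fun σ' _ h => eval_levelsExpr (h.trans hI₂.r5))
    (fun σ' h _ => eval_copiesExpr (h.trans hI₂.r1))
    hI₂.r0 hI₂.r6 hI₂.r4 hI₂.r7 (by rw [hI₂.r8, pack_eq_sum_column])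
  refine ⟨σ₁, w.drop W, σ₂, w.drop W, σ₃, w.drop W, (hex₁.runsIn hb b le_rfl hb₀).2 S ?_, h2,
    (hex₃.runsIn hb b le_rfl hI₂.bdd).2 S ?_, ?_⟩
  · exact le_trans (by simp only [sampler]; omega) hS
  · exact le_trans (by simp only [sampler]; omega) hS
  · exact g4.trans (by rw [copyScan_eq_outOf])

/-! ## Limited independence of polynomial hash functions -/

/-- The value at `x` of the polynomial modulo `p` whose coefficients are the digits of `t`. -/
def polyHash (p m t x : ℕ) : ℕ := (∑ l ∈ Finset.range m, t / p ^ l % p * x ^ l) % p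

theorem hashv_eq_polyHash (p m V x : ℕ) : hashv p m V x = polyHash p m (V / p) x := by
  simp only [hashv, polyHash, pow_succ', ← Nat.div_div_eq_div_mul]

theorem polyHash_lt {p : ℕ} (hp : 0 < p) (m t x : ℕ) : polyHash p m t x < p := Nat.mod_lt _ hp

/-- Values of the polynomial with coefficients `t` at the points `v`. -/
theorem vandermonde_mulVec_bijective {p m : ℕ} [Fact p.Prime] {v : Fin m → ZMod p}
    (hv : Function.Injective v) :
    Function.Bijective (fun f : Fin m → ZMod p => (Matrix.vandermonde v).mulVec f) := by
  rw [← Finite.injective_iff_bijective]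
  refine Matrix.mulVec_injective_iff_isUnit.2 ?_
  rw [Matrix.isUnit_iff_isUnit_det]
  exact (Matrix.det_vandermonde_ne_zero_iff.2 hv).isUnit

theorem digits_bijective (p m : ℕ) [NeZero p] : Function.Bijective
    (fun (t : Fin (p ^ m)) (l : Fin m) => (((t : ℕ) / p ^ (l : ℕ) % p : ℕ) : ZMod p)) := by
  have h1 : Function.Bijective (fun f : Fin m → Fin p => fun l => ((f l : ℕ) : ZMod p)) := by
    rw [Fintype.bijective_iff_injective_and_card]
    refine ⟨fun f g h => funext fun l => ?_, by simp [ZMod.card]⟩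
    have h2 := congrFun h l
    rw [ZMod.natCast_eq_natCast_iff', Nat.mod_eq_of_lt (f l).2, Nat.mod_eq_of_lt (g l).2] at h2
    exact Fin.ext h2
  exact h1.comp finFunctionFinEquiv.symm.bijective

theorem sum_range_eq_sum_zmod {p : ℕ} [NeZero p] (φ : ℕ → ℝ) :
    ∑ v ∈ Finset.range p, φ v = ∑ y : ZMod p, φ y.val := by
  obtain ⟨k, rfl⟩ := Nat.exists_eq_succ_of_ne_zero (NeZero.ne p)
  exact (Fin.sum_univ_eq_sum_range φ (k + 1)).symm

theorem val_polyHash {p m t x : ℕ} [Fact p.Prime] :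
    (∑ l : Fin m, (x : ZMod p) ^ (l : ℕ) * ((t / p ^ (l : ℕ) % p : ℕ) : ZMod p)).val =
      polyHash p m t x := by
  have : ∑ l : Fin m, (x : ZMod p) ^ (l : ℕ) * ((t / p ^ (l : ℕ) % p : ℕ) : ZMod p) =
      ((∑ l ∈ Finset.range m, t / p ^ l % p * x ^ l : ℕ) : ZMod p) := by
    rw [Finset.sum_range]
    push_cast
    exact Finset.sum_congr rfl fun l _ => mul_comm _ _
  rw [this, ZMod.val_natCast, polyHash]

/-- The values at at most `m` points are independent and uniform. -/
theorem sum_prod_polyHash {p m : ℕ} (hp : p.Prime) (hm : m ≤ p) {S : Finset ℕ}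
    (hS : S ⊆ Finset.range p) (hc : S.card ≤ m) (φ : ℕ → ℕ → ℝ) :
    ∑ t ∈ Finset.range (p ^ m), ∏ x ∈ S, φ x (polyHash p m t x) =
      (p : ℝ) ^ m * ∏ x ∈ S, ((∑ v ∈ Finset.range p, φ x v) / p) := by
  have : Fact p.Prime := ⟨hp⟩
  have : NeZero p := ⟨hp.ne_zero⟩
  have hp0 : (p : ℝ) ≠ 0 := by exact_mod_cast hp.ne_zero
  -- With exactly `m` points the Vandermonde matrix is square. The added points receive the constant
  -- factor `1`, whose average is `1`.
  obtain ⟨X, hSX, hXp, hXm⟩ := Finset.exists_subsuperset_card_eq hS hc (by simpa using hm)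
  set ψ : ℕ → ℕ → ℝ := fun x v => if x ∈ S then φ x v else 1 with hψ
  set e := X.orderIsoOfFin hXm with he
  have hprod : ∀ g : ℕ → ℝ, ∏ k : Fin m, g (e k) = ∏ x ∈ X, g x := fun g => by
    rw [← Finset.prod_coe_sort X]
    exact Fintype.prod_equiv e.toEquiv _ _ fun _ => rfl
  have hv : Function.Injective (fun k : Fin m => (((e k : X) : ℕ) : ZMod p)) := by
    intro k l h
    have hk := Finset.mem_range.1 (hXp (e k).2)
    have hl := Finset.mem_range.1 (hXp (e l).2)
    simp only [ZMod.natCast_eq_natCast_iff', Nat.mod_eq_of_lt hk, Nat.mod_eq_of_lt hl] at h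
    exact e.injective (Subtype.ext h)
  have h1 : ∀ t, ∏ x ∈ S, φ x (polyHash p m t x) =
      ∏ k : Fin m, ψ (e k) (polyHash p m t (e k)) := fun t => by
    rw [hprod (fun x => ψ x (polyHash p m t x)), ← Finset.prod_subset hSX]
    · exact Finset.prod_congr rfl fun x hx => by rw [hψ]; simp [hx]
    · intro x _ hx
      rw [hψ]; simp [hx]
  have h2 : ∏ x ∈ S, ((∑ v ∈ Finset.range p, φ x v) / p) =
      ∏ k : Fin m, ((∑ v ∈ Finset.range p, ψ (e k) v) / p) := by
    rw [hprod (fun x => (∑ v ∈ Finset.range p, ψ x v) / p), ← Finset.prod_subset hSX]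
    · exact Finset.prod_congr rfl fun x hx => by rw [hψ]; simp [hx]
    · intro x _ hx
      rw [hψ]; simp [hx, hp0]
  rw [h2, Finset.prod_div_distrib, Finset.prod_const, Finset.card_univ, Fintype.card_fin,
    mul_div_cancel₀ _ (pow_ne_zero _ hp0)]
  simp only [h1]
  rw [Finset.sum_range (fun t => ∏ k : Fin m, ψ (e k) (polyHash p m t (e k)))]
  -- Seeds correspond bijectively to vectors of values at the `m` points, so the sum over the seeds
  -- factors over the points.
  have hbij := (vandermonde_mulVec_bijective hv).comp (digits_bijective p m)
  calc ∑ t : Fin (p ^ m), ∏ k : Fin m, ψ (e k) (polyHash p m t (e k))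
      = ∑ y : Fin m → ZMod p, ∏ k : Fin m, ψ (e k) (y k).val := by
        refine Fintype.sum_bijective _ hbij _ _ fun t => Finset.prod_congr rfl fun k _ => ?_
        congr 1
        rw [← val_polyHash]
        simp [Matrix.mulVec, dotProduct, Matrix.vandermonde_apply]
    _ = ∏ k : Fin m, ∑ y : ZMod p, ψ (e k) y.val := by
        rw [Finset.prod_univ_sum, Fintype.piFinset_univ]
    _ = _ := by simp only [sum_range_eq_sum_zmod]

/-- Average over all hash functions. -/
noncomputable def avg (p m : ℕ) (g : ℕ → ℝ) : ℝ :=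
  (∑ t ∈ Finset.range (p ^ m), g t) / (p : ℝ) ^ m

theorem avg_prod_polyHash {p m : ℕ} (hp : p.Prime) (hm : m ≤ p) {S : Finset ℕ}
    (hS : S ⊆ Finset.range p) (hc : S.card ≤ m) (φ : ℕ → ℕ → ℝ) :
    avg p m (fun t => ∏ x ∈ S, φ x (polyHash p m t x)) =
      ∏ x ∈ S, ((∑ v ∈ Finset.range p, φ x v) / p) := by
  have hp0 : (p : ℝ) ^ m ≠ 0 := pow_ne_zero _ (by exact_mod_cast hp.ne_zero)
  rw [avg, sum_prod_polyHash hp hm hS hc, mul_div_cancel_left₀ _ hp0]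

theorem avg_mono {p m : ℕ} {f g : ℕ → ℝ} (h : ∀ t, f t ≤ g t) : avg p m f ≤ avg p m g :=
  div_le_div_of_nonneg_right (Finset.sum_le_sum fun t _ => h t) (by positivity)

theorem avg_nonneg {p m : ℕ} {f : ℕ → ℝ} (h : ∀ t, 0 ≤ f t) : 0 ≤ avg p m f :=
  div_nonneg (Finset.sum_nonneg fun t _ => h t) (by positivity)

theorem avg_sum {p m : ℕ} {ι : Type*} (s : Finset ι) (f : ι → ℕ → ℝ) :
    avg p m (fun t => ∑ i ∈ s, f i t) = ∑ i ∈ s, avg p m (f i) := by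
  simp only [avg, ← Finset.sum_div]
  rw [Finset.sum_comm]

theorem avg_mul_left {p m : ℕ} (c : ℝ) (f : ℕ → ℝ) :
    avg p m (fun t => c * f t) = c * avg p m f := by
  simp only [avg, ← Finset.mul_sum, mul_div_assoc]

theorem avg_sub {p m : ℕ} (f g : ℕ → ℝ) :
    avg p m (fun t => f t - g t) = avg p m f - avg p m g := by
  simp only [avg, Finset.sum_sub_distrib, sub_div]

theorem abs_avg_le {p m : ℕ} {f g : ℕ → ℝ} (h : ∀ t, |f t| ≤ g t) :
    |avg p m f| ≤ avg p m g := by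
  rw [avg, abs_div, abs_of_nonneg (by positivity : (0 : ℝ) ≤ (p : ℝ) ^ m)]
  exact div_le_div_of_nonneg_right ((Finset.abs_sum_le_sum_abs _ _).trans
    (Finset.sum_le_sum fun t _ => h t)) (by positivity)

/-! ## Truncated inclusion-exclusion -/

/-- The first `M` terms of the binomial expansion of `(1 - q) ^ N`. -/
def truncBinom (M N : ℕ) (q : ℝ) : ℝ :=
  ∑ r ∈ Finset.range M, (-1) ^ r * (N.choose r * q ^ r)

theorem truncBinom_succ_succ (M N : ℕ) (q : ℝ) :
    truncBinom (M + 1) (N + 1) q = truncBinom (M + 1) N q - q * truncBinom M N q := by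
  have h1 : ∀ N : ℕ, truncBinom (M + 1) N q =
      ∑ r ∈ Finset.range M, (-1) ^ (r + 1) * (N.choose (r + 1) * q ^ (r + 1)) + 1 := fun N => by
    rw [truncBinom, Finset.sum_range_succ']; simp
  rw [h1, h1, truncBinom, Finset.mul_sum, add_sub_right_comm, ← Finset.sum_sub_distrib]
  congr 1
  refine Finset.sum_congr rfl fun r _ => ?_
  rw [Nat.choose_succ_succ]
  push_cast
  ring

/-- Bonferroni inequalities. By Pascal's rule the signed error at `(N + 1, M + 1)` is the one at
`(N, M + 1)` plus `q` times the one at `(N, M)`, and both bounds propagate. For `q = 1` they concern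
the indicator of `N = 0`. -/
theorem truncBinom_bounds {q : ℝ} (h0 : 0 ≤ q) (h1 : q ≤ 1) : ∀ N M : ℕ,
    0 ≤ (-1) ^ M * ((1 - q) ^ N - truncBinom M N q) ∧
      (-1) ^ M * ((1 - q) ^ N - truncBinom M N q) ≤ N.choose M * q ^ M
  | N, 0 => by
    have : (1 - q) ^ N ≤ 1 := pow_le_one₀ (by linarith) (by linarith)
    have : 0 ≤ (1 - q) ^ N := pow_nonneg (by linarith) _
    simp [truncBinom, *]
  | 0, M + 1 => by
    have : truncBinom (M + 1) 0 q = 1 := by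
      rw [truncBinom, Finset.sum_range_succ']
      simp
    simp [this]
  | N + 1, M + 1 => by
    obtain ⟨a1, a2⟩ := truncBinom_bounds h0 h1 N (M + 1)
    obtain ⟨b1, b2⟩ := truncBinom_bounds h0 h1 N M
    have e : (-1 : ℝ) ^ (M + 1) * ((1 - q) ^ (N + 1) - truncBinom (M + 1) (N + 1) q) =
        (-1) ^ (M + 1) * ((1 - q) ^ N - truncBinom (M + 1) N q) +
          q * ((-1) ^ M * ((1 - q) ^ N - truncBinom M N q)) := by
      rw [truncBinom_succ_succ]
      ring
    rw [e]
    constructor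
    · positivity
    · rw [Nat.choose_succ_succ]
      push_cast
      calc _ ≤ (N.choose (M + 1) : ℝ) * q ^ (M + 1) + q * (N.choose M * q ^ M) :=
            add_le_add a2 (mul_le_mul_of_nonneg_left b2 h0)
        _ = _ := by ring

theorem abs_sub_truncBinom_le {q : ℝ} (h0 : 0 ≤ q) (h1 : q ≤ 1) (N M : ℕ) :
    |(1 - q) ^ N - truncBinom M N q| ≤ N.choose M * q ^ M := by
  obtain ⟨a, b⟩ := truncBinom_bounds h0 h1 N M
  have : |(1 - q) ^ N - truncBinom M N q| =
      |(-1) ^ M * ((1 - q) ^ N - truncBinom M N q)| := by simp [abs_mul]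
  rw [this, abs_of_nonneg a]
  exact b

/-- The left side is at most `β ^ (4 * β) / (4 * β)!`. Extracting `4 ^ (4 * β) = 256 ^ β` leaves a
term of the series of `exp (4 * β)`, which is at most `81 ^ β` as `e < 3`; and `81 / 256 ≤ 1 / 2`.
This is why the truncation is at order `4 * β`. -/
theorem choose_mul_pow_le {N β : ℕ} {q : ℝ} (h0 : 0 ≤ q) (h : N * q ≤ β) :
    (N.choose (4 * β) : ℝ) * q ^ (4 * β) ≤ (1 / 2) ^ β := by
  have h1 : (N.choose (4 * β) : ℝ) * q ^ (4 * β) ≤ (β : ℝ) ^ (4 * β) / (4 * β).factorial := by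
    calc (N.choose (4 * β) : ℝ) * q ^ (4 * β)
        ≤ (N : ℝ) ^ (4 * β) / (4 * β).factorial * q ^ (4 * β) :=
          mul_le_mul_of_nonneg_right (Nat.choose_le_pow_div _ _) (by positivity)
      _ = (N * q) ^ (4 * β) / (4 * β).factorial := by rw [mul_pow]; ring
      _ ≤ _ := by gcongr
  refine h1.trans ?_
  have h2 := Real.pow_div_factorial_le_exp (4 * β : ℝ) (by positivity) (4 * β)
  have h3 : Real.exp (4 * β : ℝ) ≤ 81 ^ β := by
    have e1 : Real.exp (4 * β : ℝ) = (Real.exp 1 ^ 4) ^ β := by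
      rw [← pow_mul, ← Real.exp_nat_mul]; push_cast; ring_nf
    rw [e1]
    have e2 : Real.exp 1 ^ 4 ≤ 3 ^ 4 :=
      pow_le_pow_left₀ (Real.exp_pos 1).le (by linarith [Real.exp_one_lt_d9]) 4
    exact pow_le_pow_left₀ (by positivity) (by linarith) β
  have h4 : (β : ℝ) ^ (4 * β) / (4 * β).factorial =
      (4 * β : ℝ) ^ (4 * β) / (4 * β).factorial / 256 ^ β := by
    rw [mul_pow, show (256 : ℝ) ^ β = 4 ^ (4 * β) by rw [pow_mul]; norm_num]
    field_simp
  rw [h4]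
  calc _ ≤ (81 : ℝ) ^ β / 256 ^ β := by gcongr; exact h2.trans h3
    _ = (81 / 256) ^ β := by rw [div_pow]
    _ ≤ _ := pow_le_pow_left₀ (by norm_num) (by norm_num) β

/-! ## Probability that no other point is sampled -/

/-- Number of points with hash value below `τ`. -/
def below (p m τ : ℕ) (X : Finset ℕ) (t : ℕ) : ℕ := (X.filter (polyHash p m t · < τ)).card

/-- Indicator of the event that the hash value of `i` is `v`. -/
def hits (p m i v t : ℕ) : ℝ := if polyHash p m t i = v then 1 else 0

theorem hits_nonneg (p m i v t : ℕ) : 0 ≤ hits p m i v t := by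
  unfold hits; split_ifs <;> norm_num

/-- A binomial coefficient of the count enumerates the `r`-subsets of sampled points. Every summand
involves `r` points only, and so can be averaged by limited independence. -/
theorem choose_below (p m τ : ℕ) (X : Finset ℕ) (t r : ℕ) :
    ((below p m τ X t).choose r : ℝ) =
      ∑ R ∈ X.powersetCard r, ∏ x ∈ R, if polyHash p m t x < τ then (1 : ℝ) else 0 := by
  have h : (X.filter (polyHash p m t · < τ)).powersetCard r =
      (X.powersetCard r).filter (fun R => ∀ x ∈ R, polyHash p m t x < τ) := by
    ext R
    simp only [Finset.mem_powersetCard, Finset.mem_filter, Finset.subset_iff]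
    constructor
    · rintro ⟨h1, h2⟩
      exact ⟨⟨fun x hx => (h1 hx).1, h2⟩, fun x hx => (h1 hx).2⟩
    · rintro ⟨⟨h1, h2⟩, h3⟩
      exact ⟨fun x hx => ⟨h1 hx, h3 x hx⟩, h2⟩
  rw [below, ← Finset.card_powersetCard, h, Finset.card_filter]
  push_cast
  refine Finset.sum_congr rfl fun R _ => ?_
  rw [Finset.prod_ite_zero]
  simp

section
variable {p m τ i v : ℕ} (hp : p.Prime) (hm : m ≤ p) (hi : i < p) (hv : v < p) (hτ : τ ≤ p)
include hp hm hi hv hτ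

theorem avg_hits_prod {R : Finset ℕ} (hR : R ⊆ Finset.range p) (hiR : i ∉ R)
    (hc : R.card + 1 ≤ m) :
    avg p m (fun t => hits p m i v t *
      ∏ x ∈ R, if polyHash p m t x < τ then (1 : ℝ) else 0) = 1 / p * (τ / p) ^ R.card := by
  set φ : ℕ → ℕ → ℝ := fun x u => if x = i then (if u = v then 1 else 0)
    else if u < τ then 1 else 0 with hφ
  have hS : insert i R ⊆ Finset.range p :=
    Finset.insert_subset (Finset.mem_range.2 hi) hR
  have h := avg_prod_polyHash hp hm hS (by rwa [Finset.card_insert_of_notMem hiR]) φ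
  have hne : ∀ x ∈ R, x ≠ i := fun x hx h => hiR (h ▸ hx)
  simp only [Finset.prod_insert hiR] at h
  have e1 : ∀ t, φ i (polyHash p m t i) * ∏ x ∈ R, φ x (polyHash p m t x) =
      hits p m i v t * ∏ x ∈ R, if polyHash p m t x < τ then (1 : ℝ) else 0 := fun t => by
    congr 1
    · simp [hφ, hits]
    · exact Finset.prod_congr rfl fun x hx => by simp [hφ, hne x hx]
  simp only [e1] at h
  rw [h]
  congr 1
  · simp [hφ, hv]
  · rw [← Finset.prod_const]
    refine Finset.prod_congr rfl fun x hx => ?_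
    congr 1
    simp only [hφ, hne x hx, if_false]
    rw [Finset.sum_boole]
    congr 1
    have : (Finset.range p).filter (· < τ) = Finset.range τ := by
      ext u
      simp only [Finset.mem_filter, Finset.mem_range]
      omega
    rw [this, Finset.card_range]

theorem avg_hits_choose {X : Finset ℕ} (hX : X ⊆ Finset.range p) (hiX : i ∉ X) {r : ℕ}
    (hr : r + 1 ≤ m) :
    avg p m (fun t => hits p m i v t * (below p m τ X t).choose r) =
      1 / p * (X.card.choose r * (τ / p) ^ r) := by
  simp only [choose_below, Finset.mul_sum]
  rw [avg_sum]
  rw [Finset.sum_congr rfl fun R hR => ?_]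
  rotate_left
  · exact fun R => 1 / p * (τ / p) ^ r
  · obtain ⟨h1, h2⟩ := Finset.mem_powersetCard.1 hR
    rw [avg_hits_prod hp hm hi hv hτ (h1.trans hX) (fun h => hiX (h1 h)) (by omega), h2]
  · rw [Finset.sum_const, Finset.card_powersetCard, nsmul_eq_mul]
    ring

/-- Truncated inclusion-exclusion is applied twice: with `q = 1` to the random count, and with `q =
τ / p` to the fully independent probability. Limited independence makes the two truncations agree on
average, and each error is at most the first omitted term, small when at most `β` points are
expected. -/
theorem abs_avg_avoid_sub_le_of_le {β : ℕ} (hβ : 4 * β + 1 ≤ m) {X : Finset ℕ}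
    (hX : X ⊆ Finset.range p) (hiX : i ∉ X) (hN : X.card * (τ / p : ℝ) ≤ β) :
    |avg p m (fun t => hits p m i v t * 0 ^ below p m τ X t) - 1 / p * (1 - τ / p) ^ X.card| ≤
      1 / p * (2 * (1 / 2) ^ β) := by
  have hp0 : (0 : ℝ) < p := by exact_mod_cast hp.pos
  have hq0 : (0 : ℝ) ≤ τ / p := by positivity
  have hq1 : (τ / p : ℝ) ≤ 1 := by
    rw [div_le_one hp0]; exact_mod_cast hτ
  have hT : avg p m (fun t => hits p m i v t * truncBinom (4 * β) (below p m τ X t) 1) =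
      1 / p * truncBinom (4 * β) X.card (τ / p) := by
    simp only [truncBinom, Finset.mul_sum]
    rw [avg_sum]
    refine Finset.sum_congr rfl fun r hr => ?_
    have := avg_hits_choose hp hm hi hv hτ hX hiX (r := r)
      (by have := Finset.mem_range.1 hr; omega)
    simp only [one_pow, mul_one, mul_left_comm _ ((-1 : ℝ) ^ r)]
    rw [avg_mul_left, this]
  have h1 : |avg p m (fun t => hits p m i v t * 0 ^ below p m τ X t) -
      1 / p * truncBinom (4 * β) X.card (τ / p)| ≤
      1 / p * (X.card.choose (4 * β) * (τ / p) ^ (4 * β)) := by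
    rw [← hT, ← avg_sub, ← avg_hits_choose hp hm hi hv hτ hX hiX hβ]
    refine abs_avg_le fun t => ?_
    rw [← mul_sub, abs_mul, abs_of_nonneg (hits_nonneg _ _ _ _ _)]
    refine mul_le_mul_of_nonneg_left ?_ (hits_nonneg _ _ _ _ _)
    have := abs_sub_truncBinom_le zero_le_one le_rfl (below p m τ X t) (4 * β)
    simpa using this
  have h2 : |1 / p * (1 - τ / p : ℝ) ^ X.card - 1 / p * truncBinom (4 * β) X.card (τ / p)| ≤
      1 / p * (X.card.choose (4 * β) * (τ / p) ^ (4 * β)) := by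
    rw [← mul_sub, abs_mul, abs_of_pos (by positivity : (0 : ℝ) < 1 / p)]
    exact mul_le_mul_of_nonneg_left (abs_sub_truncBinom_le hq0 hq1 _ _) (by positivity)
  have h3 : 1 / (p : ℝ) * (X.card.choose (4 * β) * (τ / p) ^ (4 * β)) ≤
      1 / p * (1 / 2) ^ β :=
    mul_le_mul_of_nonneg_left (choose_mul_pow_le hq0 hN) (by positivity)
  rw [abs_le] at h1 h2 ⊢
  constructor <;> linarith [h1.1, h1.2, h2.1, h2.2]

/-- If more than `β` points are expected, both quantities are tiny. Discarding points until the
expectation is between `β - 1` and `β` only raises the probability of avoidance. For the remaining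
points the ideal value is at most `exp (1 - β) ≤ 3 * (1 / 2) ^ β`; with the error `2 * (1 / 2) ^ β`
this gives the constant `5`. -/
theorem abs_avg_avoid_sub_le {β : ℕ} (hβ : 4 * β + 1 ≤ m) {X : Finset ℕ}
    (hX : X ⊆ Finset.range p) (hiX : i ∉ X) :
    |avg p m (fun t => hits p m i v t * 0 ^ below p m τ X t) - 1 / p * (1 - τ / p) ^ X.card| ≤
      1 / p * (5 * (1 / 2) ^ β) := by
  have hp0 : (0 : ℝ) < p := by exact_mod_cast hp.pos
  rcases le_or_gt (X.card * (τ / p : ℝ)) β with h | h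
  · refine (abs_avg_avoid_sub_le_of_le hp hm hi hv hτ hβ hX hiX h).trans ?_
    exact mul_le_mul_of_nonneg_left (by
      have : (0 : ℝ) ≤ (1 / 2) ^ β := by positivity
      linarith) (by positivity)
  set q : ℝ := τ / p with hq
  have hq1 : q ≤ 1 := by
    rw [hq, div_le_one hp0]; exact_mod_cast hτ
  have hq0 : 0 < q := by
    by_contra hcon
    have h1 : (X.card : ℝ) * q ≤ 0 := mul_nonpos_of_nonneg_of_nonpos (by positivity) (not_lt.1 hcon)
    have : (0 : ℝ) ≤ β := by positivity
    linarith
  have hexp : ∀ N : ℕ, (1 - q) ^ N ≤ Real.exp (-(N * q)) := fun N => by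
    have h1 : 1 - q ≤ Real.exp (-q) := by linarith [Real.add_one_le_exp (-q)]
    calc (1 - q) ^ N ≤ Real.exp (-q) ^ N := pow_le_pow_left₀ (by linarith) h1 N
      _ = _ := by rw [← Real.exp_nat_mul]; ring_nf
  have hhalf : Real.exp (-(β : ℝ)) ≤ (1 / 2) ^ β := by
    rw [show -(β : ℝ) = β * (-1) by ring, Real.exp_nat_mul]
    refine pow_le_pow_left₀ (Real.exp_pos _).le ?_ β
    rw [Real.exp_neg, one_div]
    exact inv_anti₀ (by norm_num) (by linarith [Real.exp_one_gt_d9])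
  have hupper : (1 - q) ^ X.card ≤ (1 / 2) ^ β :=
    (hexp _).trans ((Real.exp_le_exp.2 (by linarith)).trans hhalf)
  -- The largest size for which at most `β` points are expected; rounding down costs at most `q ≤
  -- 1`.
  obtain ⟨Y, hYX, hYc⟩ := Finset.exists_subset_card_eq (s := X) (n := ⌊β / q⌋₊) (by
    have h1 : (β / q : ℝ) ≤ X.card := by rw [div_le_iff₀ hq0]; exact h.le
    exact_mod_cast (Nat.floor_le (by positivity)).trans h1)
  have hY1 : Y.card * q ≤ β := by
    rw [hYc, ← le_div_iff₀ hq0]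
    exact Nat.floor_le (by positivity)
  have hY2 : β - 1 ≤ Y.card * q := by
    have h1 : β / q < Y.card + 1 := by rw [hYc]; exact Nat.lt_floor_add_one _
    rw [div_lt_iff₀ hq0] at h1
    linarith
  have hYp : (1 - q) ^ Y.card ≤ 3 * (1 / 2) ^ β := by
    refine (hexp _).trans ((Real.exp_le_exp.2 (by linarith : -(Y.card * q) ≤ 1 + -(β : ℝ))).trans ?_)
    rw [Real.exp_add]
    exact mul_le_mul (by linarith [Real.exp_one_lt_d9]) hhalf (Real.exp_pos _).le (by norm_num)
  have hYa := abs_avg_avoid_sub_le_of_le hp hm hi hv hτ hβ (hYX.trans hX) (fun h => hiX (hYX h)) hY1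
  rw [← hq] at hYa
  have hmono : avg p m (fun t => hits p m i v t * 0 ^ below p m τ X t) ≤
      avg p m (fun t => hits p m i v t * 0 ^ below p m τ Y t) := by
    refine avg_mono fun t => mul_le_mul_of_nonneg_left ?_ (hits_nonneg _ _ _ _ _)
    have : below p m τ Y t ≤ below p m τ X t :=
      Finset.card_le_card (Finset.filter_subset_filter _ hYX)
    exact pow_le_pow_of_le_one le_rfl zero_le_one this
  have hnn : 0 ≤ avg p m (fun t => hits p m i v t * 0 ^ below p m τ X t) :=
    avg_nonneg fun t => mul_nonneg (hits_nonneg _ _ _ _ _) (by positivity)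
  have hpi : (0 : ℝ) < 1 / p := by positivity
  have h1 : 1 / (p : ℝ) * (1 - q) ^ X.card ≤ 1 / p * (1 / 2) ^ β :=
    mul_le_mul_of_nonneg_left hupper hpi.le
  have h2 : 1 / (p : ℝ) * (1 - q) ^ Y.card ≤ 1 / p * (3 * (1 / 2) ^ β) :=
    mul_le_mul_of_nonneg_left hYp hpi.le
  have h3 : 0 ≤ 1 / (p : ℝ) * (1 - q) ^ X.card :=
    mul_nonneg hpi.le (pow_nonneg (by linarith) _)
  have h4 : 0 ≤ 1 / (p : ℝ) * (1 / 2) ^ β := by positivity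
  rw [abs_le] at hYa ⊢
  constructor <;> linarith [hYa.1, hYa.2]

end

/-! ## Isolation of a point at some level -/

/-- Some level contains `i` and no other point of `T`. -/
def Isolated (p m J : ℕ) (T : Finset ℕ) (i t : ℕ) : Prop :=
  ∃ j < J, polyHash p m t i * 2 ^ j < p ∧ ∀ x ∈ T.erase i, ¬ polyHash p m t x * 2 ^ j < p

instance (p m J : ℕ) (T : Finset ℕ) (i t : ℕ) : Decidable (Isolated p m J T i t) :=
  inferInstanceAs (Decidable (∃ j < J, _ ∧ _))

/-- The number of hash values that belong to level `j`. -/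
def cutoff (p j : ℕ) : ℕ := (p - 1) / 2 ^ j + 1

/-- The deepest level that contains the hash value `v`. -/
def deepest (p J v : ℕ) : ℕ := Nat.findGreatest (fun j => v * 2 ^ j < p) (J - 1)

theorem lt_cutoff_iff {p : ℕ} (hp : 0 < p) {j u : ℕ} : u < cutoff p j ↔ u * 2 ^ j < p := by
  rw [cutoff, Nat.lt_succ_iff, Nat.le_div_iff_mul_le (by positivity)]
  omega

theorem cutoff_le {p : ℕ} (hp : 0 < p) (j : ℕ) : cutoff p j ≤ p := by
  have : (p - 1) / 2 ^ j ≤ p - 1 := Nat.div_le_self _ _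
  unfold cutoff; omega

theorem cutoff_anti {p j k : ℕ} (h : j ≤ k) : cutoff p k ≤ cutoff p j := by
  have : (p - 1) / 2 ^ k ≤ (p - 1) / 2 ^ j :=
    Nat.div_le_div_left (Nat.pow_le_pow_right (by norm_num) h) (by positivity)
  unfold cutoff; omega

theorem deepest_spec {p J v : ℕ} (hv : v < p) : v * 2 ^ deepest p J v < p :=
  Nat.findGreatest_spec (P := fun j => v * 2 ^ j < p) (Nat.zero_le _) (by simpa using hv)

theorem le_deepest {p J v j : ℕ} (hj : j < J) (h : v * 2 ^ j < p) : j ≤ deepest p J v :=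
  Nat.le_findGreatest (P := fun j => v * 2 ^ j < p) (by omega) h

theorem deepest_lt {p J v : ℕ} (hJ : 0 < J) : deepest p J v < J := by
  have : deepest p J v ≤ J - 1 := Nat.findGreatest_le _
  omega

/-- The levels decrease, so the deepest level containing `i` has the fewest competitors: `i` is
alone somewhere exactly if it is alone there. -/
theorem isolated_iff {p m J i t : ℕ} {T : Finset ℕ} (hp : 0 < p) (hJ : 0 < J) :
    Isolated p m J T i t ↔
      below p m (cutoff p (deepest p J (polyHash p m t i))) (T.erase i) t = 0 := by
  rw [below, Finset.card_eq_zero, Finset.filter_eq_empty_iff]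
  simp only [lt_cutoff_iff hp]
  constructor
  · rintro ⟨j, hj, h1, h2⟩ x hx h3
    refine h2 x hx (lt_of_le_of_lt (Nat.mul_le_mul_left _ ?_) h3)
    exact Nat.pow_le_pow_right (by norm_num) (le_deepest hj h1)
  · intro h
    exact ⟨_, deepest_lt hJ, deepest_spec (polyHash_lt hp _ _ _), fun x hx => h hx⟩

/-- The probability of isolation under full independence. -/
noncomputable def isoProb (p J k : ℕ) : ℝ :=
  ∑ v ∈ Finset.range p, 1 / (p : ℝ) * (1 - cutoff p (deepest p J v) / p) ^ (k - 1)

/-- Split by the hash value of `i`, which determines its deepest level and thereby the threshold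
that all other points must avoid. There are `p` cases, each with an error of `5 / p * (1 / 2) ^ β`.
-/
theorem avg_isolated {p m J i β : ℕ} {T : Finset ℕ} (hp : p.Prime) (hm : m ≤ p) (hJ : 0 < J)
    (hβ : 4 * β + 1 ≤ m) (hT : T ⊆ Finset.range p) (hi : i ∈ T) :
    |avg p m (fun t => if Isolated p m J T i t then 1 else 0) - isoProb p J T.card| ≤
      5 * (1 / 2) ^ β := by
  have hp0 : (0 : ℝ) < p := by exact_mod_cast hp.pos
  have h1 : ∀ t, (if Isolated p m J T i t then (1 : ℝ) else 0) = ∑ v ∈ Finset.range p,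
      hits p m i v t * 0 ^ below p m (cutoff p (deepest p J v)) (T.erase i) t := fun t => by
    rw [Finset.sum_eq_single (polyHash p m t i)]
    · simp only [isolated_iff hp.pos hJ, hits, if_true, one_mul]
      split_ifs with h
      · rw [h, pow_zero]
      · rw [zero_pow h]
    · intro v _ hv
      rw [hits, if_neg (Ne.symm hv), zero_mul]
    · intro h
      exact absurd (Finset.mem_range.2 (polyHash_lt hp.pos m t i)) h
  simp only [h1]
  rw [avg_sum, isoProb, ← Finset.sum_sub_distrib]
  refine (Finset.abs_sum_le_sum_abs _ _).trans ?_
  calc _ ≤ ∑ _v ∈ Finset.range p, 1 / (p : ℝ) * (5 * (1 / 2) ^ β) := by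
        refine Finset.sum_le_sum fun v hv => ?_
        rw [← Finset.card_erase_of_mem hi]
        exact abs_avg_avoid_sub_le hp hm (Finset.mem_range.1 (hT hi)) (Finset.mem_range.1 hv)
          (cutoff_le hp.pos _) hβ ((Finset.erase_subset _ _).trans hT) (Finset.notMem_erase _ _)
    _ = _ := by
        rw [Finset.sum_const, Finset.card_range, nsmul_eq_mul]
        field_simp

/-- One level suffices. If a point has probability `q` of reaching level `j`, then its deepest level
is at least `j` and every other point reaches that level with probability at most `q`. So `k *
isoProb` is at least `t * (1 - t)` with `t = k * q`, by Bernoulli's inequality, and `t` lies between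
`1 / 4` and `3 / 4` for a suitable `j`. -/
theorem le_card_mul_isoProb {p J k n : ℕ} (hp : 0 < p) (hk : 1 ≤ k) (hkn : k ≤ n)
    (hpn : 4 * n ≤ p) (hJ : n.size + 3 ≤ J) : 3 / 16 ≤ k * isoProb p J k := by
  have hp0 : (0 : ℝ) < p := by exact_mod_cast hp
  -- Here `2 ^ j` lies between `2 * k` and `4 * k`. The rounding in `cutoff` adds at most `1 / p` to
  -- `q`, hence at most `1 / 4` to `k * q`, because `4 * n ≤ p`.
  set j := k.size + 1 with hj
  have hjJ : j < J := by
    have := Nat.size_le_size hkn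
    omega
  set q : ℝ := cutoff p j / p with hq
  have hq1 : q ≤ 1 := by
    rw [hq, div_le_one hp0]; exact_mod_cast cutoff_le hp j
  have hq0 : 0 ≤ q := by positivity
  have h1 : q * (1 - q) ^ (k - 1) ≤ isoProb p J k := by
    have hsub : Finset.range (cutoff p j) ⊆ Finset.range p :=
      Finset.range_subset_range.2 (cutoff_le hp j)
    have hnn : ∀ v, 0 ≤ 1 / (p : ℝ) * (1 - cutoff p (deepest p J v) / p) ^ (k - 1) := fun v => by
      have : (cutoff p (deepest p J v) : ℝ) / p ≤ 1 := by
        rw [div_le_one hp0]; exact_mod_cast cutoff_le hp _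
      exact mul_nonneg (by positivity) (pow_nonneg (by linarith) _)
    calc q * (1 - q) ^ (k - 1)
        = ∑ v ∈ Finset.range (cutoff p j), 1 / (p : ℝ) * (1 - q) ^ (k - 1) := by
          rw [Finset.sum_const, Finset.card_range, nsmul_eq_mul, hq]; ring
      _ ≤ ∑ v ∈ Finset.range (cutoff p j),
            1 / (p : ℝ) * (1 - cutoff p (deepest p J v) / p) ^ (k - 1) := by
          refine Finset.sum_le_sum fun v hv => mul_le_mul_of_nonneg_left ?_ (by positivity)
          refine pow_le_pow_left₀ (by linarith) ?_ _
          have h2 := le_deepest hjJ ((lt_cutoff_iff hp).1 (Finset.mem_range.1 hv))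
          have h3 : (cutoff p (deepest p J v) : ℝ) / p ≤ q := by
            rw [hq]
            gcongr
            exact cutoff_anti h2
          linarith
      _ ≤ _ := Finset.sum_le_sum_of_subset_of_nonneg hsub fun v _ _ => hnn v
  have h2 : 1 - k * q ≤ (1 - q) ^ (k - 1) := by
    have h3 := one_add_mul_le_pow (a := -q) (by linarith) (k - 1)
    have h4 : ((k - 1 : ℕ) : ℝ) ≤ k := by exact_mod_cast Nat.sub_le _ _
    have h5 : ((k - 1 : ℕ) : ℝ) * q ≤ k * q := mul_le_mul_of_nonneg_right h4 hq0
    have h6 : (1 : ℝ) + -q = 1 - q := by ring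
    rw [h6] at h3
    linarith
  have hsz1 : k < 2 ^ k.size := Nat.lt_size_self k
  have hsz2 : 2 ^ k.size ≤ 2 * k := by
    have h3 : k.size ≠ 0 := by
      rw [Ne, Nat.size_eq_zero]; omega
    have h4 : 2 ^ (k.size - 1) ≤ k := Nat.lt_size.1 (by omega)
    have h5 : 2 ^ k.size = 2 ^ (k.size - 1) * 2 := by
      rw [← pow_succ]; congr 1; omega
    omega
  have hpow : (2 : ℝ) ^ j = 2 * 2 ^ k.size := by rw [hj, pow_succ]; ring
  have hsz1' : (k : ℝ) < 2 ^ k.size := by exact_mod_cast hsz1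
  have hsz2' : (2 : ℝ) ^ k.size ≤ 2 * k := by exact_mod_cast hsz2
  have hk0 : (0 : ℝ) < k := by exact_mod_cast hk
  have hj0 : (0 : ℝ) < 2 ^ j := by positivity
  have hlow : 1 / 4 ≤ k * q := by
    have h3 : p ≤ cutoff p j * 2 ^ j := by
      by_contra hcon
      exact lt_irrefl _ ((lt_cutoff_iff hp).2 (not_le.1 hcon))
    have h4 : (p : ℝ) ≤ cutoff p j * 2 ^ j := by exact_mod_cast h3
    have h5 : 1 / 2 ^ j ≤ q := by
      rw [hq, div_le_div_iff₀ hj0 hp0]; linarith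
    calc (1 / 4 : ℝ) ≤ k * (1 / 2 ^ j) := by
          rw [mul_one_div, div_le_div_iff₀ (by norm_num) hj0, hpow]; linarith
      _ ≤ _ := mul_le_mul_of_nonneg_left h5 hk0.le
  have hup : k * q ≤ 3 / 4 := by
    have h3 : (cutoff p j : ℝ) ≤ p / 2 ^ j + 1 := by
      rw [cutoff]
      push_cast
      have h4 : (((p - 1) / 2 ^ j : ℕ) : ℝ) ≤ ((p - 1 : ℕ) : ℝ) / ((2 ^ j : ℕ) : ℝ) :=
        Nat.cast_div_le
      have h5 : ((p - 1 : ℕ) : ℝ) ≤ p := by exact_mod_cast Nat.sub_le _ _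
      have h6 : ((p - 1 : ℕ) : ℝ) / ((2 ^ j : ℕ) : ℝ) ≤ p / 2 ^ j := by
        push_cast
        gcongr
      linarith
    have h4 : q ≤ 1 / 2 ^ j + 1 / p := by
      rw [hq, div_le_iff₀ hp0, add_mul, one_div_mul_cancel hp0.ne']
      calc _ ≤ _ := h3
        _ = _ := by ring
    have h5 : (k : ℝ) * (1 / 2 ^ j) ≤ 1 / 2 := by
      rw [mul_one_div, div_le_div_iff₀ hj0 (by norm_num), hpow]; linarith
    have h6 : (k : ℝ) * (1 / p) ≤ 1 / 4 := by
      rw [mul_one_div, div_le_div_iff₀ hp0 (by norm_num)]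
      have : (4 * k : ℝ) ≤ p := by exact_mod_cast (Nat.mul_le_mul_left 4 hkn).trans hpn
      linarith
    have h7 := mul_le_mul_of_nonneg_left h4 hk0.le
    rw [mul_add] at h7
    linarith
  have h8 : k * (q * (1 - k * q)) ≤ k * isoProb p J k :=
    mul_le_mul_of_nonneg_left ((mul_le_mul_of_nonneg_left h2 hq0).trans h1) hk0.le
  nlinarith

/-! ## Output distribution of one copy -/

theorem scan_spec {T : ℕ → Prop} [DecidablePred T] {o : ℕ} : ∀ {n : ℕ},
    scan T o n = o ∨ (T (scan T o n) ∧ 1 ≤ scan T o n ∧ scan T o n ≤ n)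
  | 0 => Or.inl rfl
  | n + 1 => by
    rw [scan]
    split_ifs with h
    · exact Or.inr ⟨h.2, by omega, le_rfl⟩
    · rcases scan_spec (T := T) (o := o) (n := n) with h1 | ⟨h1, h2, h3⟩
      · exact Or.inl h1
      · exact Or.inr ⟨h1, h2, by omega⟩

theorem scan_ne_zero {T : ℕ → Prop} [DecidablePred T] {o i : ℕ} (hi : 1 ≤ i) (hT : T i) :
    ∀ {n : ℕ}, i ≤ n → scan T o n ≠ 0
  | 0, h => by omega
  | n + 1, h => by
    rw [scan]
    split_ifs with h1
    · omega
    · intro h2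
      rcases Nat.lt_succ_iff_lt_or_eq.1 (Nat.lt_succ_of_le h) with h3 | h3
      · exact scan_ne_zero hi hT (n := n) (by omega) h2
      · exact h1 ⟨h2, h3 ▸ hT⟩

theorem levelScan_spec {p n r : ℕ} {A F : ℕ → ℤ} : ∀ {J : ℕ},
    levelScan p n r A F 0 J = 0 ∨ (1 ≤ levelScan p n r A F 0 J ∧ levelScan p n r A F 0 J ≤ n ∧
      ∃ j < J, Passes p r (A j) (F j) (levelScan p n r A F 0 J))
  | 0 => Or.inl rfl
  | J + 1 => by
    rw [levelScan]
    rcases scan_spec (T := Passes p r (A J) (F J)) (o := levelScan p n r A F 0 J) (n := n) with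
      h | ⟨h1, h2, h3⟩
    · rw [h]
      rcases levelScan_spec (p := p) (n := n) (r := r) (A := A) (F := F) (J := J) with
        h' | ⟨h1, h2, j, hj, h3⟩
      · exact Or.inl h'
      · exact Or.inr ⟨h1, h2, j, by omega, h3⟩
    · exact Or.inr ⟨h2, h3, J, by omega, h1⟩

theorem levelScan_ne_zero {p n r i j : ℕ} {A F : ℕ → ℤ} (hi : 1 ≤ i) (hin : i ≤ n)
    (hT : Passes p r (A j) (F j) i) : ∀ {J : ℕ}, j < J → levelScan p n r A F 0 J ≠ 0
  | 0, h => by omega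
  | J + 1, h => by
    rw [levelScan]
    rcases Nat.lt_succ_iff_lt_or_eq.1 h with h3 | h3
    · have := levelScan_ne_zero hi hin hT (J := J) h3
      rwa [scan_of_ne_zero this]
    · exact scan_ne_zero hi (h3 ▸ hT) hin

/-- The support of `x`, with indices starting at `1`. -/
def support {n : ℕ} (x : Fin n → ℤ) : Finset ℕ :=
  (Finset.univ.filter fun i => x i ≠ 0).image fun i : Fin n => (i : ℕ) + 1

theorem succ_mem_support {n : ℕ} {x : Fin n → ℤ} {i : Fin n} :
    (i : ℕ) + 1 ∈ support x ↔ x i ≠ 0 := by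
  simp only [support, Finset.mem_image, Finset.mem_filter, Finset.mem_univ, true_and]
  constructor
  · rintro ⟨j, hj, h⟩
    rwa [← Fin.ext (Nat.succ_injective h)]
  · exact fun h => ⟨i, h, rfl⟩

theorem mem_support {n : ℕ} {x : Fin n → ℤ} {y : ℕ} :
    y ∈ support x ↔ ∃ i : Fin n, x i ≠ 0 ∧ (i : ℕ) + 1 = y := by
  simp [support]

theorem card_support {n : ℕ} (x : Fin n → ℤ) :
    (support x).card = Nat.card {j // x j ≠ 0} := by
  rw [support, Finset.card_image_of_injective _ fun i j h => Fin.ext (Nat.succ_injective h),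
    Nat.card_eq_fintype_card, Fintype.card_subtype]

/-- The coordinates at level `j`. -/
def levelVec (p m t : ℕ) {n : ℕ} (x : Fin n → ℤ) (j : ℕ) (i : Fin n) : ℤ :=
  if polyHash p m t (i + 1) * 2 ^ j < p then x i else 0

/-- The fingerprint test accepts a level that contains more than one point. -/
def Misled (p m J : ℕ) {n : ℕ} (x : Fin n → ℤ) (r t : ℕ) : Prop :=
  ∃ j < J, ∃ i : Fin n, (∃ l, l ≠ i ∧ levelVec p m t x j l ≠ 0) ∧
    (p : ℤ) ∣ (∑ l, levelVec p m t x j l) * (r : ℤ) ^ ((i : ℕ) + 1) -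
      ∑ l, levelVec p m t x j l * ((r ^ ((l : ℕ) + 1) % p : ℕ) : ℤ)

theorem levelSum_eq (p m V : ℕ) {n : ℕ} (x : Fin n → ℤ) (j : ℕ) :
    levelSum p m V x j = ∑ l, levelVec p m (V / p) x j l := by
  simp only [levelSum, levelVec, hashv_eq_polyHash]

theorem levelPrint_eq (p m V : ℕ) {n : ℕ} (x : Fin n → ℤ) (j : ℕ) :
    levelPrint p m V x j = ∑ l : Fin n, levelVec p m (V / p) x j l *
      (((V % p) ^ ((l : ℕ) + 1) % p : ℕ) : ℤ) := by
  simp only [levelPrint, levelVec, hashv_eq_polyHash, ite_mul, zero_mul]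

/-- Of the two levels the deeper one is contained in the other, so its point is also present at the
shallower level and contradicts isolation there. -/
theorem Isolated.unique {p m J t n : ℕ} {x : Fin n → ℤ} {i k : Fin n}
    (hi : Isolated p m J (support x) (i + 1) t) (hxi : x i ≠ 0)
    (hk : Isolated p m J (support x) (k + 1) t) (hxk : x k ≠ 0) : i = k := by
  by_contra hne
  obtain ⟨j, -, h1, h2⟩ := hi
  obtain ⟨j', -, h3, h4⟩ := hk
  have hne1 : (i : ℕ) + 1 ≠ k + 1 := fun h => hne (Fin.ext (Nat.succ_injective h))
  rcases le_total j j' with h | h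
  · refine h2 _ (Finset.mem_erase.2 ⟨hne1.symm, succ_mem_support.2 hxk⟩) (lt_of_le_of_lt ?_ h3)
    exact Nat.mul_le_mul_left _ (Nat.pow_le_pow_right (by norm_num) h)
  · refine h4 _ (Finset.mem_erase.2 ⟨hne1, succ_mem_support.2 hxi⟩) (lt_of_le_of_lt ?_ h1)
    exact Nat.mul_le_mul_left _ (Nat.pow_le_pow_right (by norm_num) h)

theorem sum_levelVec_of_forall_ne {p m t n j : ℕ} {x : Fin n → ℤ} {i : Fin n}
    (h : ∀ l, l ≠ i → levelVec p m t x j l = 0) (g : Fin n → ℤ) :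
    ∑ l, levelVec p m t x j l * g l = levelVec p m t x j i * g i :=
  Finset.sum_eq_single i (fun l _ hl => by rw [h l hl, zero_mul]) (by simp)

/-- When no test is misled, an index passes at a level only if it is the only support point there.
Conversely an isolated point passes at its level, so the scan finds some index; that index is
isolated too, and isolation is unique. -/
theorem copyOut_eq_iff {p m J V n : ℕ} {x : Fin n → ℤ}
    (hV : ¬ Misled p m J x (V % p) (V / p)) (i : Fin n) :
    copyOut p m J V x = i + 1 ↔ x i ≠ 0 ∧ Isolated p m J (support x) (i + 1) (V / p) := by
  have key : ∀ k : Fin n, copyOut p m J V x = k + 1 →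
      x k ≠ 0 ∧ Isolated p m J (support x) (k + 1) (V / p) := by
    intro k hk
    rcases levelScan_spec (p := p) (n := n) (r := V % p) (A := levelSum p m V x)
      (F := levelPrint p m V x) (J := J) with h | ⟨-, -, j, hj, h⟩
    · rw [copyOut, h] at hk; omega
    · rw [copyOut] at hk
      rw [hk, levelSum_eq, levelPrint_eq] at h
      obtain ⟨hne, hdvd⟩ := h
      have hz : ∀ l, l ≠ k → levelVec p m (V / p) x j l = 0 := by
        intro l hl
        by_contra hcon
        exact hV ⟨j, hj, k, ⟨l, hl, hcon⟩, by exact_mod_cast hdvd⟩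
      have hsum := sum_levelVec_of_forall_ne hz (fun _ => 1)
      simp only [mul_one] at hsum
      rw [hsum, levelVec] at hne
      split_ifs at hne with hlev
      swap
      · exact absurd rfl hne
      refine ⟨hne, j, hj, hlev, fun y hy => ?_⟩
      obtain ⟨hyk, hy⟩ := Finset.mem_erase.1 hy
      obtain ⟨l, hxl, rfl⟩ := mem_support.1 hy
      have h3 := hz l (fun h => hyk (by rw [h]))
      rw [levelVec] at h3
      intro hcon
      rw [if_pos hcon] at h3
      exact hxl h3
  refine ⟨key i, ?_⟩
  rintro ⟨hx, hiso⟩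
  obtain ⟨j, hj, h1, h2⟩ := id hiso
  have hz : ∀ l, l ≠ i → levelVec p m (V / p) x j l = 0 := by
    intro l hl
    rw [levelVec]
    split_ifs with hlev
    · by_contra hcon
      exact h2 _ (Finset.mem_erase.2 ⟨fun h => hl (Fin.ext (Nat.succ_injective h)),
        succ_mem_support.2 hcon⟩) hlev
    · rfl
  have hsum := sum_levelVec_of_forall_ne hz (fun _ => 1)
  simp only [mul_one] at hsum
  have hvi : levelVec p m (V / p) x j i = x i := by rw [levelVec, if_pos h1]
  have hpass : Passes p (V % p) (levelSum p m V x j) (levelPrint p m V x j) (i + 1) := by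
    rw [levelSum_eq, levelPrint_eq, hsum, sum_levelVec_of_forall_ne hz, hvi]
    refine ⟨hx, ?_⟩
    rw [← mul_sub]
    refine Dvd.dvd.mul_left ?_ _
    push_cast
    exact Int.dvd_self_sub_emod
  have hne : copyOut p m J V x ≠ 0 := levelScan_ne_zero (by omega) i.2 hpass hj
  have hle : copyOut p m J V x ≤ n := levelScan_le (Nat.zero_le _) J
  have hk := key ⟨copyOut p m J V x - 1, by omega⟩ (by simp; omega)
  have := Isolated.unique hk.2 hk.1 hiso hx
  rw [← this]
  simp; omega

-- The condition on `r` says that `r` is a root of a polynomial over `ZMod p` of degree at most `n`.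
-- Its coefficient of degree `l + 1` is `-(y l)`, untouched by the monomial of degree `i + 1` and
-- nonzero modulo `p` since `0 < |y l| < p`.
open Polynomial in
theorem card_roots_le {p n M : ℕ} (hp : p.Prime) (hM : M < p) {y : Fin n → ℤ}
    (hy : ∀ l, |y l| ≤ M) {i l : Fin n} (hl : l ≠ i) (hyl : y l ≠ 0) (A : ℤ) :
    ((Finset.range p).filter fun r : ℕ => (p : ℤ) ∣ A * (r : ℤ) ^ ((i : ℕ) + 1) -
      ∑ l : Fin n, y l * ((r ^ ((l : ℕ) + 1) % p : ℕ) : ℤ)).card ≤ n := by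
  have : Fact p.Prime := ⟨hp⟩
  set g : (ZMod p)[X] := C (A : ZMod p) * X ^ ((i : ℕ) + 1) -
    ∑ l : Fin n, C (y l : ZMod p) * X ^ ((l : ℕ) + 1) with hg
  have hcoeff : g.coeff (l + 1) = -(y l : ZMod p) := by
    rw [hg, coeff_sub, coeff_C_mul, coeff_X_pow, finsetSum_coeff,
      Finset.sum_eq_single l, coeff_C_mul, coeff_X_pow, if_pos rfl, if_neg]
    · simp
    · exact fun h => hl (Fin.ext (Nat.succ_injective h))
    · intro k _ hk
      rw [coeff_C_mul, coeff_X_pow, if_neg, mul_zero]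
      exact fun h => hk (Fin.ext (Nat.succ_injective h)).symm
    · simp
  have hg0 : g ≠ 0 := by
    intro h
    rw [h, coeff_zero] at hcoeff
    have h1 : (y l : ZMod p) = 0 := by rw [← neg_eq_zero]; exact hcoeff.symm
    rw [ZMod.intCast_zmod_eq_zero_iff_dvd] at h1
    have h2 := Int.le_of_dvd (abs_pos.2 hyl) ((dvd_abs _ _).2 h1)
    have h3 := hy l
    have h4 : (M : ℤ) < p := by exact_mod_cast hM
    omega
  have hdeg : g.natDegree ≤ n := by
    refine (natDegree_sub_le _ _).trans (max_le ?_ ?_)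
    · exact (natDegree_C_mul_X_pow_le _ _).trans i.2
    · exact natDegree_sum_le_of_forall_le _ _ fun k _ =>
        (natDegree_C_mul_X_pow_le _ _).trans k.2
  have hmap : ∀ r ∈ (Finset.range p).filter fun r : ℕ => (p : ℤ) ∣ A * (r : ℤ) ^ ((i : ℕ) + 1) -
      ∑ l : Fin n, y l * ((r ^ ((l : ℕ) + 1) % p : ℕ) : ℤ), (r : ZMod p) ∈ g.roots.toFinset := by
    intro r hr
    rw [Multiset.mem_toFinset, mem_roots hg0, IsRoot]
    have h1 := (ZMod.intCast_zmod_eq_zero_iff_dvd _ p).2 (Finset.mem_filter.1 hr).2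
    push_cast at h1
    simp only [hg, eval_sub, eval_mul, eval_C, eval_pow, eval_X, eval_finsetSum]
    convert h1 using 3
  calc _ ≤ g.roots.toFinset.card := by
        refine Finset.card_le_card_of_injOn (fun r : ℕ => (r : ZMod p)) hmap ?_
        intro r hr s hs h
        have h1 := Finset.mem_range.1 (Finset.mem_filter.1 hr).1
        have h2 := Finset.mem_range.1 (Finset.mem_filter.1 hs).1
        simp only [ZMod.natCast_eq_natCast_iff', Nat.mod_eq_of_lt h1, Nat.mod_eq_of_lt h2] at h
        exact h
    _ ≤ g.roots.card := Multiset.toFinset_card_le _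
    _ ≤ n := (card_roots' g).trans hdeg

-- Union bound over the `J` levels and the `n` candidate indices, for a fixed hash function.
open Classical in
theorem card_misled_le {p m J n M t : ℕ} (hp : p.Prime) (hM : M < p) {x : Fin n → ℤ}
    (hx : ∀ l, |x l| ≤ M) :
    ((Finset.range p).filter fun r => Misled p m J x r t).card ≤ J * n * n := by
  have hy : ∀ j l, |levelVec p m t x j l| ≤ M := fun j l => by
    rw [levelVec]
    split_ifs
    · exact hx l
    · simp
  calc _ ≤ ((Finset.range J ×ˢ (Finset.univ : Finset (Fin n))).biUnion fun a =>
        (Finset.range p).filter fun r : ℕ => (∃ l, l ≠ a.2 ∧ levelVec p m t x a.1 l ≠ 0) ∧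
          (p : ℤ) ∣ (∑ l, levelVec p m t x a.1 l) * (r : ℤ) ^ ((a.2 : ℕ) + 1) -
          ∑ l, levelVec p m t x a.1 l * ((r ^ ((l : ℕ) + 1) % p : ℕ) : ℤ)).card := by
        refine Finset.card_le_card fun r hr => ?_
        obtain ⟨h1, j, hj, i, h2⟩ := Finset.mem_filter.1 hr
        exact Finset.mem_biUnion.2 ⟨(j, i), by simpa using hj, Finset.mem_filter.2 ⟨h1, h2⟩⟩
    _ ≤ (Finset.range J ×ˢ (Finset.univ : Finset (Fin n))).card * n := by
        refine Finset.card_biUnion_le_card_mul _ _ _ fun a _ => ?_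
        by_cases h : ∃ l, l ≠ a.2 ∧ levelVec p m t x a.1 l ≠ 0
        · obtain ⟨l, hl, hyl⟩ := id h
          simp only [h, true_and]
          exact card_roots_le hp hM (hy a.1) hl hyl _
        · simp [h]
    _ = _ := by simp

theorem sum_range_mul {g : ℕ → ℝ} (p : ℕ) : ∀ N : ℕ,
    ∑ V ∈ Finset.range (p * N), g V = ∑ t ∈ Finset.range N, ∑ r ∈ Finset.range p, g (p * t + r)
  | 0 => by simp
  | N + 1 => by rw [mul_add, mul_one, Finset.sum_range_add, sum_range_mul p N,
      Finset.sum_range_succ]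

/-- The fraction of the seeds for which a copy outputs `i`. -/
noncomputable def copyProb (p m J : ℕ) {n : ℕ} (x : Fin n → ℤ) (i : ℕ) : ℝ :=
  (∑ V ∈ Finset.range (p * p ^ m), if copyOut p m J V x = i then (1 : ℝ) else 0) /
    (p * p ^ m : ℕ)

/-- The lowest digit of the seed is the root, the others form the hash function. For each hash
function, output and isolation can disagree only at the misleading roots, a fraction of at most `J *
n * n / p`. -/
theorem abs_copyProb_sub_le {p m J n M : ℕ} (hp : p.Prime) (hM : M < p) {x : Fin n → ℤ}
    (hx : ∀ l, |x l| ≤ M) (i : Fin n) :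
    |copyProb p m J x (i + 1) - avg p m (fun t =>
      if x i ≠ 0 ∧ Isolated p m J (support x) (i + 1) t then 1 else 0)| ≤ J * n * n / p := by
  classical
  have hp0 : (0 : ℝ) < p := by exact_mod_cast hp.pos
  have hpm : (0 : ℝ) < (p : ℝ) ^ m := by positivity
  have havg : avg p m (fun t =>
      if x i ≠ 0 ∧ Isolated p m J (support x) (i + 1) t then 1 else 0) =
      (∑ V ∈ Finset.range (p * p ^ m),
        if x i ≠ 0 ∧ Isolated p m J (support x) (i + 1) (V / p) then (1 : ℝ) else 0) /
        (p * p ^ m : ℕ) := by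
    rw [sum_range_mul, avg]
    have : ∀ t, ∑ r ∈ Finset.range p,
        (if x i ≠ 0 ∧ Isolated p m J (support x) (i + 1) ((p * t + r) / p) then (1 : ℝ) else 0) =
        p * if x i ≠ 0 ∧ Isolated p m J (support x) (i + 1) t then (1 : ℝ) else 0 := fun t => by
      rw [Finset.sum_congr rfl fun r hr => by
        rw [Nat.mul_add_div hp.pos, Nat.div_eq_of_lt (Finset.mem_range.1 hr), add_zero]]
      rw [Finset.sum_const, Finset.card_range, nsmul_eq_mul]
    simp only [this, ← Finset.mul_sum]
    push_cast
    field_simp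
  rw [havg, copyProb, ← sub_div, ← Finset.sum_sub_distrib, abs_div,
    abs_of_nonneg (by positivity : (0 : ℝ) ≤ ((p * p ^ m : ℕ) : ℝ))]
  have hbad : ∀ V, |(if copyOut p m J V x = i + 1 then (1 : ℝ) else 0) -
      if x i ≠ 0 ∧ Isolated p m J (support x) (i + 1) (V / p) then (1 : ℝ) else 0| ≤
      if Misled p m J x (V % p) (V / p) then 1 else 0 := by
    intro V
    by_cases h : Misled p m J x (V % p) (V / p)
    · rw [if_pos h]
      split_ifs <;> simp
    · rw [if_neg h]
      simp only [copyOut_eq_iff h i, sub_self, abs_zero, le_refl]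
  have h1 : |∑ V ∈ Finset.range (p * p ^ m), ((if copyOut p m J V x = i + 1 then (1 : ℝ) else 0) -
      if x i ≠ 0 ∧ Isolated p m J (support x) (i + 1) (V / p) then (1 : ℝ) else 0)| ≤
      p ^ m * (J * n * n) := by
    refine (Finset.abs_sum_le_sum_abs _ _).trans ((Finset.sum_le_sum fun V _ => hbad V).trans ?_)
    rw [sum_range_mul]
    refine (Finset.sum_le_sum (g := fun _ => (J * n * n : ℝ)) fun t _ => ?_).trans (by simp)
    rw [Finset.sum_congr rfl fun r hr => by
        rw [Nat.mul_add_div hp.pos, Nat.div_eq_of_lt (Finset.mem_range.1 hr), add_zero,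
          Nat.mul_add_mod, Nat.mod_eq_of_lt (Finset.mem_range.1 hr)], Finset.sum_boole]
    exact_mod_cast card_misled_le hp hM hx
  rw [div_le_div_iff₀ (by exact_mod_cast Nat.mul_pos hp.pos (pow_pos hp.pos m)) hp0]
  push_cast
  calc _ ≤ (p : ℝ) ^ m * (J * n * n) * p := mul_le_mul_of_nonneg_right h1 hp0.le
    _ = _ := by ring

/-- The distribution of one copy is close to that of an ideal sampler. -/
theorem copyProb_spec {p m J n M β : ℕ} (hp : p.Prime) (hM : M < p) (hpn : 4 * n ≤ p)
    (hJ : n.size + 3 ≤ J) (hβ : 4 * β + 1 ≤ m) (hm : m ≤ p) {x : Fin n → ℤ}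
    (hx : ∀ l, |x l| ≤ M) (hx0 : x ≠ 0) {η : ℝ}
    (hη : 5 * (1 / 2) ^ β + J * n * n / p ≤ η) (hnη : n * η ≤ 1 / 16) :
    1 / 8 ≤ ∑ i : Fin n, copyProb p m J x (i + 1) ∧
    ∀ i : Fin n, |copyProb p m J x (i + 1) / ∑ l : Fin n, copyProb p m J x (l + 1) - l0Dist x i| ≤
      16 * (n * η) := by
  classical
  set k := (support x).card with hk
  set P := isoProb p J k with hP
  set s := ∑ l : Fin n, copyProb p m J x (l + 1) with hs
  have hβ0 : (0 : ℝ) ≤ 5 * (1 / 2) ^ β := by positivity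
  have hJn : (0 : ℝ) ≤ J * n * n / p := by positivity
  have hη0 : 0 ≤ η := by linarith
  have hT : support x ⊆ Finset.range p := by
    intro y hy
    obtain ⟨i, -, rfl⟩ := mem_support.1 hy
    have := i.2
    exact Finset.mem_range.2 (by omega)
  obtain ⟨i₀, hi₀⟩ := Function.ne_iff.1 hx0
  have hk1 : 1 ≤ k := Finset.card_pos.2 ⟨_, succ_mem_support.2 hi₀⟩
  have hkn : k ≤ n := by
    rw [hk, support]
    exact Finset.card_image_le.trans ((Finset.card_le_univ _).trans (by simp))
  have hkP := le_card_mul_isoProb hp.pos hk1 hkn hpn hJ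
  rw [← hP] at hkP
  have hin : ∀ i : Fin n, x i ≠ 0 → |copyProb p m J x (i + 1) - P| ≤ η := by
    intro i hi
    have h1 := abs_copyProb_sub_le (m := m) (J := J) hp hM hx i
    have h2 := avg_isolated hp hm (by omega : 0 < J) hβ hT (succ_mem_support.2 hi)
    simp only [hi, ne_eq, not_false_eq_true, true_and] at h1
    rw [← hk, ← hP] at h2
    have h3 := abs_sub_le (copyProb p m J x (i + 1))
      (avg p m fun t => if Isolated p m J (support x) (i + 1) t then 1 else 0) P
    linarith
  have hout : ∀ i : Fin n, x i = 0 → |copyProb p m J x (i + 1)| ≤ η := by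
    intro i hi
    have h1 := abs_copyProb_sub_le (m := m) (J := J) hp hM hx i
    simp only [hi, ne_eq, not_true_eq_false, false_and, if_false] at h1
    have h2 : avg p m (fun _ => 0) = 0 := by simp [avg]
    rw [h2, sub_zero] at h1
    linarith
  have hkP' : (k : ℝ) * P = ∑ i : Fin n, if x i ≠ 0 then P else 0 := by
    rw [← Finset.sum_filter, Finset.sum_const, nsmul_eq_mul, hk, support,
      Finset.card_image_of_injective _ fun i j h => Fin.ext (Nat.succ_injective h)]
  have hsk : |s - k * P| ≤ n * η := by
    rw [hs, hkP', ← Finset.sum_sub_distrib]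
    refine (Finset.abs_sum_le_sum_abs _ _).trans ?_
    refine (Finset.sum_le_sum (g := fun _ => η) fun i _ => ?_).trans (by simp)
    split_ifs with h
    · exact hin i h
    · rw [sub_zero]; exact hout i (not_not.1 h)
  -- `3 / 16` from the ideal copy minus the total deviation `n * η ≤ 1 / 16`.
  have hs8 : 1 / 8 ≤ s := by linarith [(abs_le.1 hsk).1]
  refine ⟨hs8, fun i => ?_⟩
  have hs0 : 0 < s := by linarith
  have hn1 : (1 : ℝ) ≤ n := by
    have : 1 ≤ n := hk1.trans hkn
    exact_mod_cast this
  have hnη' : η ≤ n * η := le_mul_of_one_le_left hη0 hn1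
  have hk1' : (1 : ℝ) ≤ k := by exact_mod_cast hk1
  have hkn' : (k : ℝ) ≤ n := by exact_mod_cast hkn
  unfold l0Dist
  split_ifs with h
  · rw [sub_zero, abs_div, abs_of_pos hs0, div_le_iff₀ hs0]
    have := hout i h
    nlinarith
  · rw [← card_support, ← hk, div_sub_div _ _ hs0.ne' (by linarith : (k : ℝ) ≠ 0), abs_div,
      abs_of_pos (by positivity : (0 : ℝ) < s * k), div_le_iff₀ (by positivity)]
    have h1 := hin i h
    -- The numerator is a deviation from ideal values only. It is at most `2 * k * (n * η)`, and
    -- dividing by `s * k` with `s ≥ 1 / 8` gives the factor `16`.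
    have e : copyProb p m J x (i + 1) * k - s * 1 =
        k * (copyProb p m J x (i + 1) - P) - (s - k * P) := by ring
    rw [e]
    have h2 : |(k : ℝ) * (copyProb p m J x (i + 1) - P)| ≤ k * η := by
      rw [abs_mul, abs_of_nonneg (by linarith : (0 : ℝ) ≤ k)]
      exact mul_le_mul_of_nonneg_left h1 (by linarith)
    have h3 : |(k : ℝ) * (copyProb p m J x (i + 1) - P) - (s - k * P)| ≤ k * η + n * η :=
      (abs_sub _ _).trans (add_le_add h2 hsk)
    have h4 : (k : ℝ) * η ≤ k * (n * η) := mul_le_mul_of_nonneg_left hnη' (by linarith)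
    have h5 : n * η ≤ k * (n * η) := le_mul_of_one_le_left (by positivity) hk1'
    have h6 : 0 ≤ k * (n * η) := by positivity
    have h7 : 1 / 8 * (k * (n * η)) ≤ s * (k * (n * η)) := mul_le_mul_of_nonneg_right hs8 h6
    linarith

/-! ## Repetition -/

theorem digit_mod {p m l V : ℕ} (hl : l < m) : V % p ^ m / p ^ l % p = V / p ^ l % p := by
  have h1 : p ^ m = p ^ l * p ^ (m - l) := by rw [← pow_add]; congr 1; omega
  rw [h1, Nat.mod_mul_right_div_self, Nat.mod_mod_of_dvd]
  exact dvd_pow_self p (by omega)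

/-- A copy reads just its root and its `m` hash coefficients, the lowest `m + 1` digits. Hence the
output is a periodic function of the seed. -/
theorem copyOut_mod {p m J V n : ℕ} (x : Fin n → ℤ) :
    copyOut p m J (V % p ^ (m + 1)) x = copyOut p m J V x := by
  have h1 : V % p ^ (m + 1) % p = V % p := Nat.mod_mod_of_dvd _ (dvd_pow_self p (by omega))
  have h2 : ∀ y, hashv p m (V % p ^ (m + 1)) y = hashv p m V y := fun y => by
    unfold hashv
    congr 1
    refine Finset.sum_congr rfl fun l hl => ?_
    rw [digit_mod (by have := Finset.mem_range.1 hl; omega)]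
  have h3 : levelSum p m (V % p ^ (m + 1)) x = levelSum p m V x := by
    funext j; simp only [levelSum, h2]
  have h4 : levelPrint p m (V % p ^ (m + 1)) x = levelPrint p m V x := by
    funext j; simp only [levelPrint, h2, h1]
  rw [copyOut, copyOut, h1, h3, h4]

theorem outOf_mod {p m J U n D : ℕ} (x : Fin n → ℤ) : ∀ c ≤ D,
    outOf p m J (U % (p ^ (m + 1)) ^ D) x c = outOf p m J U x c
  | 0, _ => rfl
  | c + 1, hc => by
    have h1 : (p ^ (m + 1)) ^ D = p ^ ((m + 1) * c) * (p ^ (m + 1)) ^ (D - c) := by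
      rw [pow_mul, ← pow_add]; congr 1; omega
    have h2 : copyOut p m J (U % (p ^ (m + 1)) ^ D / p ^ ((m + 1) * c)) x =
        copyOut p m J (U / p ^ ((m + 1) * c)) x := by
      rw [h1, Nat.mod_mul_right_div_self, ← copyOut_mod,
        Nat.mod_mod_of_dvd _ (dvd_pow_self (p ^ (m + 1)) (by omega)), copyOut_mod]
    rw [outOf, outOf, outOf_mod x c (by omega), h2]

theorem copyOut_le {p m J V n : ℕ} {x : Fin n → ℤ} : copyOut p m J V x ≤ n :=
  levelScan_le (Nat.zero_le _) J

theorem outOf_le {p m J U n : ℕ} {x : Fin n → ℤ} : ∀ c, outOf p m J U x c ≤ n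
  | 0 => Nat.zero_le _
  | c + 1 => by
    rw [outOf]
    split_ifs
    · exact copyOut_le
    · exact outOf_le c

/-- The fraction of the random digits for which `D` copies output `i`. -/
noncomputable def outDist (p m J : ℕ) {n : ℕ} (x : Fin n → ℤ) (D i : ℕ) : ℝ :=
  (∑ U ∈ Finset.range ((p ^ (m + 1)) ^ D), if outOf p m J U x D = i then (1 : ℝ) else 0) /
    ((p ^ (m + 1)) ^ D : ℕ)

theorem copyProb_eq (p m J : ℕ) {n : ℕ} (x : Fin n → ℤ) (i : ℕ) : copyProb p m J x i =
    (∑ V ∈ Finset.range (p ^ (m + 1)), if copyOut p m J V x = i then (1 : ℝ) else 0) /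
      (p ^ (m + 1) : ℕ) := by
  rw [copyProb, ← pow_succ']

/-- Write the seed as `B ^ D * s + U` with `B = p ^ (m + 1)`. The lower part `U` determines the
first `D` copies, the top digit `s` is the seed of the new one, and the two range independently. The
new copy matters only if all earlier ones failed. -/
theorem outDist_succ {p m J n : ℕ} (hp : 0 < p) (x : Fin n → ℤ) (D i : ℕ) :
    outDist p m J x (D + 1) i =
      (if i = 0 then 0 else outDist p m J x D i) + outDist p m J x D 0 * copyProb p m J x i := by
  set B := p ^ (m + 1) with hB
  have hB0 : 0 < B := by positivity
  have hBD : 0 < B ^ D := by positivity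
  have hBD' : ((B ^ D : ℕ) : ℝ) ≠ 0 := by exact_mod_cast hBD.ne'
  have hB' : (B : ℝ) ≠ 0 := by exact_mod_cast hB0.ne'
  have key : ∀ s, ∀ U ∈ Finset.range (B ^ D),
      (if outOf p m J (B ^ D * s + U) x (D + 1) = i then (1 : ℝ) else 0) =
      (if i = 0 then 0 else if outOf p m J U x D = i then 1 else 0) +
        (if outOf p m J U x D = 0 then 1 else 0) * if copyOut p m J s x = i then 1 else 0 := by
    intro s U hU
    have hU' := Finset.mem_range.1 hU
    have h1 : outOf p m J (B ^ D * s + U) x D = outOf p m J U x D := by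
      rw [← outOf_mod x D le_rfl, ← hB, Nat.mul_add_mod, Nat.mod_eq_of_lt hU']
    have h2 : (B ^ D * s + U) / p ^ ((m + 1) * D) = s := by
      rw [pow_mul, ← hB, Nat.mul_add_div hBD, Nat.div_eq_of_lt hU', add_zero]
    rw [outOf, h1, h2]
    by_cases h0 : outOf p m J U x D = 0
    · by_cases hi : i = 0
      · simp [h0, hi]
      · simp [h0, hi, Ne.symm hi]
    · by_cases hi : i = 0
      · simp [h0, hi]
      · simp [h0, hi]
  rw [outDist, copyProb_eq, ← hB, pow_succ B D, sum_range_mul,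
    Finset.sum_congr rfl fun s _ => Finset.sum_congr rfl (key s)]
  simp only [Finset.sum_add_distrib, ← Finset.sum_mul, ← Finset.mul_sum, Finset.sum_const,
    Finset.card_range, nsmul_eq_mul]
  rw [outDist, outDist, ← hB]
  push_cast
  split_ifs
  · simp; field_simp
  · field_simp

theorem outDist_zero {p m J n : ℕ} (hp : 0 < p) (x : Fin n → ℤ) : ∀ D,
    outDist p m J x D 0 = copyProb p m J x 0 ^ D
  | 0 => by simp [outDist, outOf]
  | D + 1 => by rw [outDist_succ hp, outDist_zero hp x D, if_pos rfl, zero_add, pow_succ]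

/-- The geometric series over the first successful copy, with denominators cleared. Dividing by both
success probabilities shows that the conditional law does not depend on the number of copies. -/
theorem outDist_mul {p m J n : ℕ} (hp : 0 < p) (x : Fin n → ℤ) {i : ℕ} (hi : i ≠ 0) : ∀ D,
    outDist p m J x D i * (1 - copyProb p m J x 0) =
      copyProb p m J x i * (1 - copyProb p m J x 0 ^ D)
  | 0 => by simp [outDist, outOf, Ne.symm hi]
  | D + 1 => by
    rw [outDist_succ hp, if_neg hi, outDist_zero hp, add_mul, outDist_mul hp x hi D]
    ring

theorem sum_copyProb {p m J n : ℕ} (hp : 0 < p) (x : Fin n → ℤ) :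
    ∑ i : Fin n, copyProb p m J x (i + 1) = 1 - copyProb p m J x 0 := by
  have hB' : ((p ^ (m + 1) : ℕ) : ℝ) ≠ 0 := by
    have : 0 < p ^ (m + 1) := by positivity
    exact_mod_cast this.ne'
  have h1 : ∑ i ∈ Finset.range (n + 1), copyProb p m J x i = 1 := by
    simp only [copyProb_eq, ← Finset.sum_div]
    rw [Finset.sum_comm, Finset.sum_congr rfl fun V _ => by
      rw [Finset.sum_ite_eq, if_pos (Finset.mem_range.2 (Nat.lt_succ_of_le copyOut_le))]]
    rw [Finset.sum_const, Finset.card_range, nsmul_eq_mul, mul_one, div_self hB']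
  rw [Finset.sum_range_succ', Finset.sum_range fun i => copyProb p m J x (i + 1)] at h1
  linarith

/-! ## Random digits from coin flips -/

theorem sum_range_mul_of_mod {g : ℕ → ℝ} {M : ℕ} (hg : ∀ U, g (U % M) = g U) (q : ℕ) :
    ∑ U ∈ Finset.range (M * q), g U = q * ∑ U ∈ Finset.range M, g U := by
  rw [sum_range_mul, Finset.sum_congr rfl fun t _ => Finset.sum_congr rfl fun r _ => by
    rw [← hg, Nat.mul_add_mod, hg]]
  simp

/-- A periodic function has almost the same average over a long interval as over a period. -/
theorem abs_average_sub_le {g : ℕ → ℝ} {M X : ℕ} (hM : 0 < M) (hX : 0 < X)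
    (hg : ∀ U, g (U % M) = g U) (h0 : ∀ U, 0 ≤ g U) (h1 : ∀ U, g U ≤ 1) :
    |(∑ U ∈ Finset.range X, g U) / X - (∑ U ∈ Finset.range M, g U) / M| ≤ M / X := by
  set G := ∑ U ∈ Finset.range M, g U with hG
  set R := ∑ r ∈ Finset.range (X % M), g (M * (X / M) + r) with hR
  have hM0 : (0 : ℝ) < M := by exact_mod_cast hM
  have hX0 : (0 : ℝ) < X := by exact_mod_cast hX
  have hsum : ∑ U ∈ Finset.range X, g U = (X / M : ℕ) * G + R := by
    conv_lhs => rw [← Nat.div_add_mod X M]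
    rw [Finset.sum_range_add, sum_range_mul_of_mod hg]
  have hXM : (X : ℝ) = M * (X / M : ℕ) + (X % M : ℕ) := by
    exact_mod_cast (Nat.div_add_mod X M).symm
  have hR0 : 0 ≤ R := Finset.sum_nonneg fun r _ => h0 _
  have hR1 : R ≤ (X % M : ℕ) :=
    (Finset.sum_le_sum fun r _ => h1 _).trans (by simp)
  have hG0 : 0 ≤ G := Finset.sum_nonneg fun r _ => h0 _
  have hG1 : G ≤ M := (Finset.sum_le_sum fun r _ => h1 _).trans (by simp)
  have hlt : ((X % M : ℕ) : ℝ) ≤ M := by exact_mod_cast (Nat.mod_lt X hM).le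
  have hr0 : (0 : ℝ) ≤ (X % M : ℕ) := by positivity
  have e : (∑ U ∈ Finset.range X, g U) / X - G / M = (R * M - (X % M : ℕ) * G) / (X * M) := by
    rw [hsum, div_sub_div _ _ hX0.ne' hM0.ne']
    congr 1
    rw [hXM]
    ring
  rw [e, abs_div, abs_of_pos (by positivity : (0 : ℝ) < X * M),
    div_le_div_iff₀ (by positivity) hX0]
  have h2 : |R * M - (X % M : ℕ) * G| ≤ M * M := by
    rw [abs_le]
    constructor <;> nlinarith
  nlinarith [mul_le_mul_of_nonneg_right h2 hX0.le]

/-- The first `W` of `S` coins give a uniform number below `2 ^ W`. -/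
theorem sum_coins (h : ℕ → ℝ) : ∀ (W S u : ℕ), W ≤ S →
    ∑ w : Fin S → Bool, h (((List.ofFn w).take W).foldl (fun u a => 2 * u + a.toNat) u) =
      2 ^ (S - W) * ∑ t ∈ Finset.range (2 ^ W), h (u * 2 ^ W + t)
  | 0, S, u, _ => by simp
  | W + 1, 0, u, hS => by omega
  | W + 1, S + 1, u, hS => by
    have e1 : ∑ w : Fin (S + 1) → Bool,
        h (((List.ofFn w).take (W + 1)).foldl (fun u a => 2 * u + a.toNat) u) =
        ∑ b : Bool, ∑ w : Fin S → Bool,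
          h (((List.ofFn w).take W).foldl (fun u a => 2 * u + a.toNat) (2 * u + b.toNat)) := by
      rw [← Fintype.sum_prod_type']
      refine Fintype.sum_equiv (Fin.consEquiv fun _ => Bool).symm _ _ fun w => ?_
      rw [List.ofFn_succ]
      rfl
    rw [e1, Fintype.sum_bool, sum_coins h W S _ (by omega), sum_coins h W S _ (by omega),
      Nat.add_sub_add_right, ← mul_add, pow_succ 2 W, mul_two, Finset.sum_range_add, add_comm]
    congr 2
    · refine Finset.sum_congr rfl fun t _ => ?_
      congr 1
      simp only [Bool.toNat_false]
      ring
    · refine Finset.sum_congr rfl fun t _ => ?_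
      congr 1
      simp only [Bool.toNat_true]
      ring

theorem card_coins {S W : ℕ} (hW : W ≤ S) (P : ℕ → Prop) [DecidablePred P] :
    (Nat.card {w : Fin S → Bool // P (ofBits ((List.ofFn w).take W))} : ℝ) / 2 ^ S =
      (∑ U ∈ Finset.range (2 ^ W), if P U then (1 : ℝ) else 0) / (2 ^ W : ℕ) := by
  have h := sum_coins (fun U => if P U then (1 : ℝ) else 0) W S 0 hW
  simp only [zero_mul, zero_add] at h
  have e : (Nat.card {w : Fin S → Bool // P (ofBits ((List.ofFn w).take W))} : ℝ) =
      ∑ w : Fin S → Bool, if P (ofBits ((List.ofFn w).take W)) then (1 : ℝ) else 0 := by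
    rw [Nat.card_eq_fintype_card, Fintype.card_subtype, Finset.sum_boole]
  have e2 : (2 : ℝ) ^ S = 2 ^ (S - W) * 2 ^ W := by rw [← pow_add]; congr 1; omega
  rw [e, e2]
  unfold ofBits
  rw [h]
  push_cast
  rw [mul_div_mul_left _ _ (by positivity)]

/-! ## Output distribution of the algorithm -/

/-- Given the coins, runs are deterministic. So exhibiting one run identifies events about the
algorithm with events about the seed. -/
theorem runsIn_unique {A : StreamAlg} {S T n d : ℕ} {L : List (Fin n × ℤ)} {w : List Bool}
    {v v' : ℤ} (h : A.RunsIn S n d L w v) (h' : A.RunsIn T n d L w v') : v = v' := by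
  have hproc : ∀ (L : List (Fin n × ℤ)) (σ σ₁ σ₂ : Store (A.regs + 5)) (w w₁ w₂ : List Bool),
      A.ProcessesIn S L σ w σ₁ w₁ → A.ProcessesIn T L σ w σ₂ w₂ → σ₁ = σ₂ ∧ w₁ = w₂ := by
    intro L
    induction L with
    | nil =>
      rintro σ σ₁ σ₂ w w₁ w₂ ⟨rfl, rfl⟩ ⟨rfl, rfl⟩
      exact ⟨rfl, rfl⟩
    | cons a L ih =>
      rintro σ σ₁ σ₂ w w₁ w₂ ⟨τ, u, h1, h2⟩ ⟨τ', u', h1', h2'⟩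
      obtain ⟨rfl, rfl⟩ := h1.det h1'
      exact ih _ _ _ _ _ _ h2 h2'
  obtain ⟨σ₁, w₁, σ₂, w₂, σ₃, w₃, a1, a2, a3, rfl⟩ := h
  obtain ⟨τ₁, u₁, τ₂, u₂, τ₃, u₃, b1, b2, b3, rfl⟩ := h'
  obtain ⟨rfl, rfl⟩ := a1.det b1
  obtain ⟨rfl, rfl⟩ := hproc _ _ _ _ _ _ _ a2 b2
  obtain ⟨rfl, rfl⟩ := a3.det b3
  rfl

section
variable {A : StreamAlg} {S W n d : ℕ} {L : List (Fin n × ℤ)} {out : ℕ → ℕ}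
  (hW : W ≤ S)
  (hrun : ∀ w : List Bool, W ≤ w.length → A.RunsIn S n d L w (out (ofBits (w.take W)) : ℕ))
include hW hrun

theorem runsIn_ofFn_iff (w : Fin S → Bool) (v : ℕ) :
    A.RunsIn S n d L (List.ofFn w) v ↔ out (ofBits ((List.ofFn w).take W)) = v := by
  have h := hrun (List.ofFn w) (by simpa using hW)
  constructor
  · intro h'
    exact_mod_cast runsIn_unique h h'
  · rintro rfl
    exact h

theorem outProb_eq (i : Fin n) : A.outProb S n d L i =
    (∑ U ∈ Finset.range (2 ^ W), if out U = i + 1 then (1 : ℝ) else 0) / (2 ^ W : ℕ) := by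
  rw [← card_coins hW fun U => out U = i + 1]
  unfold StreamAlg.outProb
  have h := fun w => runsIn_ofFn_iff hW hrun w (i + 1)
  push_cast at h
  simp only [h]

theorem successProb_eq (hout : ∀ U, out U ≤ n) : A.successProb S n d L =
    (∑ U ∈ Finset.range (2 ^ W), if out U ≠ 0 then (1 : ℝ) else 0) / (2 ^ W : ℕ) := by
  rw [← card_coins hW fun U => out U ≠ 0]
  unfold StreamAlg.successProb
  have h : ∀ w : Fin S → Bool, (∃ i : Fin n, A.RunsIn S n d L (List.ofFn w) ((i : ℤ) + 1)) ↔
      out (ofBits ((List.ofFn w).take W)) ≠ 0 := fun w => by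
    have h := fun v => runsIn_ofFn_iff hW hrun w v
    constructor
    · rintro ⟨i, hi⟩
      have := (h (i + 1)).1 (by exact_mod_cast hi)
      omega
    · intro h0
      have h1 := hout (ofBits ((List.ofFn w).take W))
      refine ⟨⟨out (ofBits ((List.ofFn w).take W)) - 1, by omega⟩, ?_⟩
      have h2 := (h _).2 rfl
      convert h2 using 1
      simp only
      omega
  simp only [h]

end

theorem abs_sum_outOf_sub_le {p m J n D W : ℕ} (hp : 0 < p) (x : Fin n → ℤ) {i : ℕ} :
    |(∑ U ∈ Finset.range (2 ^ W), if outOf p m J U x D = i then (1 : ℝ) else 0) / (2 ^ W : ℕ) -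
      outDist p m J x D i| ≤ ((p ^ (m + 1)) ^ D : ℕ) / (2 ^ W : ℕ) := by
  refine abs_average_sub_le (by positivity) (by positivity) (fun U => ?_) (fun U => ?_)
    (fun U => ?_)
  · rw [outOf_mod x D le_rfl]
  · split_ifs <;> norm_num
  · split_ifs <;> norm_num

theorem sum_outOf_ne_zero {p m J n D W : ℕ} (x : Fin n → ℤ) :
    (∑ U ∈ Finset.range (2 ^ W), if outOf p m J U x D ≠ 0 then (1 : ℝ) else 0) / (2 ^ W : ℕ) =
      1 - (∑ U ∈ Finset.range (2 ^ W), if outOf p m J U x D = 0 then (1 : ℝ) else 0) /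
        (2 ^ W : ℕ) := by
  have h0 : ((2 ^ W : ℕ) : ℝ) ≠ 0 := by positivity
  rw [eq_sub_iff_add_eq, ← add_div, ← Finset.sum_add_distrib, div_eq_one_iff_eq h0]
  rw [Finset.sum_congr rfl fun U _ => show _ = (1 : ℝ) by split_ifs <;> simp_all]
  simp

/-- `(7 / 8) ^ 12 ≤ 1 / 4` explains the twelve copies per unit of `d`. They use only half of the
allowed failure `(1 / 2) ^ d`; the other half is left for the bias of the random digits. -/
theorem pow_twelve_mul_le {f : ℝ} (hf0 : 0 ≤ f) (hf : f ≤ 7 / 8) {d : ℕ} (hd : 1 ≤ d) :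
    f ^ (12 * d) ≤ 1 / 2 * (1 / 2) ^ d := by
  have h1 : f ^ 12 ≤ 1 / 4 :=
    (pow_le_pow_left₀ hf0 hf 12).trans (by norm_num)
  have h2 : (1 / 2 : ℝ) ^ d ≤ 1 / 2 :=
    (pow_le_pow_of_le_one (by norm_num) (by norm_num) hd).trans_eq (pow_one _)
  rw [pow_mul]
  refine (pow_le_pow_left₀ (by positivity) h1 d).trans ?_
  rw [show (1 / 4 : ℝ) = 1 / 2 * (1 / 2) by norm_num, mul_pow]
  exact mul_le_mul_of_nonneg_right h2 (by positivity)

/-- Success probability and accuracy of repeated copies with imperfect random digits. -/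
theorem repeated_spec {p m J n d W : ℕ} (hp : 0 < p) {x : Fin n → ℤ} (hd : 1 ≤ d) {κ : ℝ}
    (h8 : 1 / 8 ≤ ∑ i : Fin n, copyProb p m J x (i + 1))
    (hκ : ∀ i : Fin n, |copyProb p m J x (i + 1) / ∑ l : Fin n, copyProb p m J x (l + 1) -
      l0Dist x i| ≤ κ) {θ : ℝ}
    (hθ : (((p ^ (m + 1)) ^ (12 * d) : ℕ) : ℝ) / (2 ^ W : ℕ) ≤ θ)
    (hθd : θ ≤ 1 / 2 * (1 / 2) ^ d) {Qs : ℝ} {Q : Fin n → ℝ}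
    (hQs : Qs = (∑ U ∈ Finset.range (2 ^ W),
      if outOf p m J U x (12 * d) ≠ 0 then (1 : ℝ) else 0) / (2 ^ W : ℕ))
    (hQ : ∀ i, Q i = (∑ U ∈ Finset.range (2 ^ W),
      if outOf p m J U x (12 * d) = i + 1 then (1 : ℝ) else 0) / (2 ^ W : ℕ)) :
    1 - (1 / 2) ^ d ≤ Qs ∧ ∀ i, |Q i / Qs - l0Dist x i| ≤ 4 * θ + κ := by
  set f := copyProb p m J x 0 with hf
  rw [sum_copyProb hp, ← hf] at h8 hκ
  have hf0 : 0 ≤ f := by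
    rw [hf, copyProb]
    exact div_nonneg (Finset.sum_nonneg fun _ _ => by split_ifs <;> norm_num) (by positivity)
  have hfD := pow_twelve_mul_le hf0 (by linarith) hd
  have h0 := abs_sum_outOf_sub_le (m := m) (J := J) (D := 12 * d) (W := W) hp x (i := 0)
  rw [outDist_zero hp, ← hf] at h0
  have hQs' : Qs = 1 - (∑ U ∈ Finset.range (2 ^ W),
      if outOf p m J U x (12 * d) = 0 then (1 : ℝ) else 0) / (2 ^ W : ℕ) := by
    rw [hQs, sum_outOf_ne_zero]
  set P := 1 - f ^ (12 * d) with hP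
  have hQsP : |Qs - P| ≤ θ := by
    rw [hQs', hP, sub_sub_sub_cancel_left, abs_sub_comm]
    exact h0.trans hθ
  have hQs1 : 1 - (1 / 2) ^ d ≤ Qs := by
    have := (abs_le.1 hQsP).1
    linarith
  refine ⟨hQs1, fun i => ?_⟩
  have hhalf : (1 / 2 : ℝ) ^ d ≤ 1 / 2 := by
    calc (1 / 2 : ℝ) ^ d ≤ (1 / 2) ^ 1 := pow_le_pow_of_le_one (by norm_num) (by norm_num) hd
      _ = _ := pow_one _
  have hQs2 : 1 / 2 ≤ Qs := by linarith
  have hQs0 : 0 < Qs := by linarith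
  have hs0 : 0 < 1 - f := by linarith
  have hP0 : 0 < P := by linarith
  have hi := (abs_sum_outOf_sub_le (m := m) (J := J) (D := 12 * d) (W := W) hp x
    (i := i + 1)).trans hθ
  rw [← hQ] at hi
  set R := outDist p m J x (12 * d) (i + 1) with hR
  -- With perfect digits, repetition does not alter the conditional law; only the bias of the coins
  -- remains to be estimated.
  have hRP : R / P = copyProb p m J x (i + 1) / (1 - f) := by
    rw [div_eq_div_iff hP0.ne' hs0.ne']
    exact outDist_mul hp x (by omega) (12 * d)
  have hR0 : 0 ≤ R := by
    rw [hR, outDist]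
    exact div_nonneg (Finset.sum_nonneg fun _ _ => by split_ifs <;> norm_num) (by positivity)
  have hc1 : copyProb p m J x (i + 1) / (1 - f) ≤ 1 := by
    rw [div_le_one hs0, hf, ← sum_copyProb hp]
    refine Finset.single_le_sum (f := fun l : Fin n => copyProb p m J x (l + 1))
      (fun l _ => ?_) (Finset.mem_univ i)
    rw [copyProb]
    exact div_nonneg (Finset.sum_nonneg fun _ _ => by split_ifs <;> norm_num) (by positivity)
  have hθ0 : 0 ≤ θ := (abs_nonneg _).trans hi
  have h1 : |Q i / Qs - R / P| ≤ 4 * θ := by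
    -- As `R / P ≤ 1`, the numerator is at most `2 * θ`, and `Qs ≥ 1 / 2`.
    have e : Q i / Qs - R / P = ((Q i - R) - R / P * (Qs - P)) / Qs := by
      field_simp
      ring
    rw [e, abs_div, abs_of_pos hQs0, div_le_iff₀ hQs0]
    have h2 : |R / P * (Qs - P)| ≤ θ := by
      rw [abs_mul, abs_of_nonneg (div_nonneg hR0 hP0.le), hRP]
      calc _ ≤ 1 * |Qs - P| := mul_le_mul_of_nonneg_right hc1 (abs_nonneg _)
        _ ≤ _ := by rw [one_mul]; exact hQsP
    have h3 := (abs_sub (Q i - R) (R / P * (Qs - P))).trans (add_le_add hi h2)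
    nlinarith
  have h2 := hκ i
  rw [← hRP] at h2
  calc _ ≤ |Q i / Qs - R / P| + |R / P - l0Dist x i| := abs_sub_le _ _ _
    _ ≤ _ := add_le_add h1 h2

/-! ## Choice of the constants -/

theorem size_le_self (n : ℕ) : n.size ≤ n := Nat.size_le.2 Nat.lt_two_pow_self

theorem two_le_size {n : ℕ} (hn : 2 ≤ n) : 2 ≤ n.size := by
  have : (2 : ℕ) ^ 1 ≤ n := by simpa using hn
  exact Nat.lt_size.2 this

/-- Bertrand's postulate: the least prime is at most `2 * n ^ e`. -/
theorem leastPrime_lt {n e : ℕ} (hn : 2 ≤ n) : leastPrime (n ^ e) ≤ 2 ^ (e * n.size + 1) := by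
  obtain ⟨q, hq, h1, h2⟩ := Nat.exists_prime_lt_and_le_two_mul (n ^ e) (by positivity)
  have h3 := leastPrime_le h1.le hq
  have h4 : n ^ e ≤ (2 ^ n.size) ^ e := Nat.pow_le_pow_left (Nat.lt_size_self n).le e
  rw [← pow_mul, mul_comm] at h4
  rw [pow_succ]
  omega

/-- A register length that suffices. -/
def width (κ e γ n d : ℕ) : ℕ :=
  coins κ e γ n d + 6 * ((n.size + 3) * (12 * d)) * (e * n.size + 1) + 2 * (e * n.size + 1) +
    (κ * n.size + 2) + n.size * (κ * n.size + 2) + (n.size + 3) + 12 * d + n.size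

theorem fits {κ e γ n d U : ℕ} (hn : 2 ≤ n) (hnp : n < leastPrime (n ^ e))
    (hU : U < 2 ^ coins κ e γ n d) :
    Fits (width κ e γ n d) n (leastPrime (n ^ e)) (κ * n.size + 2) (n.size + 3) (12 * d) U := by
  have hp := leastPrime_lt (e := e) hn
  have hpp := leastPrime_prime (n ^ e)
  set p := leastPrime (n ^ e)
  set L := n.size
  set m := κ * L + 2 with hm
  set J := L + 3 with hJ
  set D := 12 * d
  set l := e * L + 1
  have hb : width κ e γ n d = coins κ e γ n d + 6 * (J * D) * l + 2 * l + m + L * m + J + D + L := rfl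
  set b := width κ e γ n d
  have hpow : ∀ {s : ℕ}, s ≤ b → 2 ^ s ≤ 2 ^ b := fun h => Nat.pow_le_pow_right (by norm_num) h
  have hself : ∀ {s : ℕ}, s ≤ b → s ≤ 2 ^ b := fun h => Nat.lt_two_pow_self.le.trans (hpow h)
  have hnm : n ^ m ≤ 2 ^ (L * m) := by
    rw [pow_mul]; exact Nat.pow_le_pow_left (Nat.lt_size_self n).le m
  refine ⟨hpp.two_le, by omega, hself (by omega), hself (by omega), hself (by omega),
    hU.le.trans (hpow (by omega)), ?_, hnm.trans (hpow (by omega)), ?_, ?_, ?_, hnp⟩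
  · calc m * p * n ^ m ≤ 2 ^ m * 2 ^ l * 2 ^ (L * m) :=
          Nat.mul_le_mul (Nat.mul_le_mul Nat.lt_two_pow_self.le hp) hnm
      _ = 2 ^ (m + l + L * m) := by rw [← pow_add, ← pow_add]
      _ ≤ _ := hpow (by omega)
  · calc p * 2 ^ J ≤ 2 ^ l * 2 ^ J := Nat.mul_le_mul_right _ hp
      _ = 2 ^ (l + J) := by rw [← pow_add]
      _ ≤ _ := hpow (by omega)
  · calc p ^ (6 * (J * D)) ≤ (2 ^ l) ^ (6 * (J * D)) := Nat.pow_le_pow_left hp _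
      _ = 2 ^ (6 * (J * D) * l) := by rw [← pow_mul, mul_comm]
      _ ≤ _ := hpow (by omega)
  · calc p ^ 2 ≤ (2 ^ l) ^ 2 := Nat.pow_le_pow_left hp _
      _ = 2 ^ (2 * l) := by rw [← pow_mul, mul_comm]
      _ ≤ _ := hpow (by omega)

theorem width_le {κ e γ n d : ℕ} (hn : 2 ≤ n) (hd : 1 ≤ d) :
    width κ e γ n d + 1 ≤
      (12 * (κ + 3) * (e + 1) + γ + 300 * (e + 1) + 2 * (κ + 2) + 100) * (n.size ^ 2 * d) := by
  have hL := two_le_size hn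
  unfold width coins
  set L := n.size
  have h1 : κ * L + 2 + 1 ≤ (κ + 3) * L := by nlinarith
  have h2 : e * L + 1 ≤ (e + 1) * L := by nlinarith
  have h3 : κ * L + 2 ≤ (κ + 2) * L := by nlinarith
  have h4 : L + 3 ≤ 4 * L := by omega
  have hLd : L ≤ L ^ 2 * d := by
    calc L = L * 1 * 1 := by ring
      _ ≤ L * L * d := Nat.mul_le_mul (Nat.mul_le_mul_left _ (by omega)) hd
      _ = _ := by ring
  have hdL : d ≤ L ^ 2 * d := Nat.le_mul_of_pos_left _ (by positivity)
  have hL2 : L ^ 2 ≤ L ^ 2 * d := Nat.le_mul_of_pos_right _ (by omega)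
  have a1 : 12 * d * (κ * L + 2 + 1) * (e * L + 1) ≤ 12 * (κ + 3) * (e + 1) * (L ^ 2 * d) := by
    calc _ ≤ 12 * d * ((κ + 3) * L) * ((e + 1) * L) :=
          Nat.mul_le_mul (Nat.mul_le_mul_left _ h1) h2
      _ = _ := by ring
  have a2 : γ * L ≤ γ * (L ^ 2 * d) := Nat.mul_le_mul_left _ hLd
  have a3 : 6 * ((L + 3) * (12 * d)) * (e * L + 1) ≤ 288 * (e + 1) * (L ^ 2 * d) := by
    calc _ ≤ 6 * ((4 * L) * (12 * d)) * ((e + 1) * L) :=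
          Nat.mul_le_mul (Nat.mul_le_mul_left _ (Nat.mul_le_mul_right _ h4)) h2
      _ = _ := by ring
  have a4 : 2 * (e * L + 1) ≤ 2 * (e + 1) * (L ^ 2 * d) := by
    calc _ ≤ 2 * ((e + 1) * L) := Nat.mul_le_mul_left _ h2
      _ = 2 * (e + 1) * L := by ring
      _ ≤ _ := Nat.mul_le_mul_left _ hLd
  have a5 : κ * L + 2 ≤ (κ + 2) * (L ^ 2 * d) := h3.trans (Nat.mul_le_mul_left _ hLd)
  have a6 : L * (κ * L + 2) ≤ (κ + 2) * (L ^ 2 * d) := by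
    calc _ ≤ L * ((κ + 2) * L) := Nat.mul_le_mul_left _ h3
      _ = (κ + 2) * L ^ 2 := by ring
      _ ≤ _ := Nat.mul_le_mul_left _ hL2
  have e1 : (12 * (κ + 3) * (e + 1) + γ + 300 * (e + 1) + 2 * (κ + 2) + 100) * (L ^ 2 * d) =
      12 * (κ + 3) * (e + 1) * (L ^ 2 * d) + γ * (L ^ 2 * d) + 288 * (e + 1) * (L ^ 2 * d) +
      2 * (e + 1) * (L ^ 2 * d) + (κ + 2) * (L ^ 2 * d) + (κ + 2) * (L ^ 2 * d) +
      10 * (e + 1) * (L ^ 2 * d) + 100 * (L ^ 2 * d) := by ring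
  rw [e1]
  have a7 : 0 ≤ 10 * (e + 1) * (L ^ 2 * d) := Nat.zero_le _
  omega

/-- The binary length exceeds `log₂ n` by at most `1`; the factor `2` absorbs this because the
length is at least `2`. -/
theorem size_le_log {n : ℕ} (hn : 2 ≤ n) : (n.size : ℝ) ≤ 2 * (Real.log n / Real.log 2) := by
  have h2 := two_le_size hn
  have hlog2 : 0 < Real.log 2 := Real.log_pos (by norm_num)
  have h1 : 2 ^ (n.size - 1) ≤ n := Nat.lt_size.1 (by omega)
  have h3 : ((n.size - 1 : ℕ) : ℝ) * Real.log 2 ≤ Real.log n := by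
    rw [← Real.log_pow]
    exact Real.log_le_log (by positivity) (by exact_mod_cast h1)
  have h4 : (n.size : ℝ) ≤ 2 * ((n.size - 1 : ℕ) : ℝ) := by
    have : n.size ≤ 2 * (n.size - 1) := by omega
    exact_mod_cast this
  rw [← le_div_iff₀ hlog2] at h3
  linarith

theorem ceil_le_log {δ : ℝ} (hδ0 : 0 < δ) (hδ : δ ≤ 1 / 2) :
    1 ≤ ⌈Real.logb 2 (1 / δ)⌉₊ ∧
    (⌈Real.logb 2 (1 / δ)⌉₊ : ℝ) ≤ 2 * (Real.log (1 / δ) / Real.log 2) ∧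
    (1 / 2 : ℝ) ^ ⌈Real.logb 2 (1 / δ)⌉₊ ≤ δ := by
  have hlog2 : 0 < Real.log 2 := Real.log_pos (by norm_num)
  have h1 : 1 ≤ Real.logb 2 (1 / δ) := by
    rw [Real.le_logb_iff_rpow_le (by norm_num) (by positivity), Real.rpow_one,
      le_div_iff₀ hδ0]
    linarith
  refine ⟨Nat.one_le_ceil_iff.2 (by linarith), ?_, ?_⟩
  · have := (Nat.ceil_lt_add_one (by linarith : 0 ≤ Real.logb 2 (1 / δ))).le
    rw [← Real.log_div_log] at *
    linarith
  · have h2 := Nat.le_ceil (Real.logb 2 (1 / δ))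
    rw [Real.logb_le_iff_le_rpow (by norm_num) (by positivity), Real.rpow_natCast] at h2
    generalize ⌈Real.logb 2 (1 / δ)⌉₊ = k at h2 ⊢
    rw [one_div, inv_pow]
    rw [one_div] at h2
    exact inv_le_of_inv_le₀ hδ0 h2

theorem inv_two_pow_size_le {n : ℕ} (hn : 2 ≤ n) (k j : ℕ) :
    (1 / 2 : ℝ) ^ ((k + j) * n.size) ≤ 1 / (n : ℝ) ^ k * (1 / 4) ^ j := by
  have hn0 : (0 : ℝ) < n := by positivity
  have h1 : (1 / 2 : ℝ) ^ n.size ≤ 1 / n := by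
    rw [div_pow, one_pow]
    exact one_div_le_one_div_of_le hn0 (by exact_mod_cast (Nat.lt_size_self n).le)
  have h2 : (1 / 2 : ℝ) ^ n.size ≤ 1 / 4 := by
    calc (1 / 2 : ℝ) ^ n.size ≤ (1 / 2) ^ 2 :=
          pow_le_pow_of_le_one (by norm_num) (by norm_num) (two_le_size hn)
      _ = _ := by norm_num
  rw [mul_comm, pow_mul, pow_add]
  refine mul_le_mul ?_ (pow_le_pow_left₀ (by positivity) h2 j) (by positivity) (by positivity)
  calc _ ≤ (1 / n : ℝ) ^ k := pow_le_pow_left₀ (by positivity) h1 k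
    _ = _ := by rw [div_pow, one_pow]

/-- The error of one copy. -/
theorem copy_error_le {n p c : ℕ} (hn : 2 ≤ n) (hp : n ^ (c + 12) ≤ p) :
    n * (5 * (1 / 2 : ℝ) ^ ((c + 6) * n.size) + ((n.size + 3 : ℕ) : ℝ) * n * n / p) ≤
      1 / 32 * (1 / (n : ℝ) ^ c) := by
  have hn0 : (0 : ℝ) < n := by positivity
  have hp0 : (0 : ℝ) < p := by
    have : 0 < n ^ (c + 12) := by positivity
    exact_mod_cast this.trans_le hp
  have hnc : (0 : ℝ) < (n : ℝ) ^ c := by positivity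
  have h1 := inv_two_pow_size_le hn (c + 1) 5
  rw [show c + 1 + 5 = c + 6 by ring] at h1
  have h2 : n * (5 * (1 / 2 : ℝ) ^ ((c + 6) * n.size)) ≤ 1 / 64 * (1 / (n : ℝ) ^ c) := by
    calc n * (5 * (1 / 2 : ℝ) ^ ((c + 6) * n.size))
        ≤ n * (5 * (1 / (n : ℝ) ^ (c + 1) * (1 / 4) ^ 5)) := by gcongr
      _ = 5 / 1024 * (1 / (n : ℝ) ^ c) := by rw [pow_succ]; field_simp; norm_num
      _ ≤ _ := mul_le_mul_of_nonneg_right (by norm_num) (by positivity)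
  have h3 : n * (((n.size + 3 : ℕ) : ℝ) * n * n / p) ≤ 1 / 64 * (1 / (n : ℝ) ^ c) := by
    have h4 : 256 * n ^ (c + 4) ≤ p := by
      refine le_trans ?_ hp
      rw [show c + 12 = 8 + (c + 4) by ring, pow_add n 8]
      exact Nat.mul_le_mul_right _ (le_trans (by norm_num) (Nat.pow_le_pow_left hn 8))
    have h4' : 256 * (n : ℝ) ^ (c + 4) ≤ p := by exact_mod_cast h4
    have h5 : ((n.size + 3 : ℕ) : ℝ) ≤ 4 * n := by
      have := size_le_self n
      have : n.size + 3 ≤ 4 * n := by omega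
      exact_mod_cast this
    calc n * (((n.size + 3 : ℕ) : ℝ) * n * n / p)
        ≤ n * (4 * n * n * n / (256 * (n : ℝ) ^ (c + 4))) := by gcongr
      _ = 1 / 64 * (1 / (n : ℝ) ^ c) := by rw [pow_add]; field_simp; norm_num
  rw [mul_add]
  linarith

/-- Independence at `m` points needs `m` distinct elements of the field. -/
theorem digits_le {n p c : ℕ} (hn : 2 ≤ n) (hp : n ^ (c + 12) ≤ p) :
    4 * (c + 6) * n.size + 2 ≤ p := by
  have h1 : c + 6 ≤ n ^ (c + 6) :=
    Nat.lt_two_pow_self.le.trans (Nat.pow_le_pow_left hn _)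
  have h2 := size_le_self n
  have h3 : 32 ≤ n ^ 5 := le_trans (by norm_num) (Nat.pow_le_pow_left hn 5)
  have h4 : n ^ (c + 12) = n ^ (c + 6) * n * n ^ 5 := by ring
  have h5 : (c + 6) * n.size ≤ n ^ (c + 6) * n := Nat.mul_le_mul h1 h2
  have h6 : n ^ (c + 6) * n * 32 ≤ n ^ (c + 6) * n * n ^ 5 := Nat.mul_le_mul_left _ h3
  have h7 : 1 ≤ n ^ (c + 6) * n := Nat.mul_pos (by positivity) (by omega)
  have h8 : 4 * (c + 6) * n.size = 4 * ((c + 6) * n.size) := by ring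
  omega

end Sampler
end L0Streaming

/-! ### The main theorem -/

open L0Streaming L0Streaming.Sampler in
/-- For all constants `a` (the coordinates are bounded by `n ^ a` throughout the stream) and `c`
(the accuracy `n ^ (-c)`) there is a zero relative error `L₀`-sampler with `O(log² n log (1/δ))`
bits of space, random bits included, that outputs a coordinate with probability at least `1 - δ`. -/
theorem theoreml0 (a c : ℕ) :
    ∃ (A : L0Streaming.StreamAlg) (C : ℝ), ∀ n : ℕ, 2 ≤ n → ∀ δ : ℝ, 0 < δ → δ ≤ 1 / 2 →
      ∃ S : ℕ, (S : ℝ) ≤ C * Real.log n ^ 2 * Real.log (1 / δ) ∧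
        ∀ L : List (Fin n × ℤ), L0Streaming.BoundedThroughout (n ^ a) L →
          A.HasSpace S n ⌈Real.logb 2 (1 / δ)⌉₊ L ∧
          (L0Streaming.streamVec L ≠ 0 →
            1 - δ ≤ A.successProb S n ⌈Real.logb 2 (1 / δ)⌉₊ L ∧
            ∀ i : Fin n,
              |A.outProb S n ⌈Real.logb 2 (1 / δ)⌉₊ L i /
                  A.successProb S n ⌈Real.logb 2 (1 / δ)⌉₊ L -
                L0Streaming.l0Dist (L0Streaming.streamVec L) i| ≤ 1 / (n : ℝ) ^ c) := by
  -- With `β = (c + 6) * n.size` the hash function has `4 * β + 2` coefficients, enough for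
  -- truncation at order `4 * β`.
  obtain ⟨κ, hκ⟩ : ∃ κ, κ = 4 * (c + 6) := ⟨_, rfl⟩
  -- The prime exceeds both `n ^ (a + 1)`, so that sketch digits can be decoded, and `n ^ (c + 12)`,
  -- so that misleading roots are rare enough.
  obtain ⟨e, he⟩ : ∃ e, e = a + c + 12 := ⟨_, rfl⟩
  -- The `γ * n.size` surplus coins push the bias of the digits below `n ^ (-c) / 64`.
  obtain ⟨γ, hγ⟩ : ∃ γ, γ = c + 3 := ⟨_, rfl⟩
  obtain ⟨A, hA⟩ : ∃ A, A = sampler κ e γ := ⟨_, rfl⟩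
  -- The final `1` ensures `K ≥ 1`, so that `S` also bounds the number of coins.
  obtain ⟨K, hK⟩ : ∃ K, K = A.init.cst + A.update.cst + A.output.cst + 1 := ⟨_, rfl⟩
  obtain ⟨K', hK'⟩ : ∃ K', K' =
    12 * (κ + 3) * (e + 1) + γ + 300 * (e + 1) + 2 * (κ + 2) + 100 := ⟨_, rfl⟩
  -- The `8 / Real.log 2 ^ 3` converts `n.size ^ 2 * d` to natural logarithms: each of the three
  -- factors is at most twice its binary logarithm.
  refine ⟨A, K * K' * 8 / Real.log 2 ^ 3, fun n hn δ hδ0 hδ => ?_⟩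
  obtain ⟨hd1, hd2, hd3⟩ := ceil_le_log hδ0 hδ
  generalize ⌈Real.logb 2 (1 / δ)⌉₊ = d at *
  obtain ⟨b, hb⟩ : ∃ b, b = width κ e γ n d := ⟨_, rfl⟩
  obtain ⟨p, hp⟩ : ∃ p, p = leastPrime (n ^ e) := ⟨_, rfl⟩
  have hpp : p.Prime := hp ▸ leastPrime_prime _
  have hnep : n ^ e ≤ p := hp ▸ le_leastPrime _
  have hn1 : 1 ≤ n := by omega
  have hlow : ∀ k ≤ e, n ^ k ≤ p := fun k hk => (Nat.pow_le_pow_right hn1 hk).trans hnep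
  have hpn : 4 * n ≤ p := by
    refine le_trans ?_ (hlow 3 (by omega))
    rw [pow_succ]
    exact Nat.mul_le_mul_right _ (Nat.pow_le_pow_left hn 2)
  have hnM : n * n ^ a ≤ p := by
    rw [← pow_succ']; exact hlow _ (by omega)
  have hM : n ^ a < p := by
    have : 0 < n ^ a := by positivity
    nlinarith
  have hp2 : p ≤ 2 ^ (e * n.size + 1) := hp ▸ leastPrime_lt hn
  have hwid := width_le (κ := κ) (e := e) (γ := γ) hn hd1
  rw [← hb, ← hK'] at hwid
  have hWb : coins κ e γ n d ≤ b := by rw [hb, width]; omega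
  have hpow : ∀ {s : ℕ}, s ≤ b → 2 ^ s ≤ 2 ^ b := fun h => Nat.pow_le_pow_right (by norm_num) h
  obtain ⟨S, hS⟩ : ∃ S, S = K * (b + 1) := ⟨_, rfl⟩
  have hWS : coins κ e γ n d ≤ S := by
    rw [hS]
    calc coins κ e γ n d ≤ 1 * (b + 1) := by omega
      _ ≤ _ := Nat.mul_le_mul_right _ (by omega)
  refine ⟨S, ?_, fun L hL => ?_⟩
  · have h1 : (S : ℝ) ≤ K * (K' * ((n.size : ℝ) ^ 2 * d)) := by
      have : S ≤ K * (K' * (n.size ^ 2 * d)) := hS ▸ Nat.mul_le_mul_left _ hwid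
      exact_mod_cast this
    have h2 := size_le_log hn
    have hlog2 : 0 < Real.log 2 := Real.log_pos (by norm_num)
    have hlogn : 0 ≤ Real.log n := Real.log_nonneg (by exact_mod_cast hn1)
    calc (S : ℝ) ≤ K * (K' * ((n.size : ℝ) ^ 2 * d)) := h1
      _ ≤ K * (K' * ((2 * (Real.log n / Real.log 2)) ^ 2 *
          (2 * (Real.log (1 / δ) / Real.log 2)))) := by gcongr
      _ = _ := by field_simp; ring
  have hrun : ∀ w : List Bool, coins κ e γ n d ≤ w.length →
      A.RunsIn S n d L w (outOf p (κ * n.size + 2) (n.size + 3)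
        (ofBits (w.take (coins κ e γ n d))) (streamVec L) (12 * d) : ℕ) := by
    intro w hw
    rw [hp] at hnM hM hp2 ⊢
    rw [hA] at hK ⊢
    refine sampler_runsIn (b := b) (M := n ^ a) ?_ hn (by omega)
      (fun U hU => hb ▸ fits hn (by omega) hU) hnM ?_ ?_ ?_ ?_ hWb ?_ hw L hL
    · rw [hb, width]; omega
    · exact Nat.lt_two_pow_self.le.trans (hpow (by rw [hb, width]; omega))
    · exact Nat.lt_two_pow_self.le.trans (hpow (by rw [hb, width]; omega))
    · calc 2 * n ^ a ≤ n * n ^ a := Nat.mul_le_mul_right _ hn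
        _ ≤ 2 ^ (e * n.size + 1) := hnM.trans hp2
        _ ≤ _ := hpow (by rw [hb, width]; omega)
    · rw [← mul_assoc]
      calc _ ≤ 2 ^ (e * n.size + 1) *
            (2 ^ (e * n.size + 1)) ^ (6 * ((n.size + 3) * (12 * d))) :=
            Nat.mul_le_mul (hnM.trans hp2) (Nat.pow_le_pow_left hp2 _)
        _ = 2 ^ (e * n.size + 1 + 6 * ((n.size + 3) * (12 * d)) * (e * n.size + 1)) := by
            rw [← pow_mul, ← pow_add, mul_comm (e * n.size + 1)]
        _ ≤ _ := hpow (by rw [hb, width]; omega)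
    · rw [hS, hK]; exact Nat.mul_le_mul_right _ (by omega)
  refine ⟨fun w => ⟨_, hrun _ (by simpa using hWS)⟩, fun hx0 => ?_⟩
  have hx : ∀ i, |streamVec L i| ≤ ((n ^ a : ℕ) : ℤ) := hL L List.prefix_rfl
  have hnc : (0 : ℝ) < 1 / (n : ℝ) ^ c := by positivity
  have hnc1 : 1 / (n : ℝ) ^ c ≤ 1 := by
    rw [div_le_one (by positivity)]
    exact one_le_pow₀ (by exact_mod_cast hn1)
  have hpc : n ^ (c + 12) ≤ p := hlow _ (by omega)
  have herr := copy_error_le hn hpc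
  obtain ⟨h8, hcopy⟩ := copyProb_spec (m := κ * n.size + 2) (J := n.size + 3)
    (β := (c + 6) * n.size) hpp hM hpn le_rfl (by rw [hκ, mul_assoc]; omega)
    (hκ ▸ digits_le hn hpc) hx hx0 le_rfl (herr.trans (by linarith))
  -- All seeds together need at most `12 * d * (κ * n.size + 3) * (e * n.size + 1)` bits. The bias
  -- is governed by the coins beyond that number, `d + γ * n.size` of them.
  have hθ : (((p ^ (κ * n.size + 2 + 1)) ^ (12 * d) : ℕ) : ℝ) / (2 ^ coins κ e γ n d : ℕ) ≤
      (1 / 2) ^ (d + γ * n.size) := by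
    have h1 : (p ^ (κ * n.size + 2 + 1)) ^ (12 * d) ≤
        2 ^ (12 * d * (κ * n.size + 2 + 1) * (e * n.size + 1)) := by
      calc (p ^ (κ * n.size + 2 + 1)) ^ (12 * d)
          ≤ ((2 ^ (e * n.size + 1)) ^ (κ * n.size + 2 + 1)) ^ (12 * d) :=
            Nat.pow_le_pow_left (Nat.pow_le_pow_left hp2 _) _
        _ = _ := by rw [← pow_mul, ← pow_mul]; congr 1; ring
    have h2 : (((p ^ (κ * n.size + 2 + 1)) ^ (12 * d) : ℕ) : ℝ) ≤
        2 ^ (12 * d * (κ * n.size + 2 + 1) * (e * n.size + 1)) := by exact_mod_cast h1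
    rw [div_le_iff₀ (by positivity)]
    refine h2.trans_eq ?_
    rw [coins]
    push_cast
    generalize 12 * d * (κ * n.size + 2 + 1) * (e * n.size + 1) = t
    rw [add_assoc, pow_add 2 t, mul_left_comm, ← mul_pow]
    norm_num
  have hγ1 : (1 / 2 : ℝ) ^ (γ * n.size) ≤ 1 / 64 * (1 / (n : ℝ) ^ c) := by
    rw [hγ]
    refine (inv_two_pow_size_le hn c 3).trans_eq ?_
    ring
  have hdpos : (0 : ℝ) < (1 / 2) ^ d := by positivity
  have hd1' : (1 / 2 : ℝ) ^ d ≤ 1 := pow_le_one₀ (by norm_num) (by norm_num)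
  have hγ0 : (0 : ℝ) < (1 / 2) ^ (γ * n.size) := by positivity
  obtain ⟨h1, h2⟩ := repeated_spec (J := n.size + 3) hpp.pos hd1 h8 hcopy hθ
    (by rw [pow_add, mul_comm]; exact mul_le_mul_of_nonneg_right (by linarith) hdpos.le)
    (successProb_eq hWS hrun fun U => outOf_le _) (outProb_eq hWS hrun)
  -- The error is at most `4 / 64 + 16 / 32 = 9 / 16` times `n ^ (-c)`: the bias of the coins plus
  -- the deviation of one copy.
  refine ⟨by linarith, fun i => (h2 i).trans ?_⟩
  have h3 : (1 / 2 : ℝ) ^ (d + γ * n.size) ≤ 1 / 64 * (1 / (n : ℝ) ^ c) := by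
    rw [pow_add]
    exact (mul_le_of_le_one_left hγ0.le hd1').trans hγ1
  linarith
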